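/- Let $A$ be a finite dimensional Hopf algebra over a field $\mathbf{k}$, with coproduct $\Delta(a)=\sum a_1\otimes a_2$, counit $\varepsilon$ and antipode $S$; let $A^e=A\otimes_{\mathbf k}A^{op}$ and let $\sigma:A\to A^e$, $\sigma(a)=\sum a_1\otimes S(a_2)$. Let $\mathbf k$ be the trivial $A$-module, regard $A$ as a left $A^e$-module via $(a\otimes b)\cdot m=amb$, and let $A^{ad}$ be $A$ as a left $A$-module via $a\cdot m=\sum a_1mS(a_2)$. A complete resolution of a finitely generated left $R$-module $M$ is an exact complex $\mathbb P=(P_n)_{n\in\mathbb Z}$ of finitely generated projective $R$-modules such that $\mathrm{Hom}_R(\mathbb P,R)$ is exact and such that $(P_n)_{n\ge 0}$, with an augmentation $P_0\to M$, is a projective resolution of $M$. Let $\mathbb P$ be a complete resolution of the $A$-module $\mathbf k$ and $\mathbb X$ a complete resolution of the $A^e$-module $A$ (both exist), and for $n\in\mathbb Z$ put $$\widehat{H}^n(A,M)=H^n(\mathrm{Hom}_A(\mathbb P,M)),\qquad \widehat{HH}^n(A,A)=H^n(\mathrm{Hom}_{A^e}(\mathbb X,A)).$$ Let $\Gamma:\mathbb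 P\to\mathbb P\,\widehat\otimes\,\mathbb P$ and $\Gamma':\mathbb X\to\mathbb X\,\widehat\otimes_A\,\mathbb X$ be augmentation-preserving chain maps of complexes of $A$-modules, respectively of $A^e$-modules, where $(\mathbb P\,\widehat\otimes\,\mathbb P)_n=\prod_{i+j=n}P_i\otimes P_j$, $(\mathbb X\,\widehat\otimes_A\,\mathbb X)_n=\prod_{i+j=n}X_i\otimes_A X_j$ with differential $d\otimes 1+(-1)^i\,1\otimes d$ on the $(i,j)$ factor, and $A$ acts diagonally on $P_i\otimes P_j$. Let $\iota:\mathbb P\to\mathbb X$ be a chain map, linear over $\sigma$, that lifts the unit map $\mathbf k\to A$. Such $\Gamma$, $\Gamma'$, $\iota$ exist, and for every choice of them the following hold. The cup products $f\smile g=(-1)^{ij}(f\otimes g)\circ\Gamma$ and $f\smile g=(-1)^{ij}(f\otimes_A g)\circ\Gamma'$, for cocycles $f$, $g$ of degrees $i$, $j$ (using $\mathbf k\otimes\mathbf k\cong\mathbf k$ and $A\otimes_AA\cong A$), make $\widehat H^*(A,\mathbf k)=\bigoplus_{n\in\mathbb Z}\widehat H^n(A,\mathbf k)$ and $\widehat{HH}^*(A,A)=\bigoplus_{n\in\mathbb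 Z}\widehat{HH}^n(A,A)$ graded rings. For every $n$ the map $\rho:\widehat{HH}^n(A,A)\to\widehat H^n(A,A^{ad})$, $[f]\mapsto[f\circ\iota]$, is bijective. The map $\theta:\widehat H^*(A,\mathbf k)\to\widehat{HH}^*(A,A)$ obtained by composing the map $\widehat H^*(A,\mathbf k)\to\widehat H^*(A,A^{ad})$ induced by the inclusion $\mathbf k\to A^{ad}$, $r\mapsto r\cdot 1$, with $\rho^{-1}$ is an injective homomorphism of graded rings. Through $\theta$ and left multiplication, $\widehat{HH}^*(A,A)$ is a left $\widehat H^*(A,\mathbf k)$-module, and $\widehat H^*(A,\mathbf k)$, identified with the image of $\theta$, is a direct summand of this module: there is a graded $\widehat H^*(A,\mathbf k)$-submodule $N\subseteq\widehat{HH}^*(A,A)$ with $$\widehat{HH}^*(A,A)=\theta\big(\widehat H^*(A,\mathbf k)\big)\oplus N .$$ -/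

import Mathlib

open CategoryTheory TensorProduct DirectSum
open scoped ModuleCat

universe u v w

namespace TateHopf

/-! ### Cohomology of `Hom_R(P, M)` for a complex `P` indexed by all integers -/

/-- Precomposition with the differential `d : P i → P j`, as a map `Hom_R(P j, M) → Hom_R(P i, M)`. -/
def precomp {R : Type v} [Ring R] (P : ChainComplex (ModuleCat.{v} R) ℤ)
    (M : Type w) [AddCommGroup M] [Module R M] (i j : ℤ) :
    (P.X j →ₗ[R] M) →+ (P.X i →ₗ[R] M) where
  toFun f := f ∘ₗ (P.d i j).hom
  map_zero' := LinearMap.zero_comp _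
  map_add' _ _ := LinearMap.add_comp _ _ _

/-- The `n`-cocycles of `Hom_R(P, M)`. -/
def cocycles {R : Type v} [Ring R] (P : ChainComplex (ModuleCat.{v} R) ℤ)
    (M : Type w) [AddCommGroup M] [Module R M] (n : ℤ) : AddSubgroup (P.X n →ₗ[R] M) :=
  (precomp P M (n + 1) n).ker

/-- The `n`-coboundaries of `Hom_R(P, M)`. -/
def coboundaries {R : Type v} [Ring R] (P : ChainComplex (ModuleCat.{v} R) ℤ)
    (M : Type w) [AddCommGroup M] [Module R M] (n : ℤ) : AddSubgroup (P.X n →ₗ[R] M) :=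
  (precomp P M n (n - 1)).range

/-- The cohomology group `Hⁿ(Hom_R(P, M))`, cocycles modulo coboundaries. -/
abbrev HomCohomology {R : Type v} [Ring R] (P : ChainComplex (ModuleCat.{v} R) ℤ)
    (M : Type w) [AddCommGroup M] [Module R M] (n : ℤ) : Type (max v w) :=
  cocycles P M n ⧸ (coboundaries P M n).addSubgroupOf (cocycles P M n)

theorem mem_cocycles {R : Type v} [Ring R] {P : ChainComplex (ModuleCat.{v} R) ℤ}
    {M : Type w} [AddCommGroup M] [Module R M] {n : ℤ} {f : P.X n →ₗ[R] M} :
    f ∈ cocycles P M n ↔ ∀ x, f ((P.d (n + 1) n).hom x) = 0 := by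
  rw [cocycles, AddMonoidHom.mem_ker]
  exact LinearMap.ext_iff

theorem mem_coboundaries {R : Type v} [Ring R] {P : ChainComplex (ModuleCat.{v} R) ℤ}
    {M : Type w} [AddCommGroup M] [Module R M] {n : ℤ} {f : P.X n →ₗ[R] M} :
    f ∈ coboundaries P M n ↔ ∃ g : P.X (n - 1) →ₗ[R] M, ∀ x, g ((P.d n (n - 1)).hom x) = f x := by
  rw [coboundaries, AddMonoidHom.mem_range]
  exact exists_congr fun g => LinearMap.ext_iff

/-- An additive map of cochains that preserves cocycles and coboundaries induces a map on
cohomology. -/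
def HomCohomology.map {R R' : Type v} [Ring R] [Ring R']
    {P : ChainComplex (ModuleCat.{v} R) ℤ} {P' : ChainComplex (ModuleCat.{v} R') ℤ}
    {M : Type*} [AddCommGroup M] [Module R M] {M' : Type*} [AddCommGroup M'] [Module R' M']
    {n n' : ℤ} (φ : (P.X n →ₗ[R] M) →+ (P'.X n' →ₗ[R'] M'))
    (hZ : ∀ f ∈ cocycles P M n, φ f ∈ cocycles P' M' n')
    (hB : ∀ f ∈ coboundaries P M n, φ f ∈ coboundaries P' M' n') :
    HomCohomology P M n →+ HomCohomology P' M' n' :=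
  QuotientAddGroup.map _ _
    ((φ.comp (cocycles P M n).subtype).codRestrict (cocycles P' M' n') fun f => hZ f f.2)
    fun f hf => hB f hf

/-- A biadditive map of cochains, of degree `(i, j) ↦ n`, for which products of cocycles are
cocycles and products of a cocycle and a coboundary are coboundaries, induces a biadditive map on
cohomology. -/
def HomCohomology.map₂ {R : Type v} [Ring R] {P : ChainComplex (ModuleCat.{v} R) ℤ}
    {M : Type w} [AddCommGroup M] [Module R M] {i j n : ℤ}
    (φ : (P.X i →ₗ[R] M) →+ (P.X j →ₗ[R] M) →+ (P.X n →ₗ[R] M))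
    (hZ : ∀ f ∈ cocycles P M i, ∀ g ∈ cocycles P M j, φ f g ∈ cocycles P M n)
    (hBZ : ∀ f ∈ coboundaries P M i, ∀ g ∈ cocycles P M j, φ f g ∈ coboundaries P M n)
    (hZB : ∀ f ∈ cocycles P M i, ∀ g ∈ coboundaries P M j, φ f g ∈ coboundaries P M n) :
    HomCohomology P M i →+ HomCohomology P M j →+ HomCohomology P M n :=
  QuotientAddGroup.lift _
    (AddMonoidHom.mk'
      (fun f : cocycles P M i => HomCohomology.map (φ f.1) (hZ f.1 f.2) (hZB f.1 f.2))
      fun f f' => by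
        ext g
        refine congrArg (QuotientAddGroup.mk (s := (coboundaries P M n).addSubgroupOf _))
          (Subtype.ext ?_)
        exact DFunLike.congr_fun (map_add φ f.1 f'.1) g.1)
    (fun f hf => by
      ext g
      exact (QuotientAddGroup.eq_zero_iff _).2 (hBZ f.1 hf g.1 g.2))

/-- The product on `H*(Hom_R(P, M))` induced by a family `Φ` of biadditive maps on cochains with
`Φ(f, g) ∘ d = Φ(f ∘ d, g) + (-1)ⁱ Φ(f, g ∘ d)` for `f` of degree `i`. The product of the classes of
`f`, of degree `i`, and `g`, of degree `j`, is the class of `(-1)^{ij} Φ(f, g)`. -/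
def HomCohomology.cup {R : Type v} [Ring R] {P : ChainComplex (ModuleCat.{v} R) ℤ}
    {M : Type w} [AddCommGroup M] [Module R M]
    (Φ : ∀ i j n : ℤ, i + j = n →
      ((P.X i →ₗ[R] M) →+ (P.X j →ₗ[R] M) →+ (P.X n →ₗ[R] M)))
    (hΦ : ∀ i j n i' j' n' (h : i + j = n) (hi : i + 1 = i') (hj : j + 1 = j') (hn : n + 1 = n')
      f g, precomp P M n' n (Φ i j n h f g) =
        Φ i' j n' (by omega) (precomp P M i' i f) g +
          (i.negOnePow : ℤ) • Φ i j' n' (by omega) f (precomp P M j' j g)) (i j : ℤ) :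
    HomCohomology P M i →+ HomCohomology P M j →+ HomCohomology P M (i + j) :=
  HomCohomology.map₂ (((i * j).negOnePow : ℤ) • Φ i j (i + j) rfl)
    (fun f hf g hg => by
      have hf : precomp P M (i + 1) i f = 0 := hf
      have hg : precomp P M (j + 1) j g = 0 := hg
      refine zsmul_mem (AddMonoidHom.mem_ker.2 ?_) _
      rw [hΦ i j (i + j) (i + 1) (j + 1) (i + j + 1) rfl rfl rfl rfl f g, hf, hg]
      simp)
    (by
      rintro _ ⟨f, rfl⟩ g hg
      have hg : precomp P M (j + 1) j g = 0 := hg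
      refine zsmul_mem (AddMonoidHom.mem_range.2 ⟨Φ (i - 1) j (i + j - 1) (by omega) f g, ?_⟩) _
      rw [hΦ (i - 1) j (i + j - 1) i (j + 1) (i + j) (by omega) (by omega) rfl (by omega) f g, hg]
      simp)
    (by
      rintro f hf _ ⟨g, rfl⟩
      have hf : precomp P M (i + 1) i f = 0 := hf
      refine zsmul_mem (AddMonoidHom.mem_range.2
        ⟨(i.negOnePow : ℤ) • Φ i (j - 1) (i + j - 1) (by omega) f g, ?_⟩) _
      rw [map_zsmul,
        hΦ i (j - 1) (i + j - 1) (i + 1) j (i + j) (by omega) rfl (by omega) (by omega) f g, hf]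
      rw [map_zero, AddMonoidHom.zero_apply, zero_add, smul_smul,
        ← Units.val_mul, ← Int.negOnePow_add, Int.negOnePow_even _ ⟨i, rfl⟩,
        Units.val_one, one_smul])

/-! ### Complete resolutions -/

/-- A complete resolution of the `R`-module `M`: an exact complex of finitely generated projective
`R`-modules indexed by `ℤ`, whose dual complex `Hom_R(-, R)` is exact too, and whose part in
degrees `≥ 0` is, together with the augmentation `aug`, a projective resolution of `M`. -/
structure CompleteResolution (R : Type v) [Ring R] (M : Type w) [AddCommGroup M] [Module R M] where
  /-- the underlying complex, with `d : P (n + 1) → P n` -/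
  cx : ChainComplex (ModuleCat.{v} R) ℤ
  finite : ∀ n, Module.Finite R (cx.X n)
  projective : ∀ n, Module.Projective R (cx.X n)
  exact : ∀ n, Function.Exact (cx.d (n + 1) n).hom (cx.d n (n - 1)).hom
  dual_exact : ∀ n, Function.Exact (precomp cx R n (n - 1)) (precomp cx R (n + 1) n)
  /-- the augmentation -/
  aug : cx.X 0 →ₗ[R] M
  aug_surjective : Function.Surjective aug
  aug_exact : Function.Exact (cx.d 1 0).hom aug

/-- `Êxtⁿ_R(N, M) = Hⁿ(Hom_R(P, M))`, computed with a complete resolution `P` of `N`. -/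
abbrev CompleteResolution.Ext {R : Type v} [Ring R] {N : Type u} [AddCommGroup N] [Module R N]
    (P : CompleteResolution R N) (M : Type w) [AddCommGroup M] [Module R M] (n : ℤ) :
    Type (max v w) :=
  HomCohomology P.cx M n

/-- The map `Êxtⁿ_R(N, M) → Êxtⁿ_R(N, M')` induced by a homomorphism `M → M'`. -/
def CompleteResolution.Ext.coeffMap {R : Type v} [Ring R] {N : Type u} [AddCommGroup N]
    [Module R N] (P : CompleteResolution R N) {M M' : Type*} [AddCommGroup M] [Module R M]
    [AddCommGroup M'] [Module R M'] (φ : M →ₗ[R] M') (n : ℤ) : P.Ext M n →+ P.Ext M' n :=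
  HomCohomology.map
    { toFun := fun f => φ ∘ₗ f
      map_zero' := LinearMap.comp_zero _
      map_add' := fun _ _ => LinearMap.comp_add _ _ _ }
    (fun f hf => mem_cocycles.2 fun x => by simp [mem_cocycles.1 hf x])
    (fun f hf => by
      obtain ⟨g, hg⟩ := mem_coboundaries.1 hf
      exact mem_coboundaries.2 ⟨φ ∘ₗ g, fun x => by simp [hg x]⟩)

/-! ### The modules over a Hopf algebra and over its enveloping algebra -/

/-- The trivial `A`-module `k`, on which `A` acts through the counit. -/
def Triv (k : Type u) (_A : Type v) : Type u := k

/-- The ring `A` as a bimodule over itself. -/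
def Regular (_k : Type u) (A : Type v) : Type v := A

/-- The ring `A` as a left `A`-module through the left adjoint action. -/
def Adjoint (_k : Type u) (A : Type v) : Type v := A

section Modules

variable (k : Type u) (A : Type v) [Field k] [Ring A] [HopfAlgebra k A]

instance : AddCommGroup (Triv k A) := inferInstanceAs (AddCommGroup k)

instance : Module k (Triv k A) := inferInstanceAs (Module k k)

/-- `a • r = ε(a) r`. -/
instance : Module A (Triv k A) := Module.compHom k (Bialgebra.counitAlgHom k A).toRingHom

theorem Triv.smul_def (a : A) (r : Triv k A) :
    a • r = ((Coalgebra.counit (R := k) a : k) * (show k from r) : k) := rfl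

instance : IsScalarTower k A (Triv k A) where
  smul_assoc c a r := by
    rw [Triv.smul_def, Triv.smul_def, map_smul, smul_eq_mul, mul_assoc]
    rfl

/-- The enveloping algebra `Aᵉ = A ⊗ Aᵒᵖ`. -/
abbrev Env : Type v := A ⊗[k] Aᵐᵒᵖ

instance : AddCommGroup (Regular k A) := inferInstanceAs (AddCommGroup A)

/-- `(a ⊗ b) • m = a m b`. -/
instance : Module (Env k A) (Regular k A) :=
  (TensorProduct.Algebra.module : Module (A ⊗[k] Aᵐᵒᵖ) A)

theorem Regular.tmul_smul (a b : A) (m : Regular k A) :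
    ((a ⊗ₜ[k] MulOpposite.op b : Env k A) • m : Regular k A) =
      (a * (show A from m) * b : A) := by
  refine (TensorProduct.Algebra.smul_def a (MulOpposite.op b) (show A from m)).trans ?_
  exact (mul_assoc a (show A from m) b).symm

/-- The algebra homomorphism `σ : A → Aᵉ`, `σ(a) = ∑ a₁ ⊗ S(a₂)`. -/
noncomputable def sigma : A →ₐ[k] Env k A :=
  (Algebra.TensorProduct.map (AlgHom.id k A) (HopfAlgebra.antipodeAlgHomOp k A)).comp
    (Bialgebra.comulAlgHom k A)

theorem sigma_eq_sum (a : A) {ι : Type*} (r : Coalgebra.Repr k a ι) :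
    sigma k A a =
      ∑ i ∈ r.index, r.left i ⊗ₜ[k] MulOpposite.op (HopfAlgebra.antipode k (r.right i)) := by
  simp [sigma, ← r.eq, HopfAlgebra.antipodeAlgHomOp]

instance : AddCommGroup (Adjoint k A) := inferInstanceAs (AddCommGroup A)

/-- `a • m = ∑ a₁ m S(a₂)`. -/
noncomputable instance : Module A (Adjoint k A) :=
  Module.compHom (Regular k A) (sigma k A).toRingHom

theorem Adjoint.smul_eq_sum (a : A) {ι : Type*} (r : Coalgebra.Repr k a ι) (m : Adjoint k A) :
    (a • m : Adjoint k A) =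
      (∑ i ∈ r.index,
        r.left i * (show A from m) * HopfAlgebra.antipode k (r.right i) : A) := by
  change (sigma k A a • (show Regular k A from m) : Regular k A) = _
  rw [sigma_eq_sum k A a r, Finset.sum_smul]
  exact Finset.sum_congr rfl fun i _ => Regular.tmul_smul k A _ _ _

/-- The inclusion `k → A^{ad}`, `r ↦ r 1`, of the scalar multiples of the identity. -/
noncomputable def unitHom : Triv k A →ₗ[A] Adjoint k A where
  toFun r := algebraMap k A r
  map_add' r r' := map_add (algebraMap k A) r r'
  map_smul' a (r : k) := by
    refine Eq.trans ?_ (Adjoint.smul_eq_sum k A a (Coalgebra.Repr.arbitrary k a) _).symm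
    have h := HopfAlgebra.sum_mul_antipode_eq_algebraMap_counit (Coalgebra.Repr.arbitrary k a)
    change algebraMap k A (Coalgebra.counit (R := k) a * r) =
      ∑ i ∈ (Coalgebra.Repr.arbitrary k a).index,
        (Coalgebra.Repr.arbitrary k a).left i * algebraMap k A r *
          HopfAlgebra.antipode k ((Coalgebra.Repr.arbitrary k a).right i)
    simp_rw [← Algebra.commutes (A := A) r, mul_assoc]
    rw [← Finset.mul_sum, h, mul_comm, map_mul]

end Modules

/-! ### Tensor products -/

section Tensor

variable {k : Type u} {A : Type v} [Field k] [Ring A] [HopfAlgebra k A]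

/-- The diagonal action of `A` on `M ⊗ N`: `a • (m ⊗ n) = ∑ a₁ m ⊗ a₂ n`. -/
noncomputable def diagAct (M N : Type*) [AddCommGroup M] [AddCommGroup N] [Module k M] [Module k N]
    [Module A M] [Module A N] [IsScalarTower k A M] [IsScalarTower k A N] :
    A →ₐ[k] Module.End k (M ⊗[k] N) :=
  (Module.endTensorEndAlgHom (R := k) (S := k) (A := k) (M := M) (N := N)).comp
    ((Algebra.TensorProduct.map (Algebra.lsmul k k M) (Algebra.lsmul k k N)).comp
      (Bialgebra.comulAlgHom k A))

theorem diagAct_tmul {M N : Type*} [AddCommGroup M] [AddCommGroup N] [Module k M] [Module k N]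
    [Module A M] [Module A N] [IsScalarTower k A M] [IsScalarTower k A N] (a : A)
    {ι : Type*} (r : Coalgebra.Repr k a ι) (m : M) (n : N) :
    diagAct M N a (m ⊗ₜ[k] n) = ∑ i ∈ r.index, (r.left i • m) ⊗ₜ[k] (r.right i • n) := by
  simp [diagAct, ← r.eq, Module.endTensorEndAlgHom_apply]

section Bimodule

variable {X Y X' Y' : Type*} [AddCommGroup X] [AddCommGroup Y] [AddCommGroup X'] [AddCommGroup Y']
  [Module k X] [Module k Y] [Module k X'] [Module k Y']
  [Module (Env k A) X] [Module (Env k A) Y] [Module (Env k A) X'] [Module (Env k A) Y']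
  [IsScalarTower k (Env k A) X] [IsScalarTower k (Env k A) Y]
  [IsScalarTower k (Env k A) X'] [IsScalarTower k (Env k A) Y']

/-- Left multiplication `x ↦ a x` on a bimodule, that is, on a left `Aᵉ`-module. -/
noncomputable def lact (k : Type u) {A : Type v} [Field k] [Ring A] [HopfAlgebra k A] (X : Type*) [AddCommGroup X] [Module k X] [Module (Env k A) X]
    [IsScalarTower k (Env k A) X] (a : A) : X →ₗ[k] X :=
  Algebra.lsmul k k X (a ⊗ₜ[k] 1 : Env k A)

/-- Right multiplication `x ↦ x a` on a bimodule, that is, on a left `Aᵉ`-module. -/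
noncomputable def ract (k : Type u) {A : Type v} [Field k] [Ring A] [HopfAlgebra k A] (X : Type*) [AddCommGroup X] [Module k X] [Module (Env k A) X]
    [IsScalarTower k (Env k A) X] (a : A) : X →ₗ[k] X :=
  Algebra.lsmul k k X (1 ⊗ₜ[k] MulOpposite.op a : Env k A)

variable (k A X Y) in
/-- The subspace of `X ⊗ₖ Y` spanned by the elements `x a ⊗ y - x ⊗ a y`. -/
def balancedRel : Submodule k (X ⊗[k] Y) :=
  Submodule.span k {t | ∃ (a : A) (x : X) (y : Y), t = ract k X a x ⊗ₜ[k] y - x ⊗ₜ[k] lact k Y a y}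

variable (k A X Y) in
/-- The tensor product `X ⊗_A Y` of bimodules over the noncommutative ring `A`. -/
abbrev BalTensor : Type _ := (X ⊗[k] Y) ⧸ balancedRel k A X Y

/-- `f ⊗_A g : X ⊗_A Y → X' ⊗_A Y'` for `f` right `A`-linear and `g` left `A`-linear. -/
noncomputable def BalTensor.map (f : X →ₗ[k] X') (g : Y →ₗ[k] Y')
    (hf : ∀ (a : A) x, f (ract k X a x) = ract k X' a (f x))
    (hg : ∀ (a : A) y, g (lact k Y a y) = lact k Y' a (g y)) :
    BalTensor k A X Y →ₗ[k] BalTensor k A X' Y' :=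
  Submodule.mapQ _ _ (TensorProduct.map f g) <| Submodule.span_le.2 <| by
    rintro _ ⟨a, x, y, rfl⟩
    exact Submodule.subset_span ⟨a, f x, g y, by simp [hf, hg]⟩

/-- `f ⊗_A 1` for `f` a homomorphism of bimodules. -/
noncomputable def BalTensor.rTensor (Y : Type*) [AddCommGroup Y] [Module k Y] [Module (Env k A) Y]
    [IsScalarTower k (Env k A) Y] (f : X →ₗ[Env k A] X') :
    BalTensor k A X Y →ₗ[k] BalTensor k A X' Y :=
  BalTensor.map (f.restrictScalars k) LinearMap.id (fun _ _ => map_smul f _ _) fun _ _ => rfl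

/-- `1 ⊗_A g` for `g` a homomorphism of bimodules. -/
noncomputable def BalTensor.lTensor (X : Type*) [AddCommGroup X] [Module k X] [Module (Env k A) X]
    [IsScalarTower k (Env k A) X] (g : Y →ₗ[Env k A] Y') :
    BalTensor k A X Y →ₗ[k] BalTensor k A X Y' :=
  BalTensor.map LinearMap.id (g.restrictScalars k) (fun _ _ => rfl) fun _ _ => map_smul g _ _

/-- The bimodule structure of `X ⊗_A Y`: `a • (x ⊗ y) • b = a x ⊗ y b`. -/
noncomputable def BalTensor.act (X Y : Type*) [AddCommGroup X] [AddCommGroup Y] [Module k X]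
    [Module k Y] [Module (Env k A) X] [Module (Env k A) Y] [IsScalarTower k (Env k A) X]
    [IsScalarTower k (Env k A) Y] (a b : A) : BalTensor k A X Y →ₗ[k] BalTensor k A X Y :=
  BalTensor.map (lact k X a) (ract k Y b)
    (fun c x => by simp [lact, ract, smul_smul])
    (fun c y => by simp [lact, ract, smul_smul])

instance : Module k (Regular k A) := inferInstanceAs (Module k A)

instance : IsScalarTower k (Env k A) (Regular k A) where
  smul_assoc c t m := by
    induction t using TensorProduct.induction_on with
    | zero =>
      have h : (0 : Env k A) • m = 0 := zero_smul (Env k A) m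
      rw [smul_zero]
      exact (h.trans (smul_zero c).symm).trans (congrArg (c • ·) h.symm)
    | add s t hs ht => simp only [smul_add, add_smul, hs, ht]
    | tmul a b =>
      obtain ⟨b, rfl⟩ := MulOpposite.op_surjective b
      rw [TensorProduct.smul_tmul', Regular.tmul_smul, Regular.tmul_smul, smul_mul_assoc,
        smul_mul_assoc]
      rfl

variable (k A) in
/-- The multiplication of `A`. -/
noncomputable def Regular.mul : Regular k A →ₗ[k] Regular k A →ₗ[k] Regular k A :=
  LinearMap.mul k A

/-- The map `X ⊗_A Y → A ⊗_A A ≅ A`, `x ⊗ y ↦ f(x) g(y)`. -/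
noncomputable def BalTensor.mul (f : X →ₗ[Env k A] Regular k A) (g : Y →ₗ[Env k A] Regular k A) :
    BalTensor k A X Y →ₗ[k] Regular k A :=
  (balancedRel k A X Y).liftQ
    (TensorProduct.lift
      ((Regular.mul k A).compl₁₂ (f.restrictScalars k) (g.restrictScalars k))) <|
    Submodule.span_le.2 <| by
      rintro _ ⟨a, x, y, rfl⟩
      have h1 : f (ract k X a x) = ((show A from f x) * a : A) := by
        refine (map_smul f _ _).trans ((Regular.tmul_smul k A 1 a (f x)).trans ?_)
        rw [one_mul]
      have h2 : g (lact k Y a y) = (a * (show A from g y) : A) := by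
        refine (map_smul g _ _).trans ((Regular.tmul_smul k A a 1 (g y)).trans ?_)
        rw [mul_one]
      rw [SetLike.mem_coe, LinearMap.mem_ker, map_sub, sub_eq_zero]
      change Regular.mul k A (f (ract k X a x)) (g y) = Regular.mul k A (f x) (g (lact k Y a y))
      rw [h1, h2]
      exact mul_assoc (G := A) _ _ _

end Bimodule

end Tensor

/-! ### Tate cohomology and its cup product -/

section Tate

variable {k : Type u} {A : Type v} [Field k] [Ring A] [HopfAlgebra k A]

/-- The Tate cohomology `Ĥⁿ(A, M) = Êxtⁿ_A(k, M)`, computed with a complete resolution `P` of the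
trivial module `k`. -/
abbrev Tate (P : CompleteResolution A (Triv k A)) (M : Type w) [AddCommGroup M] [Module A M]
    (n : ℤ) : Type (max v w) :=
  P.Ext M n

variable (k A) in
/-- The multiplication of `k`. -/
noncomputable def Triv.mul : Triv k A →ₗ[k] Triv k A →ₗ[k] Triv k A :=
  LinearMap.mul k k

/-- The map `M ⊗ N → k ⊗ k ≅ k`, `x ⊗ y ↦ f(x) g(y)`. -/
noncomputable def Triv.pairing {M N : Type*} [AddCommGroup M] [AddCommGroup N] [Module k M]
    [Module k N] [Module A M] [Module A N] [IsScalarTower k A M] [IsScalarTower k A N]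
    (f : M →ₗ[A] Triv k A) (g : N →ₗ[A] Triv k A) : M ⊗[k] N →ₗ[k] Triv k A :=
  TensorProduct.lift ((Triv.mul k A).compl₁₂ (f.restrictScalars k) (g.restrictScalars k))

/-- A complete diagonal approximation: an augmentation-preserving chain map `Γ : P → P ⊗̂ P` of
complexes of `A`-modules. As `(P ⊗̂ P)ₙ` is the product of the `Pᵢ ⊗ Pⱼ` over all `i + j = n`, with
diagonal action, the map `Γₙ` is given by its components `Γᵢⱼ : Pₙ → Pᵢ ⊗ Pⱼ`, and the differential
of `P ⊗̂ P` is `d ⊗ 1 + (-1)ⁱ 1 ⊗ d`. -/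
structure DiagonalApprox (P : CompleteResolution A (Triv k A)) where
  /-- the component `Pₙ → Pᵢ ⊗ Pⱼ` of `Γ` -/
  comp : ∀ i j n : ℤ, i + j = n → (P.cx.X n →ₗ[k] P.cx.X i ⊗[k] P.cx.X j)
  equivariant : ∀ i j n h (a : A) x,
    comp i j n h (a • x) = diagAct (P.cx.X i) (P.cx.X j) a (comp i j n h x)
  chain : ∀ i j n (h : i + j = n) x,
    comp i j n h ((P.cx.d (n + 1) n).hom x) =
      LinearMap.rTensor (P.cx.X j) ((P.cx.d (i + 1) i).hom.restrictScalars k)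
          (comp (i + 1) j (n + 1) (by omega) x) +
        (i.negOnePow : ℤ) •
          LinearMap.lTensor (P.cx.X i) ((P.cx.d (j + 1) j).hom.restrictScalars k)
            (comp i (j + 1) (n + 1) (by omega) x)
  augmentation : ∀ x, Triv.pairing P.aug P.aug (comp 0 0 0 (by omega) x) = P.aug x

theorem Triv.pairing_diagAct {M N : Type*} [AddCommGroup M] [AddCommGroup N] [Module k M]
    [Module k N] [Module A M] [Module A N] [IsScalarTower k A M] [IsScalarTower k A N]
    (f : M →ₗ[A] Triv k A) (g : N →ₗ[A] Triv k A) (a : A) (t : M ⊗[k] N) :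
    Triv.pairing f g (diagAct M N a t) = a • Triv.pairing f g t := by
  induction t using TensorProduct.induction_on with
  | zero => simp
  | add s t hs ht => simp only [map_add, smul_add, hs, ht]
  | tmul x y =>
    rw [diagAct_tmul a (Coalgebra.Repr.arbitrary k a), map_sum]
    change ∑ i ∈ _, Triv.mul k A (f _) (g _) = a • Triv.mul k A (f x) (g y)
    have h := congrArg (Coalgebra.counit (R := k))
      (Coalgebra.sum_counit_smul (Coalgebra.Repr.arbitrary k a))
    rw [map_sum] at h
    rw [Triv.smul_def, ← h, Finset.sum_mul]
    refine Finset.sum_congr rfl fun i _ => ?_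
    have h1 := map_smul f ((Coalgebra.Repr.arbitrary k a).left i) x
    have h2 := map_smul g ((Coalgebra.Repr.arbitrary k a).right i) y
    have h3 : Coalgebra.counit (R := k) (Coalgebra.counit (R := k)
        ((Coalgebra.Repr.arbitrary k a).left i) • (Coalgebra.Repr.arbitrary k a).right i) =
        Coalgebra.counit (R := k) ((Coalgebra.Repr.arbitrary k a).left i) *
          Coalgebra.counit (R := k) ((Coalgebra.Repr.arbitrary k a).right i) := map_smul _ _ _
    rw [h1, h2, h3]
    exact mul_mul_mul_comm (G := k) _ _ _ _

/-- The product `(f ⊗ g) ∘ Γ` of cochains with values in `k`. -/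
noncomputable def DiagonalApprox.pair {P : CompleteResolution A (Triv k A)}
    (Γ : DiagonalApprox P) (i j n : ℤ) (h : i + j = n) :
    (P.cx.X i →ₗ[A] Triv k A) →+ (P.cx.X j →ₗ[A] Triv k A) →+ (P.cx.X n →ₗ[A] Triv k A) :=
  AddMonoidHom.mk' (fun f => AddMonoidHom.mk' (fun g =>
    { toFun := fun x => Triv.pairing f g (Γ.comp i j n h x)
      map_add' := fun x y => by rw [map_add, map_add]
      map_smul' := fun a x => by
        rw [Γ.equivariant, Triv.pairing_diagAct, RingHom.id_apply] })
    fun g g' => LinearMap.ext fun x => by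
      change Triv.pairing f (g + g') _ = Triv.pairing f g _ + Triv.pairing f g' _
      rw [← LinearMap.add_apply]
      congr 1
      ext x y
      exact map_add (Triv.mul k A (f x)) (g y) (g' y))
    fun f f' => AddMonoidHom.ext fun g => LinearMap.ext fun x => by
      change Triv.pairing (f + f') g _ = Triv.pairing f g _ + Triv.pairing f' g _
      rw [← LinearMap.add_apply]
      congr 1
      ext x y
      exact LinearMap.map_add₂ (Triv.mul k A) (f x) (f' x) (g y)

/-- The cup product of `Ĥ*(A, k)`, given on cochains by `f ⌣ g = (f ⊗̂ g) ∘ Γ`, where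
`f ⊗̂ g = (-1)^{ij} f ⊗ g` for `f` of degree `i` and `g` of degree `j`. -/
noncomputable def Tate.cup {P : CompleteResolution A (Triv k A)} (Γ : DiagonalApprox P) (i j : ℤ) :
    Tate P (Triv k A) i →+ Tate P (Triv k A) j →+ Tate P (Triv k A) (i + j) :=
  HomCohomology.cup Γ.pair
    (by
      rintro i j n _ _ _ h rfl rfl rfl f g
      ext x
      change Triv.pairing f g (Γ.comp i j n h ((P.cx.d (n + 1) n).hom x)) = _
      rw [Γ.chain, map_add, map_zsmul]
      change _ = Triv.pairing _ g _ + (i.negOnePow : ℤ) • Triv.pairing f _ _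
      congr 1
      · generalize Γ.comp (i + 1) j (n + 1) _ x = t
        rw [← LinearMap.comp_apply]
        congr 1
        ext x y
        rfl
      · congr 1
        generalize Γ.comp i (j + 1) (n + 1) _ x = t
        rw [← LinearMap.comp_apply]
        congr 1
        ext x y
        rfl)
    i j

end Tate

/-! ### Tate-Hochschild cohomology and its cup product -/

section TateHochschild

variable {k : Type u} {A : Type v} [Field k] [Ring A] [HopfAlgebra k A]

variable (k A) in
/-- A complete resolution of `A` as a bimodule, that is, as a left `Aᵉ`-module. -/
abbrev BimoduleResolution : Type _ := CompleteResolution (Env k A) (Regular k A)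

/-- The Tate-Hochschild cohomology `ĤHⁿ(A, A) = Êxtⁿ_{Aᵉ}(A, A)`, computed with a complete
resolution `X` of the `Aᵉ`-module `A`. -/
abbrev TateHochschild (X : BimoduleResolution k A) (n : ℤ) : Type v :=
  X.Ext (Regular k A) n

/-- A complete diagonal approximation: an augmentation-preserving chain map `Γ : X → X ⊗̂_A X` of
complexes of `Aᵉ`-modules, given by its components `Γᵢⱼ : Xₙ → Xᵢ ⊗_A Xⱼ`, `i + j = n`. The
differential of `X ⊗̂_A X` is `d ⊗ 1 + (-1)ⁱ 1 ⊗ d`. -/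
structure BimoduleDiagonalApprox (X : BimoduleResolution k A) where
  /-- the component `Xₙ → Xᵢ ⊗_A Xⱼ` of `Γ` -/
  comp : ∀ i j n : ℤ, i + j = n → (X.cx.X n →ₗ[k] BalTensor k A (X.cx.X i) (X.cx.X j))
  equivariant : ∀ i j n h (a b : A) x,
    comp i j n h ((a ⊗ₜ[k] MulOpposite.op b : Env k A) • x) =
      BalTensor.act (X.cx.X i) (X.cx.X j) a b (comp i j n h x)
  chain : ∀ i j n (h : i + j = n) x,
    comp i j n h ((X.cx.d (n + 1) n).hom x) =
      BalTensor.rTensor (X.cx.X j) (X.cx.d (i + 1) i).hom (comp (i + 1) j (n + 1) (by omega) x) +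
        (i.negOnePow : ℤ) •
          BalTensor.lTensor (X.cx.X i) (X.cx.d (j + 1) j).hom
            (comp i (j + 1) (n + 1) (by omega) x)
  augmentation : ∀ x, BalTensor.mul X.aug X.aug (comp 0 0 0 (by omega) x) = X.aug x

theorem BalTensor.hom_ext {X Y : Type*} [AddCommGroup X] [AddCommGroup Y] [Module k X] [Module k Y]
    [Module (Env k A) X] [Module (Env k A) Y] [IsScalarTower k (Env k A) X]
    [IsScalarTower k (Env k A) Y] {Z : Type*} [AddCommGroup Z] [Module k Z]
    {φ ψ : BalTensor k A X Y →ₗ[k] Z}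
    (h : ∀ x y, φ (Submodule.Quotient.mk (x ⊗ₜ[k] y)) = ψ (Submodule.Quotient.mk (x ⊗ₜ[k] y))) :
    φ = ψ := by
  apply Submodule.linearMap_qext
  ext x y
  exact h x y

theorem BalTensor.mul_act {X Y : Type*} [AddCommGroup X] [AddCommGroup Y] [Module k X] [Module k Y]
    [Module (Env k A) X] [Module (Env k A) Y] [IsScalarTower k (Env k A) X]
    [IsScalarTower k (Env k A) Y] (f : X →ₗ[Env k A] Regular k A) (g : Y →ₗ[Env k A] Regular k A)
    (a b : A) (t : BalTensor k A X Y) :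
    BalTensor.mul f g (BalTensor.act X Y a b t) =
      (a ⊗ₜ[k] MulOpposite.op b : Env k A) • BalTensor.mul f g t := by
  suffices h : BalTensor.mul f g ∘ₗ BalTensor.act X Y a b =
      Algebra.lsmul k k (Regular k A) (a ⊗ₜ[k] MulOpposite.op b : Env k A) ∘ₗ
        BalTensor.mul f g from LinearMap.congr_fun h t
  refine BalTensor.hom_ext fun x y => ?_
  change Regular.mul k A (f ((a ⊗ₜ[k] 1 : Env k A) • x))
    (g ((1 ⊗ₜ[k] MulOpposite.op b : Env k A) • y)) =
      (a ⊗ₜ[k] MulOpposite.op b : Env k A) • Regular.mul k A (f x) (g y)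
  have h1 : f ((a ⊗ₜ[k] 1 : Env k A) • x) = (a * (show A from f x) : A) := by
    refine (map_smul f _ _).trans ((Regular.tmul_smul k A a 1 (f x)).trans ?_)
    rw [mul_one]
  have h2 : g ((1 ⊗ₜ[k] MulOpposite.op b : Env k A) • y) = ((show A from g y) * b : A) := by
    refine (map_smul g _ _).trans ((Regular.tmul_smul k A 1 b (g y)).trans ?_)
    rw [one_mul]
  refine Eq.trans ?_ (Regular.tmul_smul k A a b _).symm
  rw [h1, h2]
  have assoc (p q : A) : a * p * (q * b) = a * (p * q) * b := by simp only [mul_assoc]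
  exact assoc _ _

theorem BimoduleDiagonalApprox.mul_comp_smul {X : BimoduleResolution k A}
    (Γ : BimoduleDiagonalApprox X) {i j n : ℤ} (f : X.cx.X i →ₗ[Env k A] Regular k A)
    (g : X.cx.X j →ₗ[Env k A] Regular k A) (h : i + j = n) (c : Env k A) (x : X.cx.X n) :
    BalTensor.mul f g (Γ.comp i j n h (c • x)) = c • BalTensor.mul f g (Γ.comp i j n h x) := by
  induction c using TensorProduct.induction_on with
  | zero =>
    have h0 : (0 : Env k A) • x = 0 := zero_smul (Env k A) x
    refine Eq.trans ?_ (zero_smul (Env k A) (BalTensor.mul f g (Γ.comp i j n h x))).symm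
    exact (congrArg (fun z => BalTensor.mul f g (Γ.comp i j n h z)) h0).trans
      ((congrArg (BalTensor.mul f g) (map_zero _)).trans (map_zero _))
  | add s t hs ht => rw [add_smul, map_add, map_add, hs, ht, add_smul]
  | tmul a b =>
    exact (congrArg _ (Γ.equivariant i j n h a b.unop x)).trans (BalTensor.mul_act f g a b.unop _)

/-- The product `(f ⊗ g) ∘ Γ` of cochains with values in `A ≅ A ⊗_A A`. -/
noncomputable def BimoduleDiagonalApprox.pair {X : BimoduleResolution k A}
    (Γ : BimoduleDiagonalApprox X) (i j n : ℤ) (h : i + j = n) :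
    (X.cx.X i →ₗ[Env k A] Regular k A) →+ (X.cx.X j →ₗ[Env k A] Regular k A) →+
      (X.cx.X n →ₗ[Env k A] Regular k A) :=
  AddMonoidHom.mk' (fun f => AddMonoidHom.mk' (fun g =>
    { toFun := fun x => BalTensor.mul f g (Γ.comp i j n h x)
      map_add' := fun x y => by rw [map_add, map_add]
      map_smul' := fun c x => by
        rw [RingHom.id_apply]
        exact Γ.mul_comp_smul f g h c x })
    fun g g' => LinearMap.ext fun x => by
      change BalTensor.mul f (g + g') _ = BalTensor.mul f g _ + BalTensor.mul f g' _
      rw [← LinearMap.add_apply]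
      congr 1
      exact BalTensor.hom_ext fun x y => map_add (Regular.mul k A (f x)) (g y) (g' y))
    fun f f' => AddMonoidHom.ext fun g => LinearMap.ext fun x => by
      change BalTensor.mul (f + f') g _ = BalTensor.mul f g _ + BalTensor.mul f' g _
      rw [← LinearMap.add_apply]
      congr 1
      exact BalTensor.hom_ext fun x y => LinearMap.map_add₂ (Regular.mul k A) (f x) (f' x) (g y)

/-- The cup product of `ĤH*(A, A)`, given on cochains by `f ⌣ g = (f ⊗̂ g) ∘ Γ`, where
`f ⊗̂ g = (-1)^{ij} f ⊗ g` for `f` of degree `i` and `g` of degree `j`. -/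
noncomputable def TateHochschild.cup {X : BimoduleResolution k A} (Γ : BimoduleDiagonalApprox X)
    (i j : ℤ) : TateHochschild X i →+ TateHochschild X j →+ TateHochschild X (i + j) :=
  HomCohomology.cup Γ.pair
    (by
      rintro i j n _ _ _ h rfl rfl rfl f g
      ext x
      change BalTensor.mul f g (Γ.comp i j n h ((X.cx.d (n + 1) n).hom x)) = _
      rw [Γ.chain, map_add, map_zsmul]
      change _ = BalTensor.mul _ g _ + (i.negOnePow : ℤ) • BalTensor.mul f _ _
      congr 1
      · generalize Γ.comp (i + 1) j (n + 1) _ x = t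
        rw [← LinearMap.comp_apply]
        congr 1
        exact BalTensor.hom_ext fun _ _ => rfl
      · congr 1
        generalize Γ.comp i (j + 1) (n + 1) _ x = t
        rw [← LinearMap.comp_apply]
        congr 1
        exact BalTensor.hom_ext fun _ _ => rfl)
    i j

/-! ### Comparison of the two theories -/

/-- A chain map `ι : P → X` from a complete resolution of the `A`-module `k` to one of the
`Aᵉ`-module `A`, that is linear over `σ : A → Aᵉ` and lifts the unit map `k → A`. -/
structure Comparison (P : CompleteResolution A (Triv k A)) (X : BimoduleResolution k A) where
  /-- the map in degree `n` -/
  map : ∀ n, P.cx.X n →ₛₗ[(sigma k A).toRingHom] X.cx.X n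
  chain : ∀ i j x, map j ((P.cx.d i j).hom x) = (X.cx.d i j).hom (map i x)
  augmentation : ∀ x, X.aug (map 0 x) = unitHom k A (P.aug x)

/-- Composition with `ι`, as a map `Hom_{Aᵉ}(Xₙ, A) → Hom_A(Pₙ, A^{ad})`. -/
noncomputable def Comparison.cochainMap {P : CompleteResolution A (Triv k A)}
    {X : BimoduleResolution k A} (ι : Comparison P X) (n : ℤ) :
    (X.cx.X n →ₗ[Env k A] Regular k A) →+ (P.cx.X n →ₗ[A] Adjoint k A) :=
  AddMonoidHom.mk' (fun f =>
    { toFun := fun x => f (ι.map n x)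
      map_add' := fun x y => by rw [map_add, map_add]; rfl
      map_smul' := fun a x => by rw [map_smulₛₗ, map_smul]; rfl })
    fun f g => rfl

/-- The map `ĤHⁿ(A, A) → Ĥⁿ(A, A^{ad})`, `[f] ↦ [f ∘ ι]`. -/
noncomputable def Comparison.toAdjoint {P : CompleteResolution A (Triv k A)}
    {X : BimoduleResolution k A} (ι : Comparison P X) (n : ℤ) :
    TateHochschild X n →+ Tate P (Adjoint k A) n :=
  HomCohomology.map (ι.cochainMap n)
    (fun f hf => mem_cocycles.2 fun x =>
      (congrArg f (ι.chain (n + 1) n x)).trans (mem_cocycles.1 hf (ι.map (n + 1) x)))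
    (fun f hf => by
      obtain ⟨g, hg⟩ := mem_coboundaries.1 hf
      refine mem_coboundaries.2 ⟨ι.cochainMap (n - 1) g, fun x => ?_⟩
      exact (congrArg g (ι.chain n (n - 1) x)).trans (hg (ι.map n x)))

end TateHochschild

/-- A ring homomorphism `θ : R → S`, as an `R`-linear map when `R` acts on `S` by
`r • s = θ(r) s`. -/
def linearOfRingHom {R S : Type*} [Ring R] [Ring S] (θ : R →+* S) :
    letI : Module R S := Module.compHom S θ
    R →ₗ[R] S :=
  letI : Module R S := Module.compHom S θ
  { toFun := θ
    map_add' := map_add θ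
    map_smul' := fun r x => map_mul θ r x }

end TateHopf

set_option linter.unusedSectionVars false

namespace TateHopf

/-! ### Recursion over the integers -/

/-! The tool is the comparison of chain maps indexed by all integers. A semilinear chain map from a
complex `S` of projectives to an augmented exact complex `X` extends upwards because `S` is
projective and `X` exact, and downwards because cocycles on `S` with values in each `X j` are
coboundaries. Up to homotopy it depends only on its composition with the augmentation modulo
coboundaries (`IsAugmented.exists_chainMap`, `IsAugmented.comp_sub_coboundary`).

Rings: contracting the first tensor factor of a diagonal approximation with a cocycle `f` of degree
`i` gives a chain map of degree `-i`, and left multiplication by `f` is composition with it. The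
augmentation of this chain map is cohomologous to `f`, so the unit laws and associativity reduce to
comparing augmentations (`HomCohomology.IsRepresentable`, `HomCohomology.cup_assoc'`), without any
triple tensor product.

Bijectivity of ρ: through σ the algebra `Aᵉ` is a finitely generated projective `A`-module, so exact
duals remain exact with values in `Aᵉ` (`homAcyclic_sigma`). Inducing `P` along σ, realised as `P ⊗
A`, then gives a complete resolution of `A` over `Aᵉ`. It is homotopy equivalent to `X`, and the
universal property of induction turns bimodule maps on it into `A`-linear maps from `P` to the
adjoint module (`Comparison.toAdjoint_bijective`).

Multiplicativity and the summand: if ρ(z) is the image of x, the chain maps given by z and by x are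
intertwined by ι up to homotopy. Thus ρ(z y) is ρ(y) composed with the chain map of x
(`Comparison.comp_chainMap`). Taking y in the image of θ makes θ multiplicative. The counit is an
`A`-linear retraction of `k → A^{ad}`, so applying it after ρ gives κ with κ(θ(x)) = x and κ(θ(x) y)
= x κ(y); the kernel of κ is the complement.

Existence: a nonzero integral gives a Frobenius isomorphism, hence `Hom(-, A)` preserves exactness
and finitely generated modules embed in free ones; splicing syzygies and cosyzygies gives a complete
resolution of `k`. Diagonal approximations are built one column of the double complex at a time
(`exists_diagonal`). -/

theorem exists_int_seq {α : ℤ → Type*} (good : ∀ i, α i → Prop)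
    (r : ∀ i, α i → α (i + 1) → Prop)
    (up : ∀ i a, good i a → ∃ b, r i a b ∧ good (i + 1) b)
    (down : ∀ i b, good (i + 1) b → ∃ a, r i a b ∧ good i a)
    (i₀ : ℤ) (a₀ : α i₀) (h₀ : good i₀ a₀) :
    ∃ F : ∀ i, α i, F i₀ = a₀ ∧ ∀ i, r i (F i) (F (i + 1)) := by
  choose u hu hu' using up
  -- Downward induction lands in `α (i - 1)`, while `r (i - 1)` speaks of `α (i - 1 + 1)`, which is
  -- `α i` only propositionally; heterogeneous equality bridges the two.
  have down' : ∀ i (b : α i), good i b → ∃ a : α (i - 1), (∀ b' : α (i - 1 + 1), HEq b' b →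
      r (i - 1) a b') ∧ good (i - 1) a := by
    intro i b hb
    obtain ⟨j, rfl⟩ : ∃ j, i = j + 1 := ⟨i - 1, by omega⟩
    obtain ⟨a, ha, ha'⟩ := down j b hb
    have key : ∀ j', j' = j → ∃ a : α j', (∀ b' : α (j' + 1), HEq b' b → r j' a b') ∧ good j' a := by
      rintro _ rfl
      exact ⟨a, fun b' hb' => by rw [eq_of_heq hb']; exact ha, ha'⟩
    exact key _ (by omega)
  choose l hl hl' using down'
  let G : ∀ i, {a : α i // good i a} := fun i =>
    Int.inductionOn' (motive := fun i => {a : α i // good i a}) i i₀ ⟨a₀, h₀⟩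
      (fun k _ a => ⟨u k a.1 a.2, hu' k a.1 a.2⟩) (fun k _ a => ⟨l k a.1 a.2, hl' k a.1 a.2⟩)
  have G0 : G i₀ = ⟨a₀, h₀⟩ := Int.inductionOn'_self
  have Gs : ∀ i, i₀ ≤ i → G (i + 1) = ⟨u i (G i).1 (G i).2, hu' i (G i).1 (G i).2⟩ :=
    fun i hi => Int.inductionOn'_add_one hi
  have Gp : ∀ i, i ≤ i₀ → G (i - 1) = ⟨l i (G i).1 (G i).2, hl' i (G i).1 (G i).2⟩ :=
    fun i hi => Int.inductionOn'_sub_one hi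
  refine ⟨fun i => (G i).1, congrArg Subtype.val G0, fun i => ?_⟩
  change r i (G i).1 (G (i + 1)).1
  rcases le_or_gt i₀ i with hi | hi
  · have h := Gs i hi
    rw [h]
    exact hu i _ _
  · obtain ⟨j, rfl⟩ : ∃ j, i = j - 1 := ⟨i + 1, by omega⟩
    have h := Gp j (by omega)
    rw [h]
    refine hl j _ _ _ ?_
    have key : ∀ j', j' = j → HEq (G j').1 (G j).1 := by rintro _ rfl; rfl
    exact key _ (by omega)

/-! ### Complexes indexed by all integers -/

section Complexes

variable {R : Type*} {R' : Type*} [Ring R] [Ring R']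

/-- Exactness of a family of maps `d i j`, of which only those with `i = j + 1` are relevant. -/
def IsExactComplex {X : ℤ → Type*} [∀ i, AddCommGroup (X i)] [∀ i, Module R (X i)]
    (d : ∀ i j, X i →ₗ[R] X j) : Prop :=
  ∀ i j l, i = j + 1 → j = l + 1 → Function.Exact (d i j) (d j l)

/-- An exact complex whose part in degrees `≥ 0` resolves `M`. -/
structure IsAugmented {X : ℤ → Type*} [∀ i, AddCommGroup (X i)] [∀ i, Module R (X i)]
    {M : Type*} [AddCommGroup M] [Module R M]
    (d : ∀ i j, X i →ₗ[R] X j) (aug : X 0 →ₗ[R] M) : Prop where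
  exact : IsExactComplex d
  surjective : Function.Surjective aug
  exact_zero : Function.Exact (d 1 0) aug

/-- Every cocycle on the complex `S` with values in `M` is a coboundary. -/
def HomAcyclic (σ : R →+* R') {S : ℤ → Type*} [∀ i, AddCommGroup (S i)] [∀ i, Module R (S i)]
    (dS : ∀ i j, S i →ₗ[R] S j) (M : Type*) [AddCommGroup M] [Module R' M] : Prop :=
  ∀ i j l, i = j + 1 → j = l + 1 → ∀ g : S j →ₛₗ[σ] M, (∀ x, g (dS i j x) = 0) →
    ∃ h : S l →ₛₗ[σ] M, ∀ x, h (dS j l x) = g x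

/-- Restriction of scalars along σ makes semilinear maps linear, and projectivity over `R` then
applies. Since only the values of `g` must be reached, the lift is taken against the range of `f`.
-/
theorem exists_semilinear_lift {σ : R →+* R'} {P M N : Type*} [AddCommGroup P] [AddCommGroup M]
    [AddCommGroup N] [Module R P] [Module R' M] [Module R' N] [Module.Projective R P]
    (f : M →ₗ[R'] N) (g : P →ₛₗ[σ] N) (hg : ∀ x, ∃ y, f y = g x) :
    ∃ h : P →ₛₗ[σ] M, ∀ x, f (h x) = g x := by
  let _ : Module R M := Module.compHom M σ
  let _ : Module R N := Module.compHom N σ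
  let f' : M →ₗ[R] N := { toFun := f, map_add' := map_add f, map_smul' := fun c x => map_smul f (σ c) x }
  let g' : P →ₗ[R] N := { toFun := g, map_add' := map_add g, map_smul' := fun c x => map_smulₛₗ g c x }
  obtain ⟨h, hh⟩ := Module.projective_lifting_property f'.rangeRestrict
    (g'.codRestrict (LinearMap.range f') fun x => hg x) f'.surjective_rangeRestrict
  refine ⟨{ toFun := h, map_add' := map_add h, map_smul' := fun c x => map_smul h c x }, fun x => ?_⟩
  exact congrArg Subtype.val (LinearMap.congr_fun hh x)

variable {σ : R →+* R'} {S : ℤ → Type*} [∀ i, AddCommGroup (S i)] [∀ i, Module R (S i)]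
  {dS : ∀ i j, S i →ₗ[R] S j} {X : ℤ → Type*} [∀ i, AddCommGroup (X i)] [∀ i, Module R' (X i)]
  {d : ∀ i j, X i →ₗ[R'] X j} {M : Type*} [AddCommGroup M] [Module R' M] {aug : X 0 →ₗ[R'] M}

theorem IsExactComplex.d_d (h : IsExactComplex d) {i j l : ℤ} (hi : i = j + 1) (hj : j = l + 1)
    (x : X i) : d j l (d i j x) = 0 :=
  (h i j l hi hj).apply_apply_eq_zero x

theorem IsExactComplex.exists_lift (hd : IsExactComplex d) (hS : ∀ i, Module.Projective R (S i))
    {a i j l : ℤ} (hi : i = j + 1) (hj : j = l + 1) (g : S a →ₛₗ[σ] X j)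
    (hg : ∀ x, d j l (g x) = 0) : ∃ h : S a →ₛₗ[σ] X i, ∀ x, d i j (h x) = g x :=
  have := hS a
  exists_semilinear_lift _ g fun x => (hd i j l hi hj _).1 (hg x)

/-- Both kernels are the image of the differential from degree 1. This is what lets the augmentation
control the complex across degree 0. -/
theorem IsAugmented.ker_aug (h : IsAugmented d aug) (x : X 0) : aug x = 0 ↔ d 0 (-1) x = 0 := by
  rw [h.exact_zero x, h.exact 1 0 (-1) (by norm_num) (by norm_num) x]

/-- A homotopy on a single degree propagates both ways: upwards by lifting into an exact complex,
downwards by extending a cocycle over the next differential. -/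
theorem exists_homotopy_of_start (hdS : IsExactComplex dS) (hS : ∀ i, Module.Projective R (S i))
    (hd : IsExactComplex d) (hX : ∀ j, HomAcyclic σ dS (X j))
    (E : ∀ m, S m →ₛₗ[σ] X m)
    (hE : ∀ m n, m = n + 1 → ∀ x, E n (dS m n x) = d m n (E m x))
    (m₀ : ℤ) (H₀ : S m₀ →ₛₗ[σ] X (m₀ + 1))
    (h₀ : ∀ x, d (m₀ + 1) m₀ (H₀ (dS (m₀ + 1) m₀ x)) = E m₀ (dS (m₀ + 1) m₀ x)) :
    ∃ H : ∀ m n, n = m + 1 → (S m →ₛₗ[σ] X n), ∀ l m n (hl : m = l + 1) (hn : n = m + 1) x,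
      E m x = d n m (H m n hn x) + H l m hl (dS m l x) := by
  -- The invariant `d H d = E d` serves both directions: it makes `E - H d` land in cycles one
  -- degree higher, and it makes `E - d H'` vanish on boundaries, so that it factors through the
  -- differential one degree lower.
  obtain ⟨H, -, hH⟩ := exists_int_seq (α := fun i => S i →ₛₗ[σ] X (i + 1))
    (fun i H => ∀ x, d (i + 1) i (H (dS (i + 1) i x)) = E i (dS (i + 1) i x))
    (fun i H H' => ∀ x, E (i + 1) x = d (i + 1 + 1) (i + 1) (H' x) + H (dS (i + 1) i x))
    (fun i H hH => by
      obtain ⟨H', hH'⟩ := hd.exists_lift hS (l := i) rfl rfl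
        (E (i + 1) - H.comp (dS (i + 1) i)) fun x => by
          simp [hH, hE (i + 1) i rfl]
      refine ⟨H', fun x => by simp [hH'], fun x => ?_⟩
      simp [hH', hdS.d_d rfl rfl])
    (fun i H' hH' => by
      obtain ⟨H, hH⟩ := hX (i + 1) (i + 1 + 1) (i + 1) i rfl rfl
        (E (i + 1) - (d (i + 1 + 1) (i + 1)).comp H') fun x => by
          simp [hH']
      refine ⟨H, fun x => by simp [hH], fun x => ?_⟩
      simp [hH, hd.d_d rfl rfl, hE (i + 1) i rfl])
    m₀ H₀ h₀
  refine ⟨fun m n hn => hn ▸ H m, ?_⟩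
  rintro l _ _ rfl rfl x
  exact hH l x

/-- A chain map from a complex of projectives to an augmented exact complex is null-homotopic when
its composition with the augmentation is a coboundary. -/
theorem IsAugmented.exists_homotopy (hX : IsAugmented d aug) (hdS : IsExactComplex dS)
    (hS : ∀ i, Module.Projective R (S i)) (hSX : ∀ j, HomAcyclic σ dS (X j))
    (E : ∀ m, S m →ₛₗ[σ] X m)
    (hE : ∀ m n, m = n + 1 → ∀ x, E n (dS m n x) = d m n (E m x))
    (γ : S (-1) →ₛₗ[σ] M) (hγ : ∀ x, aug (E 0 x) = γ (dS 0 (-1) x)) :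
    ∃ H : ∀ m n, n = m + 1 → (S m →ₛₗ[σ] X n), ∀ l m n (hl : m = l + 1) (hn : n = m + 1) x,
      E m x = d n m (H m n hn x) + H l m hl (dS m l x) := by
  have := hS (-1)
  -- The homotopy starts in degree -1 with a lift of γ. By `ker_aug`, the starting condition only
  -- asks that `H₀ d` and `E 0` agree after augmentation, which is the hypothesis on γ.
  obtain ⟨H₀, hH₀⟩ := exists_semilinear_lift aug γ fun x => hX.surjective _
  refine exists_homotopy_of_start hdS hS hX.exact hSX E hE (-1) H₀ fun (x : S 0) => ?_
  change d 0 (-1) (H₀ (dS 0 (-1) x)) = E (-1) (dS 0 (-1) x)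
  rw [hE 0 (-1) (by norm_num), ← sub_eq_zero, ← map_sub, ← hX.ker_aug, map_sub, hH₀, hγ, sub_self]

/-- Chain maps with the same composition with the augmentation, up to a coboundary, induce the same
map on cohomology. -/
theorem IsAugmented.comp_sub_coboundary (hX : IsAugmented d aug) (hdS : IsExactComplex dS)
    (hS : ∀ i, Module.Projective R (S i)) (hSX : ∀ j, HomAcyclic σ dS (X j))
    (E E' : ∀ m, S m →ₛₗ[σ] X m)
    (hE : ∀ m n, m = n + 1 → ∀ x, E n (dS m n x) = d m n (E m x))
    (hE' : ∀ m n, m = n + 1 → ∀ x, E' n (dS m n x) = d m n (E' m x))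
    (γ : S (-1) →ₛₗ[σ] M) (hγ : ∀ x, aug (E 0 x) - aug (E' 0 x) = γ (dS 0 (-1) x))
    {N : Type*} [AddCommGroup N] [Module R' N] {m l n : ℤ} (hl : m = l + 1) (hn : n = m + 1)
    (f : X m →ₗ[R'] N) (hf : ∀ x, f (d n m x) = 0) :
    ∃ g : S l →ₛₗ[σ] N, ∀ x, f (E m x) - f (E' m x) = g (dS m l x) := by
  obtain ⟨H, hH⟩ := hX.exists_homotopy hdS hS hSX (fun m => E m - E' m)
    (fun m n h x => by simp [hE m n h, hE' m n h]) γ fun x => by simp [hγ]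
  refine ⟨f.comp (H l m hl), fun x => ?_⟩
  have := hH l m n hl hn x
  rw [LinearMap.sub_apply] at this
  rw [← map_sub, this, map_add, hf, zero_add]
  rfl

/-- Every cocycle with values in the augmentation module lifts to a chain map. -/
theorem IsAugmented.exists_chainMap (hX : IsAugmented d aug) (hdS : IsExactComplex dS)
    (hS : ∀ i, Module.Projective R (S i)) (hSX : ∀ j, HomAcyclic σ dS (X j))
    (f : S 0 →ₛₗ[σ] M) (hf : ∀ x, f (dS 1 0 x) = 0) :
    ∃ E : ∀ m, S m →ₛₗ[σ] X m, (∀ m n, m = n + 1 → ∀ x, E n (dS m n x) = d m n (E m x)) ∧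
      ∀ x, aug (E 0 x) = f x := by
  have := hS 0
  obtain ⟨E₀, hE₀⟩ := exists_semilinear_lift aug f fun x => hX.surjective _
  -- The invariant is that `E` sends boundaries to cycles. In degree 0 it holds because cycles are
  -- the kernel of the augmentation and `f` is a cocycle.
  obtain ⟨E, hE0, hE⟩ := exists_int_seq (α := fun i => S i →ₛₗ[σ] X i)
    (fun i E => ∀ n, i = n + 1 → ∀ x, d i n (E (dS (i + 1) i x)) = 0)
    (fun i E E' => ∀ x, E (dS (i + 1) i x) = d (i + 1) i (E' x))
    (fun i E hE => by
      obtain ⟨E', hE'⟩ := hX.exact.exists_lift hS (l := i - 1) rfl (by omega)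
        (E.comp (dS (i + 1) i)) fun x => hE (i - 1) (by omega) x
      refine ⟨E', fun x => (hE' x).symm, fun n hn x => ?_⟩
      obtain rfl : i = n := by omega
      rw [hE', LinearMap.comp_apply, hdS.d_d rfl rfl, map_zero])
    (fun i E' hE' => by
      obtain ⟨E, hE⟩ := hSX i (i + 1 + 1) (i + 1) i rfl rfl ((d (i + 1) i).comp E')
        fun x => hE' i rfl x
      refine ⟨E, hE, fun n hn x => ?_⟩
      rw [hE, LinearMap.comp_apply, hX.exact.d_d rfl hn])
    0 E₀ fun n hn x => by
      obtain rfl : n = -1 := by omega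
      rw [← hX.ker_aug, hE₀]
      exact hf x
  refine ⟨E, ?_, by rw [hE0]; exact hE₀⟩
  rintro _ n rfl x
  exact hE n x

theorem HomAcyclic.of_retract {M N : Type*} [AddCommGroup M] [AddCommGroup N] [Module R' M]
    [Module R' N] {κ : Type*} [Fintype κ] (h : HomAcyclic σ dS M) (ι : κ → N →ₗ[R'] M)
    (π : κ → M →ₗ[R'] N) (hπ : ∀ x, ∑ c, π c (ι c x) = x) : HomAcyclic σ dS N := by
  intro i j l hi hj g hg
  choose g' hg' using fun c => h i j l hi hj ((ι c).comp g) fun x => by simp [hg]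
  refine ⟨∑ c, (π c).comp (g' c), fun x => ?_⟩
  rw [LinearMap.sum_apply]
  simp only [LinearMap.comp_apply, hg']
  exact hπ _

theorem exists_dual_basis (Y : Type*) [AddCommGroup Y] [Module R Y] [Module.Finite R Y]
    [Module.Projective R Y] : ∃ (n : ℕ) (r : Fin n → Y) (r' : Fin n → Y →ₗ[R] R),
      ∀ y, ∑ c, r' c y • r c = y := by
  obtain ⟨n, f, g, -, -, hfg⟩ := Module.Finite.exists_comp_eq_id_of_projective R Y
  refine ⟨n, fun c => f (Pi.single c 1), fun c => (LinearMap.proj c).comp g, fun y => ?_⟩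
  conv_rhs => rw [← LinearMap.id_apply (R := R) y, ← hfg, LinearMap.comp_apply,
    pi_eq_sum_univ' (g y), map_sum]
  refine Finset.sum_congr rfl fun c _ => ?_
  rw [← map_smul]
  congr 1

/-- A finite dual basis exhibits `Y` as a retract of a finite sum of copies of the ring, so
acyclicity need only be known for the ring itself. -/
theorem HomAcyclic.of_finite_projective (h : HomAcyclic σ dS R') (Y : Type*) [AddCommGroup Y]
    [Module R' Y] [Module.Finite R' Y] [Module.Projective R' Y] : HomAcyclic σ dS Y := by
  obtain ⟨n, r, r', hr⟩ := exists_dual_basis (R := R') Y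
  exact h.of_retract r' (fun c => LinearMap.toSpanSingleton R' Y (r c)) hr

end Complexes

/-! ### Complete resolutions as complexes -/

namespace CompleteResolution

variable {R : Type v} [Ring R] {M : Type w} [AddCommGroup M] [Module R M]
  (P : CompleteResolution R M)

/-- The differentials of a complete resolution, as linear maps. -/
def d (i j : ℤ) : P.cx.X i →ₗ[R] P.cx.X j := (P.cx.d i j).hom

theorem isAugmented : IsAugmented P.d P.aug where
  exact := by
    rintro i j l rfl hj
    obtain rfl : l = j - 1 := by omega
    exact P.exact j
  surjective := P.aug_surjective
  exact_zero := P.aug_exact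

theorem homAcyclic : HomAcyclic (RingHom.id R) P.d R := by
  rintro i j l rfl hj g hg
  obtain rfl : l = j - 1 := by omega
  obtain ⟨h, hh⟩ := (P.dual_exact j g).1 (LinearMap.ext hg)
  exact ⟨h, fun x => LinearMap.congr_fun hh x⟩

/-- A family `P (c + m) → X m` commuting with the differentials is an ordinary chain map out of the
shifted complex. The shift keeps the sign of the differential, because the sign in the cup product
already makes the relevant maps commute strictly. -/
theorem homAcyclic_shift {R' : Type*} [Ring R'] {σ : R →+* R'} {N : Type*} [AddCommGroup N]
    [Module R' N] (h : HomAcyclic σ P.d N) (c : ℤ) :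
    HomAcyclic σ (S := fun m => P.cx.X (c + m)) (fun i j => P.d (c + i) (c + j)) N :=
  fun i j l hi hj => h (c + i) (c + j) (c + l) (by omega) (by omega)

theorem isExactComplex_shift (c : ℤ) :
    IsExactComplex (X := fun m => P.cx.X (c + m)) (fun i j => P.d (c + i) (c + j)) :=
  fun i j l hi hj => P.isAugmented.exact (c + i) (c + j) (c + l) (by omega) (by omega)

end CompleteResolution

/-! ### Graded rings from cup products -/

namespace HomCohomology

section Classes

variable {R : Type v} [Ring R] {P : ChainComplex (ModuleCat.{v} R) ℤ} {M : Type w}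
  [AddCommGroup M] [Module R M]

/-- The class of a cocycle. -/
def mk {n : ℤ} (f : P.X n →ₗ[R] M) (hf : f ∈ cocycles P M n) : HomCohomology P M n :=
  QuotientAddGroup.mk ⟨f, hf⟩

theorem exists_mk {n : ℤ} (x : HomCohomology P M n) : ∃ f hf, mk f hf = x := by
  obtain ⟨⟨f, hf⟩, rfl⟩ := QuotientAddGroup.mk_surjective x
  exact ⟨f, hf, rfl⟩

theorem mk_eq_zero {n l : ℤ} (hl : n = l + 1) {f : P.X n →ₗ[R] M} (hf : f ∈ cocycles P M n) :
    mk f hf = 0 ↔ ∃ g : P.X l →ₗ[R] M, ∀ x, f x = g ((P.d n l).hom x) := by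
  obtain rfl : l = n - 1 := by omega
  refine (QuotientAddGroup.eq_zero_iff _).trans ?_
  refine (mem_coboundaries (P := P) (M := M) (f := f)).trans ?_
  exact exists_congr fun g => forall_congr' fun x => eq_comm

theorem mk_eq_mk {n l : ℤ} (hl : n = l + 1) {f f' : P.X n →ₗ[R] M} (hf : f ∈ cocycles P M n)
    (hf' : f' ∈ cocycles P M n) :
    mk f hf = mk f' hf' ↔ ∃ g : P.X l →ₗ[R] M, ∀ x, f x - f' x = g ((P.d n l).hom x) := by
  rw [← sub_eq_zero]
  exact mk_eq_zero hl (sub_mem hf hf')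

end Classes

variable {R : Type v} [Ring R] {M : Type w} [AddCommGroup M] [Module R M]
  {P : CompleteResolution R M}

/-- A pairing of cochains is representable if multiplication by a cocycle on the left is, up to a
sign, composition with a chain map, and multiplication by the augmentation on the right is
composition with an augmentation-preserving chain map. -/
structure IsRepresentable (Φ : ∀ i j n : ℤ, i + j = n →
      ((P.cx.X i →ₗ[R] M) →+ (P.cx.X j →ₗ[R] M) →+ (P.cx.X n →ₗ[R] M))) : Prop where
  left : ∀ i, ∀ f ∈ cocycles P.cx M i, ∃ D : ∀ m n, i + m = n → (P.cx.X n →ₗ[R] P.cx.X m),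
    (∀ m n m' n' (h : i + m = n) (h' : i + m' = n'), m = m' + 1 → ∀ x,
      D m' n' h' (P.d n n' x) = P.d m m' (D m n h x)) ∧
    ∀ j n h (g : P.cx.X j →ₗ[R] M) x,
      (((i * j).negOnePow : ℤ) • Φ i j n h f g) x = g (D j n h x)
  right : ∃ E : ∀ m, P.cx.X m →ₗ[R] P.cx.X m,
    (∀ m n, m = n + 1 → ∀ x, E n (P.d m n x) = P.d m n (E m x)) ∧
    (∀ x, P.aug (E 0 x) = P.aug x) ∧
    ∀ i h (f : P.cx.X i →ₗ[R] M) x, Φ i 0 i h f P.aug x = f (E i x)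

theorem aug_mem_cocycles : P.aug ∈ cocycles P.cx M 0 :=
  mem_cocycles.2 fun x => P.aug_exact.apply_apply_eq_zero x

section Ring

variable {Φ : ∀ i j n : ℤ, i + j = n →
      ((P.cx.X i →ₗ[R] M) →+ (P.cx.X j →ₗ[R] M) →+ (P.cx.X n →ₗ[R] M))}
    (hΦ : ∀ i j n i' j' n' (h : i + j = n) (hi : i + 1 = i') (hj : j + 1 = j') (hn : n + 1 = n')
      f g, precomp P.cx M n' n (Φ i j n h f g) =
        Φ i' j n' (by omega) (precomp P.cx M i' i f) g +
          (i.negOnePow : ℤ) • Φ i j' n' (by omega) f (precomp P.cx M j' j g))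

include hΦ in
theorem pairing_mem_cocycles {i j n : ℤ} (h : i + j = n) {f : P.cx.X i →ₗ[R] M}
    {g : P.cx.X j →ₗ[R] M} (hf : f ∈ cocycles P.cx M i) (hg : g ∈ cocycles P.cx M j) :
    ((i * j).negOnePow : ℤ) • Φ i j n h f g ∈ cocycles P.cx M n := by
  have hf : precomp P.cx M (i + 1) i f = 0 := hf
  have hg : precomp P.cx M (j + 1) j g = 0 := hg
  refine zsmul_mem (AddMonoidHom.mem_ker.2 ?_) _
  rw [hΦ i j n (i + 1) (j + 1) (n + 1) h rfl rfl rfl f g, hf, hg]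
  simp

/-- The equality lives in the graded monoid so that the target degree may be any `n` equal to `i +
j`; the unit laws and associativity compare degrees that agree only propositionally. -/
theorem cup_mk {i j n : ℤ} (h : i + j = n) {f : P.cx.X i →ₗ[R] M}
    {g : P.cx.X j →ₗ[R] M} (hf : f ∈ cocycles P.cx M i) (hg : g ∈ cocycles P.cx M j) :
    GradedMonoid.mk (A := HomCohomology P.cx M) (i + j) (cup Φ hΦ i j (mk f hf) (mk g hg)) =
      GradedMonoid.mk n (mk (((i * j).negOnePow : ℤ) • Φ i j n h f g)
        (pairing_mem_cocycles hΦ h hf hg)) := by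
  subst h
  rfl

theorem cup_mk_eq {i j : ℤ} {f : P.cx.X i →ₗ[R] M}
    {g : P.cx.X j →ₗ[R] M} (hf : f ∈ cocycles P.cx M i) (hg : g ∈ cocycles P.cx M j) :
    cup Φ hΦ i j (mk f hf) (mk g hg) = mk (((i * j).negOnePow : ℤ) • Φ i j (i + j) rfl f g)
        (pairing_mem_cocycles hΦ rfl hf hg) := rfl

/-- Cochain-level comparison of the effect of two chain maps `P → P` of degree `-c`. -/
theorem comp_chainMap_congr (c : ℤ) (D D' : ∀ m n, c + m = n → (P.cx.X n →ₗ[R] P.cx.X m))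
    (hD : ∀ m n m' n' (h : c + m = n) (h' : c + m' = n'), m = m' + 1 → ∀ x,
      D m' n' h' (P.d n n' x) = P.d m m' (D m n h x))
    (hD' : ∀ m n m' n' (h : c + m = n) (h' : c + m' = n'), m = m' + 1 → ∀ x,
      D' m' n' h' (P.d n n' x) = P.d m m' (D' m n h x))
    {l : ℤ} (hl : c = l + 1) (hc : c + 0 = c)
    (γ : P.cx.X l →ₗ[R] M) (hγ : ∀ x, P.aug (D 0 c hc x) - P.aug (D' 0 c hc x) = γ (P.d c l x))
    {N : Type*} [AddCommGroup N] [Module R N] {m n l' : ℤ} (h : c + m = n) (hn : n = l' + 1)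
    (f : P.cx.X m →ₗ[R] N) (hf : ∀ x, f (P.d (m + 1) m x) = 0) :
    ∃ g : P.cx.X l' →ₗ[R] N, ∀ x, f (D m n h x) - f (D' m n h x) = g (P.d n l' x) := by
  subst h
  obtain rfl : l = c + -1 := by omega
  obtain ⟨l', rfl⟩ : ∃ l'', l' = c + l'' := ⟨l' - c, by omega⟩
  -- After shifting the source by `c`, both families are chain maps of degree 0 and the homotopy
  -- comparison applies.
  refine P.isAugmented.comp_sub_coboundary (σ := RingHom.id R) (P.isExactComplex_shift c)
    (fun i => P.projective _) (fun j => P.homAcyclic_shift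
      (have := P.finite j; have := P.projective j; P.homAcyclic.of_finite_projective _) c)
    (fun m => D m (c + m) rfl) (fun m => D' m (c + m) rfl)
    (fun m n h x => hD m _ n _ rfl rfl h x) (fun m n h x => hD' m _ n _ rfl rfl h x) γ
    (fun x => ?_) (m := m) (l := l') (by omega) rfl f hf
  have key : ∀ c' (h' : c + 0 = c') (y : P.cx.X c'), P.aug (D 0 c' h' y) - P.aug (D' 0 c' h' y) =
      γ (P.d c' (c + -1) y) := by
    rintro c' h' y
    obtain rfl : c = c' := by omega
    exact hγ y
  exact key (c + 0) rfl x

variable (hR : IsRepresentable Φ)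

include hR

/-- Right multiplication by the augmentation is composition with an augmentation-preserving
endomorphism of the resolution, hence with a map homotopic to the identity. -/
theorem cup_one' (i : ℤ) {f : P.cx.X i →ₗ[R] M} (hf : f ∈ cocycles P.cx M i) :
    ∃ g : P.cx.X (i - 1) →ₗ[R] M, ∀ x,
      Φ i 0 i (add_zero i) f P.aug x - f x = g (P.d i (i - 1) x) := by
  obtain ⟨E, hE, hE0, hEΦ⟩ := hR.right
  obtain ⟨g, hg⟩ := P.isAugmented.comp_sub_coboundary (σ := RingHom.id R) P.isAugmented.exact
    P.projective (fun j =>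
      (have := P.finite j; have := P.projective j; P.homAcyclic.of_finite_projective _))
    E (fun m => LinearMap.id) hE (fun _ _ _ _ => rfl) 0 (fun x => by simp [hE0])
    (m := i) (l := i - 1) (by omega) rfl f (mem_cocycles.1 hf)
  exact ⟨g, fun x => by rw [hEΦ]; exact hg x⟩

/-- The unit property on the right gives the augmentation of the chain map of a cocycle. -/
theorem aug_comp {i : ℤ} {f : P.cx.X i →ₗ[R] M} (hf : f ∈ cocycles P.cx M i)
    {D : ∀ m n, i + m = n → (P.cx.X n →ₗ[R] P.cx.X m)}
    (hD : ∀ j n h (g : P.cx.X j →ₗ[R] M) x,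
      (((i * j).negOnePow : ℤ) • Φ i j n h f g) x = g (D j n h x)) {l : ℤ} (hl : i = l + 1) :
    ∃ g : P.cx.X l →ₗ[R] M, ∀ x, P.aug (D 0 i (add_zero i) x) - f x = g (P.d i l x) := by
  obtain rfl : l = i - 1 := by omega
  obtain ⟨g, hg⟩ := cup_one' hR i hf
  refine ⟨g, fun x => ?_⟩
  rw [← hg, ← hD]
  simp

/-- The chain map representing left multiplication by the augmentation has degree 0. Its own
augmentation is the product of the augmentation with itself, which the right unit data evaluate to
the augmentation; so it too is homotopic to the identity. -/
theorem one_cup' (j : ℤ) {g : P.cx.X j →ₗ[R] M} (hg : g ∈ cocycles P.cx M j) :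
    ∃ g' : P.cx.X (j - 1) →ₗ[R] M, ∀ x,
      Φ 0 j j (zero_add j) P.aug g x - g x = g' (P.d j (j - 1) x) := by
  obtain ⟨E, hE, hE0, hEΦ⟩ := hR.right
  obtain ⟨D, hD, hDΦ⟩ := hR.left 0 P.aug aug_mem_cocycles
  obtain ⟨g', hg'⟩ := comp_chainMap_congr (P := P) 0 D (fun m n h => (by
      obtain rfl : m = n := by omega
      exact LinearMap.id)) hD (fun m n m' n' h h' hm x => by
        obtain rfl : m = n := by omega
        obtain rfl : m' = n' := by omega
        rfl) (l := -1) (by norm_num) (by norm_num) 0 (fun x => by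
        rw [← hDΦ]
        simp [hEΦ, hE0]) (zero_add j) (l' := j - 1) (by omega) g (mem_cocycles.1 hg)
  refine ⟨g', fun x => ?_⟩
  rw [← hg', ← hDΦ]
  simp

/-- Both triple products are `h` composed with a chain map of degree `-(i + j)`: the one
representing the product of `f` and `g`, or the composite of those representing `f` and `g`. Both
have augmentation cohomologous to that product, so they are homotopic. -/
theorem cup_assoc' {i j l : ℤ} {f : P.cx.X i →ₗ[R] M} {g : P.cx.X j →ₗ[R] M}
    {h : P.cx.X l →ₗ[R] M} (hf : f ∈ cocycles P.cx M i) (hg : g ∈ cocycles P.cx M j)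
    (hh : h ∈ cocycles P.cx M l)
    (hfg : ((i * j).negOnePow : ℤ) • Φ i j (i + j) rfl f g ∈ cocycles P.cx M (i + j)) :
    ∃ t : P.cx.X (i + j + l - 1) →ₗ[R] M, ∀ x,
      ((((i + j) * l).negOnePow : ℤ) • Φ (i + j) l (i + j + l) rfl
        (((i * j).negOnePow : ℤ) • Φ i j (i + j) rfl f g) h) x -
      (((i * (j + l)).negOnePow : ℤ) • Φ i (j + l) (i + j + l) (by omega) f
        (((j * l).negOnePow : ℤ) • Φ j l (j + l) rfl g h)) x = t (P.d (i + j + l) (i + j + l - 1) x) := by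
  obtain ⟨D, hD, hDΦ⟩ := hR.left i f hf
  obtain ⟨D', hD', hDΦ'⟩ := hR.left j g hg
  obtain ⟨D₂, hD₂, hDΦ₂⟩ := hR.left (i + j) _ hfg
  obtain ⟨γ, hγ⟩ := aug_comp hR hfg hDΦ₂ (l := i + j - 1) (by omega)
  obtain ⟨γ', hγ'⟩ := aug_comp hR hg hDΦ' (l := j - 1) (by omega)
  -- The augmentation of `D₂` differs from the product by γ, that of `D'` from `g` by γ'. Pulling γ'
  -- back along `D` leaves the total discrepancy `γ - γ' D`.
  obtain ⟨t, ht⟩ := comp_chainMap_congr (i + j) D₂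
    (fun m n h => D' m (j + m) rfl ∘ₗ D (j + m) n (by omega)) hD₂
    (fun m n m' n' h h' hm x => by
      rw [LinearMap.comp_apply, LinearMap.comp_apply, hD (j + m) n (j + m') n' (by omega) (by omega)
        (by omega), hD' m _ m' _ rfl rfl hm])
    (l := i + j - 1) (by omega) (add_zero _) (γ - γ' ∘ₗ D (j - 1) _ (by omega)) (fun x => by
      have h1 : ∀ j' (hj' : j + 0 = j') (hj'' : i + j' = i + j),
          P.aug (D' 0 j' hj' (D j' (i + j) hj'' x)) =
          γ' (D (j - 1) (i + j - 1) (by omega) (P.d (i + j) (i + j - 1) x)) + g (D j (i + j) rfl x) := by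
        rintro j' hj' hj''
        obtain rfl : j = j' := by omega
        rw [hD j (i + j) (j - 1) _ rfl _ (by omega), ← hγ']
        abel
      rw [LinearMap.comp_apply, h1, LinearMap.sub_apply, ← hγ, ← hDΦ j (i + j) rfl g x,
        LinearMap.comp_apply]
      abel) rfl (l' := i + j + l - 1) (by omega) h (mem_cocycles.1 hh)
  refine ⟨t, fun x => ?_⟩
  rw [← ht, hDΦ₂, hDΦ, hDΦ', LinearMap.comp_apply]

end Ring

end HomCohomology

open HomCohomology in
/-- The graded ring structure given by a representable pairing of cochains. -/
@[reducible]
noncomputable def CompleteResolution.gRing {R : Type v} [Ring R] {M : Type w} [AddCommGroup M]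
    [Module R M] {P : CompleteResolution R M} {Φ : ∀ i j n : ℤ, i + j = n →
      ((P.cx.X i →ₗ[R] M) →+ (P.cx.X j →ₗ[R] M) →+ (P.cx.X n →ₗ[R] M))}
    (hΦ : ∀ i j n i' j' n' (h : i + j = n) (hi : i + 1 = i') (hj : j + 1 = j') (hn : n + 1 = n')
      f g, precomp P.cx M n' n (Φ i j n h f g) =
        Φ i' j n' (by omega) (precomp P.cx M i' i f) g +
          (i.negOnePow : ℤ) • Φ i j' n' (by omega) f (precomp P.cx M j' j g))
    (hR : IsRepresentable Φ) : DirectSum.GRing (HomCohomology P.cx M) :=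
  letI : GradedMonoid.GMul (HomCohomology P.cx M) := ⟨fun {i j} x y => cup Φ hΦ i j x y⟩
  letI : GradedMonoid.GOne (HomCohomology P.cx M) := ⟨HomCohomology.mk P.aug aug_mem_cocycles⟩
  { (inferInstance : GradedMonoid.GMul (HomCohomology P.cx M)),
    (inferInstance : GradedMonoid.GOne (HomCohomology P.cx M)) with
    mul_zero x := map_zero _
    zero_mul {i j} y := DFunLike.congr_fun (map_zero (cup Φ hΦ i j)) y
    mul_add x y z := map_add _ _ _
    add_mul {i j} x y z := DFunLike.congr_fun (map_add (cup Φ hΦ i j) x y) z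
    one_mul := by
      rintro ⟨j, y⟩
      obtain ⟨g, hg, rfl⟩ := exists_mk y
      refine (cup_mk hΦ (zero_add j) aug_mem_cocycles hg).trans ?_
      congr 1
      rw [mk_eq_mk (l := j - 1) (by omega)]
      obtain ⟨t, ht⟩ := one_cup' hR j hg
      exact ⟨t, fun x => by rw [← CompleteResolution.d, ← ht]; simp⟩
    mul_one := by
      rintro ⟨i, y⟩
      obtain ⟨f, hf, rfl⟩ := exists_mk y
      refine (cup_mk hΦ (add_zero i) hf aug_mem_cocycles).trans ?_
      congr 1
      rw [mk_eq_mk (l := i - 1) (by omega)]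
      obtain ⟨t, ht⟩ := cup_one' hR i hf
      exact ⟨t, fun x => by rw [← CompleteResolution.d, ← ht]; simp⟩
    mul_assoc := by
      rintro ⟨i, x⟩ ⟨j, y⟩ ⟨l, z⟩
      obtain ⟨f, hf, rfl⟩ := exists_mk x
      obtain ⟨g, hg, rfl⟩ := exists_mk y
      obtain ⟨h, hh, rfl⟩ := exists_mk z
      refine (cup_mk hΦ rfl (pairing_mem_cocycles hΦ rfl hf hg) hh).trans
        (Eq.trans ?_ (cup_mk hΦ (n := i + j + l) (by omega) hf (pairing_mem_cocycles hΦ rfl hg hh)).symm)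
      congr 1
      rw [mk_eq_mk (l := i + j + l - 1) (by omega)]
      exact cup_assoc' hR hf hg hh (pairing_mem_cocycles hΦ rfl hf hg)
    natCast n := n • HomCohomology.mk P.aug aug_mem_cocycles
    natCast_zero := zero_nsmul _
    natCast_succ n := succ_nsmul _ n
    intCast n := n • HomCohomology.mk P.aug aug_mem_cocycles
    intCast_ofNat n := natCast_zsmul _ n
    intCast_negSucc_ofNat n := negSucc_zsmul _ n }

section Contraction

variable {k : Type u} {A : Type v} [Field k] [Ring A] [HopfAlgebra k A]

/-! ### Contractions of tensor products over the base field -/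

variable (k A) in
/-- The identification of the trivial module with `k`. -/
def Triv.toField : Triv k A →ₗ[k] k := LinearMap.id

theorem Triv.toField_smul (a : A) (r : Triv k A) :
    Triv.toField k A (a • r) = Coalgebra.counit (R := k) a * Triv.toField k A r := rfl

variable {M N M' N' : Type*} [AddCommGroup M] [AddCommGroup N] [Module k M]
  [Module k N] [Module A M] [Module A N] [IsScalarTower k A M] [IsScalarTower k A N]
  [AddCommGroup M'] [AddCommGroup N'] [Module k M']
  [Module k N'] [Module A M'] [Module A N'] [IsScalarTower k A M'] [IsScalarTower k A N']

/-- The map `M ⊗ N → N`, `x ⊗ y ↦ f(x) y`. -/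
noncomputable def Triv.lcontract (N : Type*) [AddCommGroup N] [Module k N] (f : M →ₗ[A] Triv k A) :
    M ⊗[k] N →ₗ[k] N :=
  TensorProduct.lift ((LinearMap.lsmul k N).comp ((Triv.toField k A).comp (f.restrictScalars k)))

/-- The map `M ⊗ N → M`, `x ⊗ y ↦ g(y) x`. -/
noncomputable def Triv.rcontract (M : Type*) [AddCommGroup M] [Module k M] (g : N →ₗ[A] Triv k A) :
    M ⊗[k] N →ₗ[k] M :=
  TensorProduct.lift
    ((LinearMap.lsmul k M).comp ((Triv.toField k A).comp (g.restrictScalars k))).flip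

@[simp]
theorem Triv.lcontract_tmul (f : M →ₗ[A] Triv k A) (x : M) (y : N) :
    Triv.lcontract N f (x ⊗ₜ y) = Triv.toField k A (f x) • y := rfl

@[simp]
theorem Triv.rcontract_tmul (g : N →ₗ[A] Triv k A) (x : M) (y : N) :
    Triv.rcontract M g (x ⊗ₜ y) = Triv.toField k A (g y) • x := rfl

/-- The counit axiom: `A` acts on the value of `f` through ε, and the sum of ε(a₁) a₂ is a. -/
theorem Triv.lcontract_diagAct (f : M →ₗ[A] Triv k A) (a : A) (t : M ⊗[k] N) :
    Triv.lcontract N f (diagAct M N a t) = a • Triv.lcontract N f t := by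
  induction t using TensorProduct.induction_on with
  | zero => simp
  | add s t hs ht => simp only [map_add, smul_add, hs, ht]
  | tmul x y =>
    rw [diagAct_tmul a (Coalgebra.Repr.arbitrary k a), map_sum]
    conv_rhs => rw [← Coalgebra.sum_counit_smul (Coalgebra.Repr.arbitrary k a), Finset.sum_smul]
    refine Finset.sum_congr rfl fun i _ => ?_
    rw [lcontract_tmul, lcontract_tmul, map_smul, Triv.toField_smul, mul_smul, smul_assoc,
      smul_comm (_ : A) (_ : k) y]

theorem Triv.rcontract_diagAct (g : N →ₗ[A] Triv k A) (a : A) (t : M ⊗[k] N) :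
    Triv.rcontract M g (diagAct M N a t) = a • Triv.rcontract M g t := by
  induction t using TensorProduct.induction_on with
  | zero => simp
  | add s t hs ht => simp only [map_add, smul_add, hs, ht]
  | tmul x y =>
    have h := congrArg (TensorProduct.lift (LinearMap.lsmul k A).flip)
      (Coalgebra.sum_tmul_counit_eq (Coalgebra.Repr.arbitrary k a))
    simp only [map_sum, TensorProduct.lift.tmul, LinearMap.flip_apply, LinearMap.lsmul_apply,
      one_smul] at h
    rw [diagAct_tmul a (Coalgebra.Repr.arbitrary k a), map_sum]
    conv_rhs => rw [← h, Finset.sum_smul]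
    refine Finset.sum_congr rfl fun i _ => ?_
    rw [rcontract_tmul, rcontract_tmul, map_smul, Triv.toField_smul, mul_smul, smul_assoc,
      smul_comm (_ : A) (_ : k) x]

theorem Triv.lcontract_lTensor (f : M →ₗ[A] Triv k A) (g : N →ₗ[k] N') (t : M ⊗[k] N) :
    Triv.lcontract N' f (LinearMap.lTensor M g t) = g (Triv.lcontract N f t) := by
  induction t using TensorProduct.induction_on with
  | zero => simp
  | add s t hs ht => simp only [map_add, hs, ht]
  | tmul x y => simp

theorem Triv.lcontract_rTensor (f : M' →ₗ[A] Triv k A) (g : M →ₗ[A] M') (t : M ⊗[k] N) :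
    Triv.lcontract N f (LinearMap.rTensor N (g.restrictScalars k) t) =
      Triv.lcontract N (f ∘ₗ g) t := by
  induction t using TensorProduct.induction_on with
  | zero => simp
  | add s t hs ht => simp only [map_add, hs, ht]
  | tmul x y => simp

theorem Triv.rcontract_rTensor (f : N →ₗ[A] Triv k A) (g : M →ₗ[k] M') (t : M ⊗[k] N) :
    Triv.rcontract M' f (LinearMap.rTensor N g t) = g (Triv.rcontract M f t) := by
  induction t using TensorProduct.induction_on with
  | zero => simp
  | add s t hs ht => simp only [map_add, hs, ht]
  | tmul x y => simp

theorem Triv.rcontract_lTensor (f : N' →ₗ[A] Triv k A) (g : N →ₗ[A] N') (t : M ⊗[k] N) :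
    Triv.rcontract M f (LinearMap.lTensor M (g.restrictScalars k) t) =
      Triv.rcontract M (f ∘ₗ g) t := by
  induction t using TensorProduct.induction_on with
  | zero => simp
  | add s t hs ht => simp only [map_add, hs, ht]
  | tmul x y => simp

theorem Triv.lcontract_zero (t : M ⊗[k] N) :
    Triv.lcontract N (0 : M →ₗ[A] Triv k A) t = 0 := by
  induction t using TensorProduct.induction_on with
  | zero => simp
  | add s t hs ht => simp only [map_add, hs, ht, add_zero]
  | tmul x y => simp

theorem Triv.rcontract_zero (t : M ⊗[k] N) :
    Triv.rcontract M (0 : N →ₗ[A] Triv k A) t = 0 := by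
  induction t using TensorProduct.induction_on with
  | zero => simp
  | add s t hs ht => simp only [map_add, hs, ht, add_zero]
  | tmul x y => simp

theorem Triv.pairing_eq_lcontract (f : M →ₗ[A] Triv k A) (g : N →ₗ[A] Triv k A) (t : M ⊗[k] N) :
    Triv.pairing f g t = g (Triv.lcontract N f t) := by
  induction t using TensorProduct.induction_on with
  | zero => simp
  | add s t hs ht => simp only [map_add, hs, ht]
  | tmul x y => exact ((g.restrictScalars k).map_smul (Triv.toField k A (f x)) y).symm

theorem Triv.pairing_eq_rcontract (f : M →ₗ[A] Triv k A) (g : N →ₗ[A] Triv k A) (t : M ⊗[k] N) :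
    Triv.pairing f g t = f (Triv.rcontract M g t) := by
  induction t using TensorProduct.induction_on with
  | zero => simp
  | add s t hs ht => simp only [map_add, hs, ht]
  | tmul x y =>
    refine Eq.trans ?_ ((f.restrictScalars k).map_smul (Triv.toField k A (g y)) x).symm
    exact mul_comm (G := k) _ _

/-! ### Contractions of tensor products of bimodules -/

variable (k A) in
/-- The identification of the regular bimodule with `A`. -/
def Regular.toA : Regular k A →ₗ[k] A := LinearMap.id

theorem Regular.toA_smul (a b : A) (m : Regular k A) :
    Regular.toA k A ((a ⊗ₜ[k] MulOpposite.op b : Env k A) • m) = a * Regular.toA k A m * b :=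
  Regular.tmul_smul k A a b m

section Bimodule

variable {X Y X' Y' : Type*} [AddCommGroup X] [AddCommGroup Y] [AddCommGroup X'] [AddCommGroup Y']
  [Module k X] [Module k Y] [Module k X'] [Module k Y']
  [Module (Env k A) X] [Module (Env k A) Y] [Module (Env k A) X'] [Module (Env k A) Y']
  [IsScalarTower k (Env k A) X] [IsScalarTower k (Env k A) Y]
  [IsScalarTower k (Env k A) X'] [IsScalarTower k (Env k A) Y']

theorem lact_apply (a : A) (x : X) : lact k X a x = (a ⊗ₜ[k] 1 : Env k A) • x := rfl

theorem ract_apply (a : A) (x : X) :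
    ract k X a x = (1 ⊗ₜ[k] MulOpposite.op a : Env k A) • x := rfl

theorem lact_lact (a b : A) (x : X) : lact k X a (lact k X b x) = lact k X (a * b) x := by
  simp [lact_apply, smul_smul]

theorem ract_ract (a b : A) (x : X) : ract k X a (ract k X b x) = ract k X (b * a) x := by
  simp [ract_apply, smul_smul]

theorem lact_ract (a b : A) (x : X) : lact k X a (ract k X b x) = ract k X b (lact k X a x) := by
  simp [lact_apply, ract_apply, smul_smul]

theorem tmul_smul_eq (a b : A) (x : X) :
    (a ⊗ₜ[k] MulOpposite.op b : Env k A) • x = lact k X a (ract k X b x) := by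
  simp [lact_apply, ract_apply, smul_smul]

theorem map_lact (f : X →ₗ[Env k A] X') (a : A) (x : X) :
    f (lact k X a x) = lact k X' a (f x) := map_smul f _ _

theorem map_ract (f : X →ₗ[Env k A] X') (a : A) (x : X) :
    f (ract k X a x) = ract k X' a (f x) := map_smul f _ _

theorem Regular.toA_lact (a : A) (m : Regular k A) :
    Regular.toA k A (lact k _ a m) = a * Regular.toA k A m :=
  (Regular.toA_smul a 1 m).trans (mul_one _)

theorem Regular.toA_ract (a : A) (m : Regular k A) :
    Regular.toA k A (ract k _ a m) = Regular.toA k A m * a :=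
  (Regular.toA_smul 1 a m).trans (by rw [one_mul])

variable (k A) in
/-- The left action on a bimodule, as a linear map in both variables. -/
noncomputable def lactHom (X : Type*) [AddCommGroup X] [Module k X] [Module (Env k A) X]
    [IsScalarTower k (Env k A) X] : A →ₗ[k] X →ₗ[k] X :=
  (Algebra.lsmul k k X).toLinearMap ∘ₗ (Algebra.TensorProduct.includeLeft (R := k) (S := k)
    (A := A) (B := Aᵐᵒᵖ)).toLinearMap

variable (k A) in
/-- The right action on a bimodule, as a linear map in both variables. -/
noncomputable def ractHom (X : Type*) [AddCommGroup X] [Module k X] [Module (Env k A) X]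
    [IsScalarTower k (Env k A) X] : A →ₗ[k] X →ₗ[k] X :=
  (Algebra.lsmul k k X).toLinearMap ∘ₗ (Algebra.TensorProduct.includeRight (R := k)
    (A := A) (B := Aᵐᵒᵖ)).toLinearMap ∘ₗ (MulOpposite.opLinearEquiv k).toLinearMap

/-- The linear map on `X ⊗_A Y` given by a balanced bilinear map. -/
noncomputable def BalTensor.lift {Z : Type*} [AddCommGroup Z] [Module k Z]
    (φ : X →ₗ[k] Y →ₗ[k] Z) (hφ : ∀ (a : A) x y, φ (ract k X a x) y = φ x (lact k Y a y)) :
    BalTensor k A X Y →ₗ[k] Z :=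
  (balancedRel k A X Y).liftQ (TensorProduct.lift φ) <| Submodule.span_le.2 <| by
    rintro _ ⟨a, x, y, rfl⟩
    rw [SetLike.mem_coe, LinearMap.mem_ker, map_sub, TensorProduct.lift.tmul,
      TensorProduct.lift.tmul, hφ, sub_self]

variable (k A) in
/-- The class of `x ⊗ y` in `X ⊗_A Y`. -/
noncomputable def BalTensor.tmul (x : X) (y : Y) : BalTensor k A X Y :=
  Submodule.Quotient.mk (x ⊗ₜ[k] y)

theorem BalTensor.ract_tmul (a : A) (x : X) (y : Y) :
    BalTensor.tmul k A (ract k X a x) y = BalTensor.tmul k A x (lact k Y a y) :=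
  (Submodule.Quotient.eq _).2 (Submodule.subset_span ⟨a, x, y, rfl⟩)

variable (k A X Y) in
/-- The class of `x ⊗ y`, as a bilinear map. -/
noncomputable def BalTensor.mk : X →ₗ[k] Y →ₗ[k] BalTensor k A X Y :=
  (TensorProduct.mk k X Y).compr₂ (balancedRel k A X Y).mkQ

@[elab_as_elim]
theorem BalTensor.induction_on {p : BalTensor k A X Y → Prop} (t : BalTensor k A X Y)
    (tmul : ∀ x y, p (BalTensor.tmul k A x y)) (add : ∀ s t, p s → p t → p (s + t)) : p t := by
  obtain ⟨t, rfl⟩ := Submodule.Quotient.mk_surjective _ t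
  induction t using TensorProduct.induction_on with
  | zero =>
    have := tmul 0 0
    rwa [BalTensor.tmul, zero_tmul] at this
  | tmul x y => exact tmul x y
  | add s t hs ht => exact add _ _ hs ht

@[simp]
theorem BalTensor.rTensor_tmul (f : X →ₗ[Env k A] X') (x : X) (y : Y) :
    BalTensor.rTensor Y f (BalTensor.tmul k A x y) = BalTensor.tmul k A (f x) y := rfl

@[simp]
theorem BalTensor.lTensor_tmul (f : Y →ₗ[Env k A] Y') (x : X) (y : Y) :
    BalTensor.lTensor X f (BalTensor.tmul k A x y) = BalTensor.tmul k A x (f y) := rfl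

@[simp]
theorem BalTensor.act_tmul (a b : A) (x : X) (y : Y) :
    BalTensor.act X Y a b (BalTensor.tmul k A x y) =
      BalTensor.tmul k A (lact k X a x) (ract k Y b y) := rfl

/-- The map `X ⊗_A Y → Y`, `x ⊗ y ↦ f(x) y`. -/
noncomputable def BalTensor.lcontract (Y : Type*) [AddCommGroup Y] [Module k Y]
    [Module (Env k A) Y] [IsScalarTower k (Env k A) Y] (f : X →ₗ[Env k A] Regular k A) :
    BalTensor k A X Y →ₗ[k] Y :=
  BalTensor.lift ((lactHom k A Y).comp ((Regular.toA k A).comp (f.restrictScalars k)))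
    fun a x y => by
      change lact k Y (Regular.toA k A (f (ract k X a x))) y =
        lact k Y (Regular.toA k A (f x)) (lact k Y a y)
      rw [map_ract, Regular.toA_ract, lact_lact]

/-- The map `X ⊗_A Y → X`, `x ⊗ y ↦ x g(y)`. -/
noncomputable def BalTensor.rcontract (X : Type*) [AddCommGroup X] [Module k X]
    [Module (Env k A) X] [IsScalarTower k (Env k A) X] (g : Y →ₗ[Env k A] Regular k A) :
    BalTensor k A X Y →ₗ[k] X :=
  BalTensor.lift ((ractHom k A X).comp ((Regular.toA k A).comp (g.restrictScalars k))).flip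
    fun a x y => by
      change ract k X (Regular.toA k A (g y)) (ract k X a x) =
        ract k X (Regular.toA k A (g (lact k Y a y))) x
      rw [map_lact, Regular.toA_lact, ract_ract]

@[simp]
theorem BalTensor.lcontract_tmul (f : X →ₗ[Env k A] Regular k A) (x : X) (y : Y) :
    BalTensor.lcontract Y f (BalTensor.tmul k A x y) = lact k Y (Regular.toA k A (f x)) y := rfl

@[simp]
theorem BalTensor.rcontract_tmul (g : Y →ₗ[Env k A] Regular k A) (x : X) (y : Y) :
    BalTensor.rcontract X g (BalTensor.tmul k A x y) = ract k X (Regular.toA k A (g y)) x := rfl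

theorem BalTensor.lcontract_act (f : X →ₗ[Env k A] Regular k A) (a b : A)
    (t : BalTensor k A X Y) : BalTensor.lcontract Y f (BalTensor.act X Y a b t) =
      (a ⊗ₜ[k] MulOpposite.op b : Env k A) • BalTensor.lcontract Y f t := by
  induction t using BalTensor.induction_on with
  | add s t hs ht => simp only [map_add, smul_add, hs, ht]
  | tmul x y =>
    rw [act_tmul, lcontract_tmul, lcontract_tmul, tmul_smul_eq, map_lact, Regular.toA_lact,
      ← lact_lact, lact_ract]

theorem BalTensor.rcontract_act (g : Y →ₗ[Env k A] Regular k A) (a b : A)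
    (t : BalTensor k A X Y) : BalTensor.rcontract X g (BalTensor.act X Y a b t) =
      (a ⊗ₜ[k] MulOpposite.op b : Env k A) • BalTensor.rcontract X g t := by
  induction t using BalTensor.induction_on with
  | add s t hs ht => simp only [map_add, smul_add, hs, ht]
  | tmul x y =>
    rw [act_tmul, rcontract_tmul, rcontract_tmul, tmul_smul_eq, map_ract, Regular.toA_ract,
      ← ract_ract, lact_ract, lact_ract]

theorem BalTensor.lcontract_lTensor (f : X →ₗ[Env k A] Regular k A) (g : Y →ₗ[Env k A] Y')
    (t : BalTensor k A X Y) :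
    BalTensor.lcontract Y' f (BalTensor.lTensor X g t) = g (BalTensor.lcontract Y f t) := by
  induction t using BalTensor.induction_on with
  | add s t hs ht => simp only [map_add, hs, ht]
  | tmul x y => simp [map_lact]

theorem BalTensor.lcontract_rTensor (f : X' →ₗ[Env k A] Regular k A) (g : X →ₗ[Env k A] X')
    (t : BalTensor k A X Y) :
    BalTensor.lcontract Y f (BalTensor.rTensor Y g t) = BalTensor.lcontract Y (f ∘ₗ g) t := by
  induction t using BalTensor.induction_on with
  | add s t hs ht => simp only [map_add, hs, ht]
  | tmul x y => simp

theorem BalTensor.rcontract_rTensor (f : Y →ₗ[Env k A] Regular k A) (g : X →ₗ[Env k A] X')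
    (t : BalTensor k A X Y) :
    BalTensor.rcontract X' f (BalTensor.rTensor Y g t) = g (BalTensor.rcontract X f t) := by
  induction t using BalTensor.induction_on with
  | add s t hs ht => simp only [map_add, hs, ht]
  | tmul x y => simp [map_ract]

theorem BalTensor.rcontract_lTensor (f : Y' →ₗ[Env k A] Regular k A) (g : Y →ₗ[Env k A] Y')
    (t : BalTensor k A X Y) :
    BalTensor.rcontract X f (BalTensor.lTensor X g t) = BalTensor.rcontract X (f ∘ₗ g) t := by
  induction t using BalTensor.induction_on with
  | add s t hs ht => simp only [map_add, hs, ht]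
  | tmul x y => simp

theorem BalTensor.lcontract_zero (t : BalTensor k A X Y) :
    BalTensor.lcontract Y (0 : X →ₗ[Env k A] Regular k A) t = 0 := by
  induction t using BalTensor.induction_on with
  | add s t hs ht => simp only [map_add, hs, ht, add_zero]
  | tmul x y => exact LinearMap.congr_fun (map_zero (lactHom k A Y)) y

theorem BalTensor.rcontract_zero (t : BalTensor k A X Y) :
    BalTensor.rcontract X (0 : Y →ₗ[Env k A] Regular k A) t = 0 := by
  induction t using BalTensor.induction_on with
  | add s t hs ht => simp only [map_add, hs, ht, add_zero]
  | tmul x y => exact LinearMap.congr_fun (map_zero (ractHom k A X)) x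

theorem BalTensor.mul_eq_lcontract (f : X →ₗ[Env k A] Regular k A)
    (g : Y →ₗ[Env k A] Regular k A) (t : BalTensor k A X Y) :
    BalTensor.mul f g t = g (BalTensor.lcontract Y f t) := by
  induction t using BalTensor.induction_on with
  | add s t hs ht => simp only [map_add, hs, ht]
  | tmul x y =>
    rw [lcontract_tmul, map_lact]
    exact (Regular.toA_lact (Regular.toA k A (f x)) (g y)).symm

theorem BalTensor.mul_eq_rcontract (f : X →ₗ[Env k A] Regular k A)
    (g : Y →ₗ[Env k A] Regular k A) (t : BalTensor k A X Y) :
    BalTensor.mul f g t = f (BalTensor.rcontract X g t) := by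
  induction t using BalTensor.induction_on with
  | add s t hs ht => simp only [map_add, hs, ht]
  | tmul x y =>
    rw [rcontract_tmul, map_ract]
    exact (Regular.toA_ract (Regular.toA k A (g y)) (f x)).symm

end Bimodule

theorem map_env_smul {X Y : Type*} [AddCommGroup X] [AddCommGroup Y] [Module (Env k A) X]
    [Module (Env k A) Y] (φ : X →+ Y)
    (hφ : ∀ (a b : A) x, φ ((a ⊗ₜ[k] MulOpposite.op b : Env k A) • x) =
      (a ⊗ₜ[k] MulOpposite.op b : Env k A) • φ x) (e : Env k A) (x : X) : φ (e • x) = e • φ x := by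
  induction e using TensorProduct.induction_on with
  | zero =>
    have h0 : (0 : Env k A) • x = 0 := zero_smul (Env k A) x
    exact (congrArg φ h0).trans ((map_zero φ).trans (zero_smul (Env k A) (φ x)).symm)
  | add s t hs ht => rw [add_smul, map_add, add_smul, hs, ht]
  | tmul a b => exact hφ a b.unop x

theorem negOnePow_smul_smul {V : Type*} [AddCommGroup V] {i j m : ℤ} (h : i + j = m) (x : V) :
    (i.negOnePow : ℤ) • (j.negOnePow : ℤ) • x = (m.negOnePow : ℤ) • x := by
  rw [smul_smul, ← Units.val_mul, ← Int.negOnePow_add, h]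

/-! ### Cup products as compositions -/

theorem DiagonalApprox.chain_of_eq {P : CompleteResolution A (Triv k A)} (Γ : DiagonalApprox P)
    {i i' j j' n n' : ℤ} (hi : i' = i + 1) (hj : j' = j + 1) (hn : n' = n + 1) (h : i + j = n)
    (x : P.cx.X n') :
    Γ.comp i j n h (P.d n' n x) =
      LinearMap.rTensor (P.cx.X j) ((P.d i' i).restrictScalars k)
          (Γ.comp i' j n' (by omega) x) +
        (i.negOnePow : ℤ) •
          LinearMap.lTensor (P.cx.X i) ((P.d j' j).restrictScalars k)
            (Γ.comp i j' n' (by omega) x) := by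
  subst hi hj hn
  exact Γ.chain i j n h x

/-- Contracting the left factor of Γ with a cocycle kills the `d ⊗ 1` part of the differential and
leaves `(-1)ⁱ d`; the factor `(-1)^{im}` absorbs this sign, so the contraction commutes strictly
with `d`. Contracting the right factor with the augmentation kills the `1 ⊗ d` part instead. -/
theorem DiagonalApprox.isRepresentable {P : CompleteResolution A (Triv k A)}
    (Γ : DiagonalApprox P) : HomCohomology.IsRepresentable Γ.pair where
  left i f hf := by
    refine ⟨fun m n h =>
      { toFun := fun x => ((i * m).negOnePow : ℤ) • Triv.lcontract (P.cx.X m) f (Γ.comp i m n h x)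
        map_add' := fun x y => by simp only [map_add, smul_add]
        map_smul' := fun a x => by
          rw [Γ.equivariant, Triv.lcontract_diagAct, RingHom.id_apply, smul_comm] }, ?_, ?_⟩
    · rintro m n m' n' h h' hm x
      have h0 : f ∘ₗ P.d (i + 1) i = 0 := LinearMap.ext (mem_cocycles.1 hf)
      change ((i * m').negOnePow : ℤ) • Triv.lcontract _ f (Γ.comp i m' n' h' (P.d n n' x)) =
        P.d m m' (((i * m).negOnePow : ℤ) • Triv.lcontract _ f (Γ.comp i m n h x))
      rw [Γ.chain_of_eq (i' := i + 1) rfl hm (by omega), map_add, Triv.lcontract_rTensor, h0,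
        Triv.lcontract_zero, zero_add, map_zsmul, Triv.lcontract_lTensor,
        negOnePow_smul_smul (m := i * m) (by subst hm; ring), map_zsmul]
      rfl
    · intro j n h g x
      change ((i * j).negOnePow : ℤ) • Triv.pairing f g (Γ.comp i j n h x) =
        g (((i * j).negOnePow : ℤ) • Triv.lcontract _ f (Γ.comp i j n h x))
      rw [Triv.pairing_eq_lcontract, map_zsmul]
  right := by
    refine ⟨fun m =>
      { toFun := fun x => Triv.rcontract (P.cx.X m) P.aug (Γ.comp m 0 m (add_zero m) x)
        map_add' := fun x y => by simp only [map_add]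
        map_smul' := fun a x => by
          rw [Γ.equivariant, Triv.rcontract_diagAct, RingHom.id_apply] }, ?_, ?_, ?_⟩
    · rintro m n hm x
      have h0 : P.aug ∘ₗ P.d (0 + 1) 0 = 0 :=
        LinearMap.ext (mem_cocycles.1 HomCohomology.aug_mem_cocycles)
      change Triv.rcontract _ P.aug (Γ.comp n 0 n _ (P.d m n x)) =
        P.d m n (Triv.rcontract _ P.aug (Γ.comp m 0 m _ x))
      rw [Γ.chain_of_eq (i' := m) (j' := 0 + 1) hm rfl hm, map_add, map_zsmul,
        Triv.rcontract_lTensor, h0, Triv.rcontract_zero, smul_zero, add_zero,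
        Triv.rcontract_rTensor]
      rfl
    · intro x
      exact (Triv.pairing_eq_rcontract _ _ _).symm.trans (Γ.augmentation x)
    · intro i h f x
      exact Triv.pairing_eq_rcontract _ _ _

theorem BimoduleDiagonalApprox.chain_of_eq {X : BimoduleResolution k A}
    (Γ : BimoduleDiagonalApprox X)
    {i i' j j' n n' : ℤ} (hi : i' = i + 1) (hj : j' = j + 1) (hn : n' = n + 1) (h : i + j = n)
    (x : X.cx.X n') :
    Γ.comp i j n h (X.d n' n x) =
      BalTensor.rTensor (X.cx.X j) (X.d i' i) (Γ.comp i' j n' (by omega) x) +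
        (i.negOnePow : ℤ) • BalTensor.lTensor (X.cx.X i) (X.d j' j)
            (Γ.comp i j' n' (by omega) x) := by
  subst hi hj hn
  exact Γ.chain i j n h x

/-- The same contractions work over the noncommutative base: a bimodule map to `A` turns `x ⊗ y`
into `f(x) y` or `x g(y)`, both well defined on the balanced tensor product. -/
theorem BimoduleDiagonalApprox.isRepresentable {X : BimoduleResolution k A}
    (Γ : BimoduleDiagonalApprox X) : HomCohomology.IsRepresentable Γ.pair where
  left i f hf := by
    refine ⟨fun m n h =>
      { toFun := fun x =>
          ((i * m).negOnePow : ℤ) • BalTensor.lcontract (X.cx.X m) f (Γ.comp i m n h x)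
        map_add' := fun x y => by simp only [map_add, smul_add]
        map_smul' := fun e x => by
          refine (congrArg _ (map_env_smul ((BalTensor.lcontract (X.cx.X m) f ∘ₗ
            Γ.comp i m n h).toAddMonoidHom) (fun a b x => ?_) e x)).trans ?_
          · change BalTensor.lcontract _ f (Γ.comp i m n h _) = _
            rw [Γ.equivariant, BalTensor.lcontract_act]
            rfl
          · rw [RingHom.id_apply, smul_comm]
            rfl }, ?_, ?_⟩
    · rintro m n m' n' h h' hm x
      have h0 : f ∘ₗ X.d (i + 1) i = 0 := LinearMap.ext (mem_cocycles.1 hf)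
      change ((i * m').negOnePow : ℤ) • BalTensor.lcontract _ f (Γ.comp i m' n' h' (X.d n n' x)) =
        X.d m m' (((i * m).negOnePow : ℤ) • BalTensor.lcontract _ f (Γ.comp i m n h x))
      rw [Γ.chain_of_eq (i' := i + 1) rfl hm (by omega), map_add, BalTensor.lcontract_rTensor, h0,
        BalTensor.lcontract_zero, zero_add, map_zsmul, BalTensor.lcontract_lTensor,
        negOnePow_smul_smul (m := i * m) (by subst hm; ring), map_zsmul]
    · intro j n h g x
      change ((i * j).negOnePow : ℤ) • BalTensor.mul f g (Γ.comp i j n h x) =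
        g (((i * j).negOnePow : ℤ) • BalTensor.lcontract _ f (Γ.comp i j n h x))
      rw [BalTensor.mul_eq_lcontract, map_zsmul]
  right := by
    refine ⟨fun m =>
      { toFun := fun x => BalTensor.rcontract (X.cx.X m) X.aug (Γ.comp m 0 m (add_zero m) x)
        map_add' := fun x y => by simp only [map_add]
        map_smul' := fun e x => by
          refine map_env_smul ((BalTensor.rcontract (X.cx.X m) X.aug ∘ₗ
            Γ.comp m 0 m (add_zero m)).toAddMonoidHom) (fun a b x => ?_) e x
          change BalTensor.rcontract _ X.aug (Γ.comp m 0 m _ _) = _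
          rw [Γ.equivariant, BalTensor.rcontract_act]
          rfl }, ?_, ?_, ?_⟩
    · rintro m n hm x
      have h0 : X.aug ∘ₗ X.d (0 + 1) 0 = 0 :=
        LinearMap.ext (mem_cocycles.1 HomCohomology.aug_mem_cocycles)
      change BalTensor.rcontract _ X.aug (Γ.comp n 0 n _ (X.d m n x)) =
        X.d m n (BalTensor.rcontract _ X.aug (Γ.comp m 0 m _ x))
      rw [Γ.chain_of_eq (i' := m) (j' := 0 + 1) hm rfl hm, map_add, map_zsmul,
        BalTensor.rcontract_lTensor, h0, BalTensor.rcontract_zero, smul_zero, add_zero,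
        BalTensor.rcontract_rTensor]
    · intro x
      exact (BalTensor.mul_eq_rcontract _ _ _).symm.trans (Γ.augmentation x)
    · intro i h f x
      exact BalTensor.mul_eq_rcontract _ _ _

end Contraction

section Theta

variable {k : Type u} {A : Type v} [Field k] [Ring A] [HopfAlgebra k A]

/-! ### The adjoint module -/

/-- Linear maps to the adjoint module are the maps to the regular bimodule that are linear
over `σ`. -/
noncomputable def Adjoint.toSemilinear {V : Type*} [AddCommGroup V] [Module A V] (γ : V →ₗ[A] Adjoint k A) :
    V →ₛₗ[(sigma k A).toRingHom] Regular k A where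
  toFun := γ
  map_add' := map_add γ
  map_smul' a x := map_smul γ a x

/-- Maps to the regular bimodule that are linear over `σ`, as maps to the adjoint module. -/
noncomputable def Adjoint.ofSemilinear {V : Type*} [AddCommGroup V] [Module A V]
    (γ : V →ₛₗ[(sigma k A).toRingHom] Regular k A) : V →ₗ[A] Adjoint k A where
  toFun := γ
  map_add' := map_add γ
  map_smul' a x := map_smulₛₗ γ a x

variable (k A) in
/-- The counit, as a retraction of the inclusion of `k` in the adjoint module. -/
noncomputable def adjointCounit : Adjoint k A →ₗ[A] Triv k A where
  toFun m := Coalgebra.counit (R := k) (A := A) m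
  map_add' x y := map_add (Coalgebra.counit (R := k) (A := A)) x y
  map_smul' a (m : A) := by
    refine (congrArg (Coalgebra.counit (R := k) (A := A))
      (Adjoint.smul_eq_sum k A a (Coalgebra.Repr.arbitrary k a) m)).trans ?_
    have h := congrArg (Coalgebra.counit (R := k))
      (Coalgebra.sum_counit_smul (Coalgebra.Repr.arbitrary k a))
    rw [map_sum] at h
    change Coalgebra.counit (R := k) (∑ i ∈ (Coalgebra.Repr.arbitrary k a).index,
        (Coalgebra.Repr.arbitrary k a).left i * m *
          HopfAlgebra.antipode k ((Coalgebra.Repr.arbitrary k a).right i)) =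
      Coalgebra.counit (R := k) a * Coalgebra.counit (R := k) m
    rw [← h, Finset.sum_mul, map_sum]
    refine Finset.sum_congr rfl fun i _ => ?_
    -- Since ε is multiplicative with values in a commutative field and ε S = ε, the adjoint action
    -- is sent to multiplication by the counit.
    rw [Bialgebra.counit_mul, Bialgebra.counit_mul, HopfAlgebra.counit_antipode, map_smul,
      smul_eq_mul, mul_right_comm]

theorem adjointCounit_unitHom (r : Triv k A) : adjointCounit k A (unitHom k A r) = r :=
  Bialgebra.counit_algebraMap (A := A) (show k from r)

/-! ### Multiplicativity of the comparison -/

variable {P : CompleteResolution A (Triv k A)} {X : BimoduleResolution k A}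

theorem Comparison.chain_d (ι : Comparison P X) (i j : ℤ) (x : P.cx.X i) :
    ι.map j (P.d i j x) = X.d i j (ι.map i x) := ι.chain i j x

/-- Left multiplication by compatible classes commutes with the comparison map. -/
theorem Comparison.comp_chainMap (ι : Comparison P X)
    (hσ : HomAcyclic (sigma k A).toRingHom P.d (Env k A))
    (Γ : DiagonalApprox P) (Γ' : BimoduleDiagonalApprox X) {i j n l : ℤ} (h : i + j = n)
    (hl : n = l + 1)
    {f : P.cx.X i →ₗ[A] Triv k A} (hf : f ∈ cocycles P.cx _ i)
    {φ : X.cx.X i →ₗ[Env k A] Regular k A} (hφ : φ ∈ cocycles X.cx _ i)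
    {γ : P.cx.X (i - 1) →ₗ[A] Adjoint k A}
    (hγ : ∀ x, ι.cochainMap i φ x - unitHom k A (f x) = γ (P.d i (i - 1) x))
    {ψ : X.cx.X j →ₗ[Env k A] Regular k A} (hψ : ψ ∈ cocycles X.cx _ j) :
    ∃ D : ∀ m n, i + m = n → (P.cx.X n →ₗ[A] P.cx.X m),
      (∀ m n m' n' (h : i + m = n) (h' : i + m' = n'), m = m' + 1 → ∀ x,
        D m' n' h' (P.d n n' x) = P.d m m' (D m n h x)) ∧
      (∀ j n h (g : P.cx.X j →ₗ[A] Triv k A) x,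
        (((i * j).negOnePow : ℤ) • Γ.pair i j n h f g) x = g (D j n h x)) ∧
      ∃ t : P.cx.X l →ₗ[A] Adjoint k A, ∀ x,
        ι.cochainMap n (((i * j).negOnePow : ℤ) • Γ'.pair i j n h φ ψ) x -
          ι.cochainMap j ψ (D j n h x) = t (P.d n l x) := by
  subst h
  obtain rfl : l = i + (j - 1) := by omega
  obtain ⟨D, hD, hDΦ⟩ := Γ.isRepresentable.left i f hf
  obtain ⟨D', hD', hDΦ'⟩ := Γ'.isRepresentable.left i φ hφ
  obtain ⟨g, hg⟩ := HomCohomology.aug_comp Γ.isRepresentable hf hDΦ (l := i + -1) (by omega)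
  obtain ⟨g', hg'⟩ := HomCohomology.aug_comp Γ'.isRepresentable hφ hDΦ' (l := i + -1) (by omega)
  have hγ' : ∃ γ' : P.cx.X (i + -1) →ₗ[A] Adjoint k A,
      ∀ x, ι.cochainMap i φ x - unitHom k A (f x) = γ' (P.d i (i + -1) x) := ⟨γ, hγ⟩
  obtain ⟨γ', hγ'⟩ := hγ'
  refine ⟨D, hD, hDΦ, ?_⟩
  -- The two composites of ι with `D` and `D'` are σ-linear chain maps from the shifted `P` to `X`.
  -- Their augmentations are the unit applied to `f` and `φ ι`, each up to a coboundary, and these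
  -- differ by the coboundary of γ by hypothesis.
  obtain ⟨t, ht⟩ := X.isAugmented.comp_sub_coboundary (σ := (sigma k A).toRingHom)
    (P.isExactComplex_shift i) (fun _ => P.projective _)
    (fun m => P.homAcyclic_shift
      (have := X.finite m; have := X.projective m; hσ.of_finite_projective _) i)
    (fun m => (D' m (i + m) rfl).comp (ι.map (i + m)))
    (fun m => (ι.map m).comp (D m (i + m) rfl))
    (fun m n hm x => by
      rw [LinearMap.comp_apply, LinearMap.comp_apply, ι.chain_d, hD' m _ n _ rfl rfl hm])
    (fun m n hm x => by
      rw [LinearMap.comp_apply, LinearMap.comp_apply, hD m _ n _ rfl rfl hm, ι.chain_d])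
    (Adjoint.toSemilinear (γ' + ι.cochainMap (i + -1) g' - unitHom k A ∘ₗ g)) (fun x => by
      have key : ∀ i' (hi' : i + 0 = i') (y : P.cx.X i'),
          X.aug (D' 0 i' hi' (ι.map i' y)) - X.aug (ι.map 0 (D 0 i' hi' y)) =
          (γ' + ι.cochainMap (i + -1) g' - unitHom k A ∘ₗ g) (P.d i' (i + -1) y) := by
        intro i' hi' y
        obtain rfl : i = i' := by omega
        have e1 : X.aug (D' 0 i hi' (ι.map i y)) = φ (ι.map i y) + g' (X.d i (i + -1) (ι.map i y)) := by
          rw [← hg']; abel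
        have e2 : P.aug (D 0 i hi' y) = f y + g (P.d i (i + -1) y) := by
          rw [← hg]; abel
        rw [ι.augmentation, e1, e2, map_add, LinearMap.sub_apply, LinearMap.add_apply, ← hγ',
          ← ι.chain_d]
        have aux (p q r s : A) : p + q - (r + s) = p - r + q - s := by abel
        exact aux _ _ _ _
      exact key (i + 0) rfl x)
    (m := j) (l := j - 1) (by omega) rfl ψ (mem_cocycles.1 hψ)
  refine ⟨Adjoint.ofSemilinear t, fun x => Eq.trans ?_ (ht x)⟩
  change (((i * j).negOnePow : ℤ) • Γ'.pair i j _ rfl φ ψ) (ι.map _ x) - _ = _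
  rw [hDΦ']
  rfl

theorem Comparison.cochainMap_mem_cocycles (ι : Comparison P X) {n : ℤ}
    {φ : X.cx.X n →ₗ[Env k A] Regular k A} (hφ : φ ∈ cocycles X.cx _ n) :
    ι.cochainMap n φ ∈ cocycles P.cx _ n :=
  mem_cocycles.2 fun x => (congrArg φ (ι.chain (n + 1) n x)).trans (mem_cocycles.1 hφ _)

theorem comp_mem_cocycles {R : Type v} [Ring R] {Q : ChainComplex (ModuleCat.{v} R) ℤ}
    {M M' : Type*} [AddCommGroup M] [Module R M] [AddCommGroup M'] [Module R M'] (q : M →ₗ[R] M')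
    {n : ℤ} {f : Q.X n →ₗ[R] M} (hf : f ∈ cocycles Q M n) : q ∘ₗ f ∈ cocycles Q M' n :=
  mem_cocycles.2 fun x => by simp [mem_cocycles.1 hf x]

theorem Comparison.toAdjoint_mk (ι : Comparison P X) {n : ℤ}
    {φ : X.cx.X n →ₗ[Env k A] Regular k A} (hφ : φ ∈ cocycles X.cx _ n) :
    ι.toAdjoint n (HomCohomology.mk φ hφ) =
      HomCohomology.mk (ι.cochainMap n φ) (ι.cochainMap_mem_cocycles hφ) := rfl

theorem CompleteResolution.Ext.coeffMap_mk {M M' : Type*} [AddCommGroup M] [Module A M]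
    [AddCommGroup M'] [Module A M'] (q : M →ₗ[A] M')
    {n : ℤ} {f : P.cx.X n →ₗ[A] M} (hf : f ∈ cocycles P.cx M n) :
    CompleteResolution.Ext.coeffMap P q n (HomCohomology.mk f hf) =
      HomCohomology.mk (q ∘ₗ f) (comp_mem_cocycles q hf) := rfl

/-- Named proofs of the Leibniz rules allow the general results on `HomCohomology.cup` to be
applied; proof irrelevance then identifies those products with the given ones definitionally. -/
theorem DiagonalApprox.pair_leibniz (Γ : DiagonalApprox P) (i j n i' j' n' : ℤ) (h : i + j = n)
    (hi : i + 1 = i') (hj : j + 1 = j') (hn : n + 1 = n') (f : P.cx.X i →ₗ[A] Triv k A)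
    (g : P.cx.X j →ₗ[A] Triv k A) : precomp P.cx _ n' n (Γ.pair i j n h f g) =
      Γ.pair i' j n' (by omega) (precomp P.cx _ i' i f) g +
        (i.negOnePow : ℤ) • Γ.pair i j' n' (by omega) f (precomp P.cx _ j' j g) := by
  subst h hi hj hn
  ext x
  change Triv.pairing f g (Γ.comp i j _ rfl (P.d (i + j + 1) (i + j) x)) =
    Triv.pairing (f ∘ₗ P.d (i + 1) i) g _ +
      (i.negOnePow : ℤ) • Triv.pairing f (g ∘ₗ P.d (j + 1) j) _
  rw [Γ.chain_of_eq rfl rfl rfl, map_add, map_zsmul, Triv.pairing_eq_rcontract f g,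
    Triv.rcontract_rTensor, Triv.pairing_eq_lcontract f g, Triv.lcontract_lTensor,
    Triv.pairing_eq_rcontract, Triv.pairing_eq_lcontract]
  rfl

theorem BimoduleDiagonalApprox.pair_leibniz (Γ : BimoduleDiagonalApprox X)
    (i j n i' j' n' : ℤ) (h : i + j = n)
    (hi : i + 1 = i') (hj : j + 1 = j') (hn : n + 1 = n') (f : X.cx.X i →ₗ[Env k A] Regular k A)
    (g : X.cx.X j →ₗ[Env k A] Regular k A) : precomp X.cx _ n' n (Γ.pair i j n h f g) =
      Γ.pair i' j n' (by omega) (precomp X.cx _ i' i f) g +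
        (i.negOnePow : ℤ) • Γ.pair i j' n' (by omega) f (precomp X.cx _ j' j g) := by
  subst h hi hj hn
  ext x
  change BalTensor.mul f g (Γ.comp i j _ rfl (X.d (i + j + 1) (i + j) x)) =
    BalTensor.mul (f ∘ₗ X.d (i + 1) i) g _ +
      (i.negOnePow : ℤ) • BalTensor.mul f (g ∘ₗ X.d (j + 1) j) _
  rw [Γ.chain_of_eq rfl rfl rfl, map_add, map_zsmul, BalTensor.mul_eq_rcontract f g,
    BalTensor.rcontract_rTensor, BalTensor.mul_eq_lcontract f g, BalTensor.lcontract_lTensor,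
    BalTensor.mul_eq_rcontract, BalTensor.mul_eq_lcontract]
  rfl

theorem Tate.cup_eq (Γ : DiagonalApprox P) (i j : ℤ) :
    Tate.cup Γ i j = HomCohomology.cup Γ.pair Γ.pair_leibniz i j := rfl

theorem TateHochschild.cup_eq (Γ : BimoduleDiagonalApprox X) (i j : ℤ) :
    TateHochschild.cup Γ i j = HomCohomology.cup Γ.pair Γ.pair_leibniz i j := rfl

set_option maxHeartbeats 1000000 in
/-- Left multiplication by compatible classes commutes with the comparison map and with a map of
coefficients to a module over which the pairing with the second class is known. -/
theorem Comparison.map_cup (ι : Comparison P X)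
    (hσ : HomAcyclic (sigma k A).toRingHom P.d (Env k A))
    (Γ : DiagonalApprox P) (Γ' : BimoduleDiagonalApprox X) {i j : ℤ}
    (x : Tate P (Triv k A) i) (z : TateHochschild X i)
    (hz : ι.toAdjoint i z = CompleteResolution.Ext.coeffMap P (unitHom k A) i x)
    (y : TateHochschild X j) :
    (∀ x' : Tate P (Triv k A) j,
      ι.toAdjoint j y = CompleteResolution.Ext.coeffMap P (unitHom k A) j x' →
      ι.toAdjoint (i + j) (TateHochschild.cup Γ' i j z y) =
        CompleteResolution.Ext.coeffMap P (unitHom k A) (i + j) (Tate.cup Γ i j x x')) ∧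
    CompleteResolution.Ext.coeffMap P (adjointCounit k A) (i + j)
        (ι.toAdjoint (i + j) (TateHochschild.cup Γ' i j z y)) =
      Tate.cup Γ i j x
        (CompleteResolution.Ext.coeffMap P (adjointCounit k A) j (ι.toAdjoint j y)) := by
  obtain ⟨f, hf, rfl⟩ := HomCohomology.exists_mk x
  obtain ⟨φ, hφ, rfl⟩ := HomCohomology.exists_mk z
  obtain ⟨ψ, hψ, rfl⟩ := HomCohomology.exists_mk y
  rw [ι.toAdjoint_mk, CompleteResolution.Ext.coeffMap_mk,
    HomCohomology.mk_eq_mk (l := i - 1) (by omega)] at hz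
  obtain ⟨γ, hγ⟩ := hz
  obtain ⟨D, hD, hDΦ, t, ht⟩ := ι.comp_chainMap hσ Γ Γ' (i := i) (j := j) (n := i + j)
    (l := i + j - 1) rfl (by omega) hf hφ hγ hψ
  rw [TateHochschild.cup_eq, HomCohomology.cup_mk_eq _ hφ hψ, ι.toAdjoint_mk,
    ι.toAdjoint_mk]
  constructor
  · intro x' hx'
    obtain ⟨g, hg, rfl⟩ := HomCohomology.exists_mk x'
    rw [CompleteResolution.Ext.coeffMap_mk,
      HomCohomology.mk_eq_mk (l := j - 1) (by omega)] at hx'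
    obtain ⟨s, hs⟩ := hx'
    rw [Tate.cup_eq, HomCohomology.cup_mk_eq _ hf hg, CompleteResolution.Ext.coeffMap_mk,
      HomCohomology.mk_eq_mk (l := i + j - 1) (by omega)]
    -- Modulo the coboundary of `t`, the product is `ψ ι D`. Replacing `ψ ι` by the unit applied to
    -- `g` adds `s d D`, which is the coboundary of `s D` because `D` is a chain map.
    refine ⟨t + s ∘ₗ D (j - 1) (i + j - 1) (by omega), fun x => ?_⟩
    rw [LinearMap.add_apply, LinearMap.comp_apply, LinearMap.comp_apply, hDΦ]
    have e := hs (D j (i + j) rfl x)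
    rw [LinearMap.comp_apply] at e
    have e' := hD j (i + j) (j - 1) (i + j - 1) rfl (by omega) (by omega) x
    rw [CompleteResolution.d, CompleteResolution.d] at e'
    rw [e', ← e, ← CompleteResolution.d, ← ht, sub_add_sub_cancel]
  · rw [CompleteResolution.Ext.coeffMap_mk, CompleteResolution.Ext.coeffMap_mk]
    rw [Tate.cup_eq, HomCohomology.cup_mk_eq _ hf
      (comp_mem_cocycles (adjointCounit k A) (ι.cochainMap_mem_cocycles hψ)), HomCohomology.mk_eq_mk (l := i + j - 1) (by omega)]
    refine ⟨adjointCounit k A ∘ₗ t, fun x => ?_⟩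
    rw [hDΦ, LinearMap.comp_apply, LinearMap.comp_apply, LinearMap.comp_apply,
      ← CompleteResolution.d, ← ht, map_sub]

theorem coeffMap_adjointCounit_unitHom {n : ℤ} (x : Tate P (Triv k A) n) :
    CompleteResolution.Ext.coeffMap P (adjointCounit k A) n
      (CompleteResolution.Ext.coeffMap P (unitHom k A) n x) = x := by
  obtain ⟨f, hf, rfl⟩ := HomCohomology.exists_mk x
  refine (HomCohomology.mk_eq_mk (l := n - 1) (by omega) _ _).2 ⟨0, fun x => ?_⟩
  exact sub_eq_zero.2 (adjointCounit_unitHom (f x))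

/-! ### The graded rings -/

/-- The identity for `κ` on products says that it is linear over `R`, so its kernel is a submodule
complementary to the image of θ; it need not be a ring homomorphism. -/
theorem isCompl_of_retraction {R S : Type*} [Ring R] [Ring S] (θ : R →+* S) (κ : S →+ R)
    (hκ : ∀ r, κ (θ r) = r) (hmul : ∀ r s, κ (θ r * s) = r * κ s) :
    let _ : Module R S := Module.compHom S θ
    ∃ N : Submodule R S, (∀ s, s ∈ N ↔ κ s = 0) ∧
      IsCompl (LinearMap.range (linearOfRingHom θ)) N := by
  let _ : Module R S := Module.compHom S θ
  let N : Submodule R S :=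
    { carrier := {s | κ s = 0}
      add_mem' := fun {a b} ha hb => by
        change κ _ = 0 at *
        rw [map_add, ha, hb, add_zero]
      zero_mem' := map_zero κ
      smul_mem' := fun r s hs => by
        change κ _ = 0 at *
        exact (hmul r s).trans (by rw [hs, mul_zero]) }
  refine ⟨N, fun s => Iff.rfl, ?_, ?_⟩
  · rw [Submodule.disjoint_def]
    rintro _ ⟨r, rfl⟩ hr
    have hr : κ (θ r) = 0 := hr
    rw [hκ] at hr
    rw [hr, map_zero]
  · rw [codisjoint_iff, eq_top_iff]
    rintro s -
    refine Submodule.mem_sup.2 ⟨θ (κ s), ⟨κ s, rfl⟩, s - θ (κ s), ?_, add_sub_cancel _ _⟩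
    change κ (s - θ (κ s)) = 0
    rw [map_sub, hκ, sub_self]

/-- All verifications reduce to homogeneous elements. The complement is the kernel of the degreewise
map given by `c`, hence graded. -/
theorem exists_ringHom_of_graded {T H : ℤ → Type*} [∀ n, AddCommGroup (T n)]
    [∀ n, AddCommGroup (H n)] [DirectSum.GRing T] [DirectSum.GRing H] (t : ∀ n, T n →+ H n)
    (c : ∀ n, H n →+ T n) (hct : ∀ n x, c n (t n x) = x)
    (hone : t 0 GradedMonoid.GOne.one = GradedMonoid.GOne.one)
    (hmul : ∀ {i j} (x : T i) (y : T j),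
      t (i + j) (GradedMonoid.GMul.mul x y) = GradedMonoid.GMul.mul (t i x) (t j y))
    (hc : ∀ {i j} (x : T i) (y : H j),
      c (i + j) (GradedMonoid.GMul.mul (t i x) y) = GradedMonoid.GMul.mul x (c j y)) :
    ∃ θ : (⨁ n, T n) →+* ⨁ n, H n,
      (∀ n (x : T n), θ (DirectSum.of _ n x) = DirectSum.of _ n (t n x)) ∧
      Function.Injective θ ∧
      letI : Module (⨁ n, T n) (⨁ n, H n) := Module.compHom _ θ
      ∃ N : Submodule (⨁ n, T n) (⨁ n, H n), (∀ y ∈ N, ∀ n, DirectSum.of H n (y n) ∈ N) ∧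
        IsCompl (LinearMap.range (linearOfRingHom θ)) N := by
  let θ : (⨁ n, T n) →+* ⨁ n, H n :=
    DirectSum.toSemiring (fun n => (DirectSum.of H n).comp (t n))
      (congrArg (DirectSum.of H 0) hone)
      (fun {i j} x y => (congrArg (DirectSum.of H (i + j)) (hmul x y)).trans
        (DirectSum.of_mul_of _ _).symm)
  have hθ : ∀ n x, θ (DirectSum.of _ n x) = DirectSum.of _ n (t n x) := fun n x =>
    DirectSum.toSemiring_of _ _ _ n x
  let κ : (⨁ n, H n) →+ ⨁ n, T n := DirectSum.map c
  have hκθ : ∀ r, κ (θ r) = r := by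
    intro r
    induction r using DirectSum.induction_on with
    | zero => simp
    | add r s hr hs => rw [map_add, map_add, hr, hs]
    | of n x => rw [hθ, DirectSum.map_of, hct]
  have hκmul : ∀ r s, κ (θ r * s) = r * κ s := by
    intro r s
    induction r using DirectSum.induction_on with
    | zero => simp
    | add r r' hr hr' => rw [map_add, add_mul, map_add, hr, hr', add_mul]
    | of i x =>
      induction s using DirectSum.induction_on with
      | zero => simp
      | add s s' hs hs' => rw [mul_add, map_add, hs, hs', map_add, mul_add]
      | of j y =>
        rw [hθ, DirectSum.of_mul_of, DirectSum.map_of, DirectSum.map_of, DirectSum.of_mul_of, hc]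
  refine ⟨θ, hθ, Function.LeftInverse.injective hκθ, ?_⟩
  obtain ⟨N, hN, hN'⟩ := isCompl_of_retraction θ κ hκθ hκmul
  refine ⟨N, fun y hy n => ?_, hN'⟩
  rw [hN] at hy ⊢
  rw [DirectSum.map_of, ← DirectSum.map_apply c n y]
  change DirectSum.of _ n ((κ y) n) = 0
  rw [hy, DirectSum.zero_apply, map_zero]

set_option maxHeartbeats 1000000 in
-- In each degree θ is the unit on coefficients followed by the inverse of ρ, and its retraction is
-- ρ followed by the counit on coefficients. Injectivity of ρ turns identities in the adjoint
-- cohomology into identities in Tate-Hochschild cohomology.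
theorem exists_gRing_theta (ι : Comparison P X)
    (hσ : HomAcyclic (sigma k A).toRingHom P.d (Env k A))
    (Γ : DiagonalApprox P) (Γ' : BimoduleDiagonalApprox X)
    (hρ : ∀ n, Function.Bijective (ι.toAdjoint n)) :
    ∃ (T : DirectSum.GRing (Tate P (Triv k A))) (H : DirectSum.GRing (TateHochschild X)),
      (∀ i j (x : Tate P (Triv k A) i) (y : Tate P (Triv k A) j),
        T.mul x y = Tate.cup Γ i j x y) ∧
      (∀ i j (x : TateHochschild X i) (y : TateHochschild X j),
        H.mul x y = TateHochschild.cup Γ' i j x y) ∧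
      ∃ θ : (⨁ n, Tate P (Triv k A) n) →+* ⨁ n, TateHochschild X n,
        (∀ n (x : Tate P (Triv k A) n), ∃ y : TateHochschild X n,
          θ (DirectSum.of _ n x) = DirectSum.of _ n y ∧
            ι.toAdjoint n y = CompleteResolution.Ext.coeffMap P (unitHom k A) n x) ∧
        Function.Injective θ ∧
        letI : Module (⨁ n, Tate P (Triv k A) n) (⨁ n, TateHochschild X n) :=
          Module.compHom _ θ
        ∃ N : Submodule (⨁ n, Tate P (Triv k A) n) (⨁ n, TateHochschild X n),
          (∀ y ∈ N, ∀ n, DirectSum.of (TateHochschild X) n (y n) ∈ N) ∧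
          IsCompl (LinearMap.range (linearOfRingHom θ)) N := by
  let _ : DirectSum.GRing (Tate P (Triv k A)) := CompleteResolution.gRing Γ.pair_leibniz Γ.isRepresentable
  let _ : DirectSum.GRing (TateHochschild X) := CompleteResolution.gRing Γ'.pair_leibniz Γ'.isRepresentable
  let t : ∀ n, Tate P (Triv k A) n →+ TateHochschild X n := fun n =>
    (AddEquiv.ofBijective (ι.toAdjoint n) (hρ n)).symm.toAddMonoidHom.comp
      (CompleteResolution.Ext.coeffMap P (unitHom k A) n)
  have ht : ∀ n x, ι.toAdjoint n (t n x) =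
      CompleteResolution.Ext.coeffMap P (unitHom k A) n x := fun n x =>
    (AddEquiv.ofBijective (ι.toAdjoint n) (hρ n)).apply_symm_apply _
  obtain ⟨θ, hθ, hinj, hN⟩ := exists_ringHom_of_graded t
    (fun n => (CompleteResolution.Ext.coeffMap P (adjointCounit k A) n).comp (ι.toAdjoint n))
    (fun n x => (congrArg _ (ht n x)).trans (coeffMap_adjointCounit_unitHom x))
    (by
      -- The two units are the augmentation classes, and ι is compatible with the augmentations on
      -- the nose, so the zero cochain bounds the difference.
      refine (hρ 0).1 ((ht 0 _).trans ?_)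
      refine (HomCohomology.mk_eq_mk (l := -1) (by omega) _ _).2 ⟨0, fun x => ?_⟩
      exact sub_eq_zero.2 (ι.augmentation x).symm)
    (fun {i j} x y => (hρ (i + j)).1 ((ht _ _).trans
      ((ι.map_cup hσ Γ Γ' x (t i x) (ht i x) (t j y)).1 y (ht j y)).symm))
    (fun {i j} x y => (ι.map_cup hσ Γ Γ' x (t i x) (ht i x) y).2)
  exact ⟨_, _, fun _ _ _ _ => rfl, fun _ _ _ _ => rfl, θ,
    fun n x => ⟨t n x, hθ n x, ht n x⟩, hinj, hN⟩

end Theta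

section Hopf

variable {k : Type u} {A : Type v} [Field k] [Ring A] [HopfAlgebra k A]

open Coalgebra HopfAlgebra

/-! ### Hopf algebra identities -/

/-- In Sweedler notation the left side is a₁ ⊗ S(a₂) a₃. Coassociativity regroups it, the antipode
axiom collapses the last two factors to a counit, and the counit axiom finishes. The companion
identity uses a₂ S(a₃). -/
theorem sum_antipode_mul_right (a : A) :
    ∑ i ∈ (ℛ k a).index, ∑ j ∈ (ℛ k ((ℛ k a).left i)).index,
      (ℛ k ((ℛ k a).left i)).left j ⊗ₜ[k]
        (antipode k ((ℛ k ((ℛ k a).left i)).right j) * (ℛ k a).right i) = a ⊗ₜ[k] (1 : A) := by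
  have h := congrArg (LinearMap.lTensor A (TensorProduct.lift
    ((LinearMap.mul k A) ∘ₗ antipode k)))
    (sum_tmul_tmul_eq (ℛ k a) (fun i => ℛ k ((ℛ k a).left i)) fun i => ℛ k ((ℛ k a).right i))
  simp only [map_sum, LinearMap.lTensor_tmul, TensorProduct.lift.tmul, LinearMap.comp_apply,
    LinearMap.mul_apply'] at h
  rw [h]
  simp only [← TensorProduct.tmul_sum, sum_antipode_mul_eq_smul, tmul_smul]
  have h' := congrArg (LinearMap.lTensor A (LinearMap.toSpanSingleton k A 1))
    (sum_tmul_counit_eq (ℛ k a))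
  simpa only [map_sum, LinearMap.lTensor_tmul, LinearMap.toSpanSingleton_apply, tmul_smul,
    one_smul] using h'

theorem sum_mul_antipode_right (a : A) :
    ∑ i ∈ (ℛ k a).index, ∑ j ∈ (ℛ k ((ℛ k a).left i)).index,
      (ℛ k ((ℛ k a).left i)).left j ⊗ₜ[k]
        ((ℛ k ((ℛ k a).left i)).right j * antipode k ((ℛ k a).right i)) = a ⊗ₜ[k] (1 : A) := by
  have h := congrArg (LinearMap.lTensor A (TensorProduct.lift
    ((LinearMap.mul k A).compl₂ (antipode k))))
    (sum_tmul_tmul_eq (ℛ k a) (fun i => ℛ k ((ℛ k a).left i)) fun i => ℛ k ((ℛ k a).right i))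
  simp only [map_sum, LinearMap.lTensor_tmul, TensorProduct.lift.tmul, LinearMap.compl₂_apply,
    LinearMap.mul_apply'] at h
  rw [h]
  simp only [← TensorProduct.tmul_sum, sum_mul_antipode_eq_smul, tmul_smul]
  have h' := congrArg (LinearMap.lTensor A (LinearMap.toSpanSingleton k A 1))
    (sum_tmul_counit_eq (ℛ k a))
  simpa only [map_sum, LinearMap.lTensor_tmul, LinearMap.toSpanSingleton_apply, tmul_smul,
    one_smul] using h'

section Diagonal

variable (k A) (N : Type*) [AddCommGroup N] [Module k N] [Module A N] [IsScalarTower k A N]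

/-- The map `A ⊗ N → A ⊗ N`, `a ⊗ n ↦ ∑ a₁ ⊗ a₂ n`, from the left action of `A` on the first factor
to the diagonal action. -/
noncomputable def diagMap : A ⊗[k] N →ₗ[k] A ⊗[k] N :=
  TensorProduct.lift
    (LinearMap.lcomp k _ (TensorProduct.mk k A N 1) ∘ₗ (diagAct A N).toLinearMap)

theorem diagMap_tmul (a : A) (n : N) : diagMap k A N (a ⊗ₜ n) = diagAct A N a (1 ⊗ₜ n) := rfl

/-- The inverse `a ⊗ n ↦ ∑ a₁ ⊗ S(a₂) n` of `diagMap`. -/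
noncomputable def diagInv : A ⊗[k] N →ₗ[k] A ⊗[k] N :=
  LinearMap.lTensor A (TensorProduct.lift (Algebra.lsmul k k N).toLinearMap) ∘ₗ
    (TensorProduct.assoc k A A N).toLinearMap ∘ₗ
      LinearMap.rTensor N (LinearMap.lTensor A (antipode k) ∘ₗ comul)

theorem diagInv_tmul (a : A) (n : N) : diagInv k A N (a ⊗ₜ n) =
    ∑ i ∈ (ℛ k a).index, (ℛ k a).left i ⊗ₜ (antipode k ((ℛ k a).right i) • n) := by
  rw [diagInv, LinearMap.comp_apply, LinearMap.comp_apply, LinearMap.rTensor_tmul,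
    LinearMap.comp_apply, ← (ℛ k a).eq]
  simp [TensorProduct.sum_tmul]

theorem diagMap_tmul_eq (a : A) (n : N) : diagMap k A N (a ⊗ₜ n) =
    ∑ i ∈ (ℛ k a).index, (ℛ k a).left i ⊗ₜ ((ℛ k a).right i • n) := by
  rw [diagMap_tmul, diagAct_tmul a (ℛ k a)]
  simp

theorem diagMap_diagInv (t : A ⊗[k] N) : diagMap k A N (diagInv k A N t) = t := by
  induction t using TensorProduct.induction_on with
  | zero => simp
  | add s t hs ht => rw [map_add, map_add, hs, ht]
  | tmul a n =>
    have h := congrArg (LinearMap.lTensor A ((LinearMap.toSpanSingleton A N n).restrictScalars k))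
      (sum_mul_antipode_right (k := k) a)
    rw [diagInv_tmul, map_sum]
    simp only [diagMap_tmul_eq, smul_smul]
    simpa [map_sum] using h

theorem diagInv_diagMap (t : A ⊗[k] N) : diagInv k A N (diagMap k A N t) = t := by
  induction t using TensorProduct.induction_on with
  | zero => simp
  | add s t hs ht => rw [map_add, map_add, hs, ht]
  | tmul a n =>
    have h := congrArg (LinearMap.lTensor A ((LinearMap.toSpanSingleton A N n).restrictScalars k))
      (sum_antipode_mul_right (k := k) a)
    rw [diagMap_tmul_eq, map_sum]
    simp only [diagInv_tmul, smul_smul]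
    simpa [map_sum] using h

theorem diagMap_bijective : Function.Bijective (diagMap k A N) :=
  ⟨Function.LeftInverse.injective (diagInv_diagMap k A N),
    Function.RightInverse.surjective (diagMap_diagInv k A N)⟩

theorem diagMap_lsmul (a : A) (t : A ⊗[k] N) :
    diagMap k A N (a • t) = diagAct A N a (diagMap k A N t) := by
  induction t using TensorProduct.induction_on with
  | zero => simp
  | add s t hs ht => simp only [smul_add, map_add, hs, ht]
  | tmul b n =>
    rw [TensorProduct.smul_tmul', diagMap_tmul, diagMap_tmul, smul_eq_mul, map_mul]
    rfl

end Diagonal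

/-! ### Finitely generated projective modules -/

section FGProjective

theorem finite_projective_of_retract {R : Type*} [Ring R] {M N : Type*} [AddCommGroup M]
    [AddCommGroup N] [Module R M] [Module R N] [Module.Finite R M] [Module.Projective R M]
    {κ : Type*} [Fintype κ] (ι : κ → N →ₗ[R] M)
    (π : κ → M →ₗ[R] N) (hπ : ∀ x, ∑ c, π c (ι c x) = x) :
    Module.Finite R N ∧ Module.Projective R N := by
  classical
  have : Module.Projective R (κ → M) :=
    Module.Projective.of_equiv (DFinsupp.linearEquivFunOnFintype (R := R) (M := fun _ : κ => M))
  have h : (LinearMap.lsum R (fun _ : κ => M) ℕ π).comp (LinearMap.pi ι) = LinearMap.id :=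
    LinearMap.ext fun x => by simp [LinearMap.lsum_apply, hπ]
  exact ⟨Module.Finite.of_surjective (LinearMap.lsum R (fun _ : κ => M) ℕ π)
    (LinearMap.surjective_of_comp_eq_id _ _ h), Module.Projective.of_split _ _ h⟩

theorem finite_projective_of_bijective {R : Type*} [Ring R] {M N : Type*} [AddCommGroup M]
    [AddCommGroup N] [Module R M] [Module R N] [Module.Finite R M] [Module.Projective R M]
    (f : M →ₗ[R] N) (hf : Function.Bijective f) :
    Module.Finite R N ∧ Module.Projective R N :=
  ⟨Module.Finite.of_surjective f hf.2, Module.Projective.of_equiv (LinearEquiv.ofBijective f hf)⟩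

variable (k A) in
-- A basis of `N` over the field provides the finite dual basis, with the scalars extended to `A`.
theorem finite_projective_tensor (N : Type*) [AddCommGroup N] [Module k N] [FiniteDimensional k N] :
    Module.Finite A (A ⊗[k] N) ∧ Module.Projective A (A ⊗[k] N) := by
  let b := Module.finBasis k N
  refine finite_projective_of_retract (M := A)
    (fun s => TensorProduct.AlgebraTensorModule.lift
      (LinearMap.toSpanSingleton A (N →ₗ[k] A)
        ((LinearMap.toSpanSingleton k A 1).comp (b.coord s))))
    (fun s => LinearMap.toSpanSingleton A (A ⊗[k] N) (1 ⊗ₜ b s)) fun t => ?_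
  induction t using TensorProduct.induction_on with
  | zero => simp
  | add s t hs ht => simp only [map_add, Finset.sum_add_distrib, hs, ht]
  | tmul a n =>
    conv_rhs => rw [← b.sum_repr n, TensorProduct.tmul_sum]
    refine Finset.sum_congr rfl fun s _ => ?_
    rw [LinearMap.toSpanSingleton_apply, TensorProduct.AlgebraTensorModule.lift_tmul,
      LinearMap.toSpanSingleton_apply, LinearMap.smul_apply, LinearMap.comp_apply,
      LinearMap.toSpanSingleton_apply, TensorProduct.smul_tmul', smul_eq_mul, smul_eq_mul, mul_one,
      mul_smul_comm, mul_one, TensorProduct.smul_tmul, b.coord_apply]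

end FGProjective

/-! ### The diagonal tensor product -/

section DiagTensor

variable (k A) (M N : Type*) [AddCommGroup M] [AddCommGroup N] [Module k M] [Module k N]
    [Module A M] [Module A N] [IsScalarTower k A M] [IsScalarTower k A N]

/-- The tensor product of two `A`-modules, with the diagonal action. -/
def DiagTensor (k : Type*) (_A : Type*) (M N : Type*) [Field k] [AddCommGroup M] [AddCommGroup N]
    [Module k M] [Module k N] : Type _ := M ⊗[k] N

noncomputable instance : AddCommGroup (DiagTensor k A M N) :=
  inferInstanceAs (AddCommGroup (M ⊗[k] N))

noncomputable instance : Module k (DiagTensor k A M N) := inferInstanceAs (Module k (M ⊗[k] N))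

noncomputable instance : Module A (DiagTensor k A M N) :=
  Module.compHom (M ⊗[k] N) (diagAct (k := k) (A := A) M N).toRingHom

variable {M N}

theorem DiagTensor.smul_def (a : A) (t : DiagTensor k A M N) :
    a • t = (diagAct M N a (show M ⊗[k] N from t) : M ⊗[k] N) := rfl

variable (N) in
theorem rTensor_diagAct {M' : Type*} [AddCommGroup M'] [Module k M'] [Module A M']
    [IsScalarTower k A M'] (f : M →ₗ[A] M') (a : A) (t : M ⊗[k] N) :
    LinearMap.rTensor N (f.restrictScalars k) (diagAct M N a t) =
      diagAct M' N a (LinearMap.rTensor N (f.restrictScalars k) t) := by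
  induction t using TensorProduct.induction_on with
  | zero => simp
  | add s t hs ht => simp only [map_add, hs, ht]
  | tmul x y =>
    rw [LinearMap.rTensor_tmul, diagAct_tmul a (ℛ k a), diagAct_tmul a (ℛ k a), map_sum]
    simp

variable (M) in
theorem lTensor_diagAct {N' : Type*} [AddCommGroup N'] [Module k N'] [Module A N']
    [IsScalarTower k A N'] (f : N →ₗ[A] N') (a : A) (t : M ⊗[k] N) :
    LinearMap.lTensor M (f.restrictScalars k) (diagAct M N a t) =
      diagAct M N' a (LinearMap.lTensor M (f.restrictScalars k) t) := by
  induction t using TensorProduct.induction_on with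
  | zero => simp
  | add s t hs ht => simp only [map_add, hs, ht]
  | tmul x y =>
    rw [LinearMap.lTensor_tmul, diagAct_tmul a (ℛ k a), diagAct_tmul a (ℛ k a), map_sum]
    simp

variable {k A} in
variable (N) in
/-- `f ⊗ 1` as a map of diagonal tensor products. -/
noncomputable def DiagTensor.rTensor {M' : Type*} [AddCommGroup M'] [Module k M'] [Module A M']
    [IsScalarTower k A M'] (f : M →ₗ[A] M') : DiagTensor k A M N →ₗ[A] DiagTensor k A M' N where
  toFun := LinearMap.rTensor N (f.restrictScalars k)
  map_add' := map_add _
  map_smul' := rTensor_diagAct k A N f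

variable {k A} in
variable (M) in
/-- `1 ⊗ f` as a map of diagonal tensor products. -/
noncomputable def DiagTensor.lTensor {N' : Type*} [AddCommGroup N'] [Module k N'] [Module A N']
    [IsScalarTower k A N'] (f : N →ₗ[A] N') : DiagTensor k A M N →ₗ[A] DiagTensor k A M N' where
  toFun := LinearMap.lTensor M (f.restrictScalars k)
  map_add' := map_add _
  map_smul' := lTensor_diagAct k A M f

/-- For `M = A` the map `diagMap` untwists the diagonal action into the action on the first factor
alone. A dual basis of `M`, tensored with `N`, reduces the general case to this one. -/
theorem DiagTensor.finite_projective [FiniteDimensional k N] [Module.Finite A M]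
    [Module.Projective A M] :
    Module.Finite A (DiagTensor k A M N) ∧ Module.Projective A (DiagTensor k A M N) := by
  have h1 := finite_projective_tensor k A N
  have := h1.1
  have := h1.2
  let α : A ⊗[k] N →ₗ[A] DiagTensor k A A N :=
    { toFun := diagMap k A N
      map_add' := map_add _
      map_smul' := diagMap_lsmul k A N }
  have h2 := finite_projective_of_bijective α (diagMap_bijective k A N)
  have := h2.1
  have := h2.2
  obtain ⟨n, r, r', hr⟩ := exists_dual_basis (R := A) M
  let π : Fin n → DiagTensor k A A N →ₗ[A] DiagTensor k A M N := fun c =>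
    DiagTensor.rTensor N (LinearMap.toSpanSingleton A M (r c))
  refine finite_projective_of_retract (fun c => DiagTensor.rTensor N (r' c)) π fun t => ?_
  induction t using TensorProduct.induction_on with
  | zero => exact Finset.sum_eq_zero fun c _ => by erw [map_zero]
  | add s t hs ht =>
    refine Eq.trans ?_ (congrArg₂ (· + ·) hs ht)
    erw [← Finset.sum_add_distrib]
    refine Finset.sum_congr rfl fun c _ => ?_
    erw [map_add, map_add]
    rfl
  | tmul x y =>
    change ∑ c, (r' c x • r c) ⊗ₜ[k] y = x ⊗ₜ y
    rw [← TensorProduct.sum_tmul, hr]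

end DiagTensor

/-! ### Acyclicity of the enveloping algebra along `σ` -/

section Sigma

variable (k A)

/-- The opposite algebra, on which `a` acts as left multiplication by `S(a)`. -/
def AntipodeTwist (_k : Type*) (A : Type*) : Type _ := Aᵐᵒᵖ

instance : AddCommGroup (AntipodeTwist k A) := inferInstanceAs (AddCommGroup Aᵐᵒᵖ)

instance : Module k (AntipodeTwist k A) := inferInstanceAs (Module k Aᵐᵒᵖ)

noncomputable instance : Module A (AntipodeTwist k A) :=
  Module.compHom Aᵐᵒᵖ (antipodeAlgHomOp k A).toRingHom

instance : IsScalarTower k A (AntipodeTwist k A) where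
  smul_assoc c a x := by
    change antipodeAlgHomOp k A (c • a) * (show Aᵐᵒᵖ from x) =
      c • (antipodeAlgHomOp k A a * (show Aᵐᵒᵖ from x))
    rw [map_smul, smul_mul_assoc]

instance [FiniteDimensional k A] : FiniteDimensional k (AntipodeTwist k A) :=
  inferInstanceAs (FiniteDimensional k Aᵐᵒᵖ)

/-- Restricted along σ, the regular module of `Aᵉ` is a diagonal tensor product of `A` with a
twisted copy of `Aᵒᵖ`, so the untwisting argument covers it. -/
theorem sigma_mul_eq_diagAct (a : A) (t : Env k A) :
    sigma k A a * t = (diagAct (k := k) A (AntipodeTwist k A) a t : A ⊗[k] Aᵐᵒᵖ) := by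
  induction t using TensorProduct.induction_on with
  | zero => exact (mul_zero _).trans (map_zero (diagAct (k := k) A (AntipodeTwist k A) a)).symm
  | add s t hs ht =>
    rw [mul_add, hs, ht]
    exact (map_add (diagAct (k := k) A (AntipodeTwist k A) a) s t).symm
  | tmul x y =>
    rw [sigma_eq_sum k A a (ℛ k a), Finset.sum_mul]
    simp only [Algebra.TensorProduct.tmul_mul_tmul]
    exact (diagAct_tmul (N := AntipodeTwist k A) a (ℛ k a) x y).symm

/-- Through σ, `Aᵉ` is finitely generated projective over `A`, and acyclicity with values in `A`
passes to such modules. -/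
theorem homAcyclic_sigma [FiniteDimensional k A] {S : ℤ → Type*} [∀ i, AddCommGroup (S i)]
    [∀ i, Module A (S i)] {dS : ∀ i j, S i →ₗ[A] S j} (h : HomAcyclic (RingHom.id A) dS A) :
    HomAcyclic (sigma k A).toRingHom dS (Env k A) := by
  obtain ⟨h1, h2⟩ := DiagTensor.finite_projective k A (M := A) (N := AntipodeTwist k A)
  intro i j l hi hj g hg
  obtain ⟨f, hf⟩ := h.of_finite_projective (DiagTensor k A A (AntipodeTwist k A)) i j l hi hj
    { toFun := g
      map_add' := map_add g
      map_smul' := fun a x => (map_smulₛₗ g a x).trans (sigma_mul_eq_diagAct k A a (g x)) } hg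
  exact ⟨
    { toFun := f
      map_add' := map_add f
      map_smul' := fun a x => (map_smul f a x).trans (sigma_mul_eq_diagAct k A a (f x)).symm }, hf⟩

end Sigma
end Hopf

section Induced

variable {k : Type u} {A : Type v} [Field k] [Ring A] [HopfAlgebra k A]

open Coalgebra HopfAlgebra

/-! ### Induced bimodules -/

/-- The bimodule induced from an `A`-module `M` along `σ`, realised as `M ⊗ A` with
`x (m ⊗ b) c = ∑ x₁ m ⊗ x₂ b c`. -/
def Induced (k : Type*) (A : Type*) (M : Type*) [Field k] [Ring A] [HopfAlgebra k A]
    [AddCommGroup M] [Module k M] : Type _ := M ⊗[k] A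

section

variable (M : Type*) [AddCommGroup M] [Module k M] [Module A M] [IsScalarTower k A M]

noncomputable instance : AddCommGroup (Induced k A M) := inferInstanceAs (AddCommGroup (M ⊗[k] A))

noncomputable instance : Module k (Induced k A M) := inferInstanceAs (Module k (M ⊗[k] A))

/-- Right multiplication on the second factor of `M ⊗ A`. -/
noncomputable def rightMulHom : Aᵐᵒᵖ →ₐ[k] Module.End k (M ⊗[k] A) :=
  (Module.End.lTensorAlgHom k A M).comp (Algebra.lsmul k k A)

variable {M}

theorem rightMulHom_tmul (c : A) (m : M) (b : A) :
    rightMulHom (k := k) M (MulOpposite.op c) (m ⊗ₜ b) = m ⊗ₜ (b * c) := rfl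

variable (M) in
/-- The action of `Aᵉ` on the induced bimodule. -/
noncomputable def inducedAct : Env k A →ₐ[k] Module.End k (M ⊗[k] A) :=
  Algebra.TensorProduct.lift (diagAct M A) (rightMulHom M) fun x c => by
    obtain ⟨c, rfl⟩ := MulOpposite.op_surjective c
    refine TensorProduct.ext' fun m b => ?_
    rw [Module.End.mul_apply, Module.End.mul_apply, rightMulHom_tmul, diagAct_tmul x (ℛ k x),
      diagAct_tmul x (ℛ k x), map_sum]
    exact Finset.sum_congr rfl fun i _ => by
      rw [rightMulHom_tmul, smul_eq_mul, smul_eq_mul, mul_assoc]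

noncomputable instance : Module (Env k A) (Induced k A M) :=
  Module.compHom (M ⊗[k] A) (inducedAct M).toRingHom

theorem Induced.smul_def (e : Env k A) (t : Induced k A M) :
    e • t = (inducedAct M e (show M ⊗[k] A from t) : M ⊗[k] A) := rfl

instance : IsScalarTower k (Env k A) (Induced k A M) where
  smul_assoc c e t := by
    rw [Induced.smul_def, Induced.smul_def, map_smul]
    rfl

variable (k A) in
/-- The element `m ⊗ b` of the induced bimodule. -/
noncomputable def Induced.tmul (m : M) (b : A) : Induced k A M := m ⊗ₜ[k] b

theorem Induced.tmul_smul (x c : A) (t : M ⊗[k] A) :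
    ((x ⊗ₜ[k] MulOpposite.op c : Env k A) • (show Induced k A M from t) : Induced k A M) =
      diagAct M A x (rightMulHom M (MulOpposite.op c) t) := by
  rw [Induced.smul_def, inducedAct, Algebra.TensorProduct.lift_tmul]
  rfl

@[elab_as_elim]
theorem Induced.induction_on {p : Induced k A M → Prop} (t : Induced k A M)
    (tmul : ∀ m b, p (Induced.tmul k A m b)) (add : ∀ s t, p s → p t → p (s + t)) : p t := by
  induction t using TensorProduct.induction_on with
  | zero =>
    have := tmul 0 0
    rwa [Induced.tmul, zero_tmul] at this
  | tmul m b => exact tmul m b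
  | add s t hs ht => exact add _ _ hs ht

theorem Induced.op_smul_tmul (c : A) (m : M) (b : A) :
    (1 ⊗ₜ[k] MulOpposite.op c : Env k A) • Induced.tmul k A m b = Induced.tmul k A m (b * c) := by
  refine (Induced.tmul_smul 1 c (m ⊗ₜ[k] b)).trans ?_
  rw [map_one]
  rfl

theorem Induced.smul_tmul (x : A) (m : M) (b : A) :
    (x ⊗ₜ[k] 1 : Env k A) • Induced.tmul k A m b =
      ∑ i ∈ (ℛ k x).index,
        Induced.tmul k A ((ℛ k x).left i • m) ((ℛ k x).right i * b) := by
  refine (Induced.tmul_smul x 1 (m ⊗ₜ[k] b)).trans ?_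
  rw [rightMulHom_tmul, mul_one, diagAct_tmul x (ℛ k x)]
  rfl

/-- Left multiplications are recovered from right multiplications and σ: the left side is x₁ ⊗ S(x₂)
x₃ read in `A ⊗ Aᵒᵖ`. This gives the universal property of induction and, later, the symmetry of σ
of an integral. -/
theorem sum_op_mul_sigma (x : A) :
    ∑ i ∈ (ℛ k x).index,
      (1 ⊗ₜ[k] MulOpposite.op ((ℛ k x).right i) : Env k A) * sigma k A ((ℛ k x).left i) =
        x ⊗ₜ 1 := by
  have h := congrArg (LinearMap.lTensor A (MulOpposite.opLinearEquiv k (M := A)).toLinearMap)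
    (sum_antipode_mul_right (k := k) x)
  rw [map_sum] at h
  refine Eq.trans (Finset.sum_congr rfl fun i _ => ?_) h
  rw [sigma_eq_sum k A _ (ℛ k ((ℛ k x).left i)), Finset.mul_sum, map_sum]
  refine Finset.sum_congr rfl fun j _ => ?_
  rw [Algebra.TensorProduct.tmul_mul_tmul, one_mul]
  rfl

/-- The second factor becomes x₂ S(x₃) and cancels, which is why `m ↦ m ⊗ 1` is linear over σ. -/
theorem Induced.sigma_smul_tmul (x : A) (m : M) :
    sigma k A x • Induced.tmul k A m 1 = Induced.tmul k A (x • m) 1 := by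
  have h' := congrArg (LinearMap.rTensor A ((LinearMap.toSpanSingleton A M m).restrictScalars k))
    (sum_mul_antipode_right (k := k) x)
  rw [map_sum] at h'
  rw [sigma_eq_sum k A x (ℛ k x), Finset.sum_smul]
  refine Eq.trans (Finset.sum_congr rfl fun i _ => ?_) h'
  refine (Induced.tmul_smul _ _ (m ⊗ₜ[k] (1 : A))).trans ?_
  rw [rightMulHom_tmul, one_mul, diagAct_tmul _ (ℛ k ((ℛ k x).left i)), map_sum]
  rfl

/-- The map of induced bimodules given by a map of modules. -/
noncomputable def Induced.map {M' : Type*} [AddCommGroup M'] [Module k M'] [Module A M']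
    [IsScalarTower k A M'] (f : M →ₗ[A] M') : Induced k A M →ₗ[Env k A] Induced k A M' where
  toFun := LinearMap.rTensor A (f.restrictScalars k)
  map_add' := map_add _
  map_smul' e t := by
    refine map_env_smul (LinearMap.rTensor A (f.restrictScalars k)).toAddMonoidHom
      (X := Induced k A M) (Y := Induced k A M') (fun x c t => ?_) e t
    refine (congrArg (LinearMap.rTensor A (f.restrictScalars k)) (Induced.tmul_smul x c t)).trans ?_
    refine Eq.trans ?_ (Induced.tmul_smul x c _).symm
    rw [rTensor_diagAct]
    congr 1
    change (LinearMap.rTensor A (f.restrictScalars k) ∘ₗ LinearMap.lTensor M _) t =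
      (LinearMap.lTensor M' _ ∘ₗ LinearMap.rTensor A (f.restrictScalars k)) t
    rw [LinearMap.rTensor_comp_lTensor, LinearMap.lTensor_comp_rTensor]

/-- For `M = A` the bimodule is free on `1 ⊗ 1`: acting on this element is the bijection `diagMap`.
The general case is a retract through a dual basis. -/
theorem Induced.finite_projective [Module.Finite A M] [Module.Projective A M] :
    Module.Finite (Env k A) (Induced k A M) ∧ Module.Projective (Env k A) (Induced k A M) := by
  have h1 := finite_projective_of_bijective
    (LinearMap.toSpanSingleton (Env k A) (Induced k A A) (Induced.tmul k A 1 1)) (by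
      have h : (⇑(LinearMap.toSpanSingleton (Env k A) (Induced k A A) (Induced.tmul k A 1 1))) =
          diagMap k A A ∘ LinearMap.lTensor A (MulOpposite.opLinearEquiv k (M := A)).symm := by
        funext t
        induction t using TensorProduct.induction_on with
        | zero => exact (map_zero _).trans (by simp; rfl)
        | add s t hs ht =>
          refine (map_add _ s t).trans ?_
          rw [hs, ht]
          simp only [Function.comp_apply, map_add]
          rfl
        | tmul x c =>
          obtain ⟨c, rfl⟩ := MulOpposite.op_surjective c
          rw [LinearMap.toSpanSingleton_apply]
          refine (Induced.tmul_smul x c ((1 : A) ⊗ₜ[k] (1 : A))).trans ?_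
          rw [rightMulHom_tmul, one_mul]
          rfl
      rw [h]
      exact (diagMap_bijective k A A).comp
        (LinearEquiv.lTensor A (MulOpposite.opLinearEquiv k (M := A)).symm).bijective)
  have := h1.1
  have := h1.2
  obtain ⟨n, r, r', hr⟩ := exists_dual_basis (R := A) M
  let π : Fin n → Induced k A A →ₗ[Env k A] Induced k A M := fun c =>
    Induced.map (LinearMap.toSpanSingleton A M (r c))
  refine finite_projective_of_retract (fun c => Induced.map (r' c)) π fun t => ?_
  induction t using Induced.induction_on with
  | add s t hs ht => simp only [map_add, Finset.sum_add_distrib, hs, ht]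
  | tmul x y =>
    change ∑ c, (r' c x • r c) ⊗ₜ[k] y = x ⊗ₜ y
    rw [← TensorProduct.sum_tmul, hr]

variable (k) in
/-- The map `m ↦ m ⊗ 1` to the induced bimodule, linear over `σ`. -/
noncomputable def Induced.unit (M : Type*) [AddCommGroup M] [Module k M] [Module A M]
    [IsScalarTower k A M] : M →ₛₗ[(sigma k A).toRingHom] Induced k A M where
  toFun m := Induced.tmul k A m 1
  map_add' x y := TensorProduct.add_tmul x y 1
  map_smul' x m := (Induced.sigma_smul_tmul x m).symm

variable {Y : Type*} [AddCommGroup Y] [Module k Y] [Module (Env k A) Y]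
  [IsScalarTower k (Env k A) Y]

/-- The universal property of the induced bimodule. -/
noncomputable def Induced.extend (h : M →ₛₗ[(sigma k A).toRingHom] Y) :
    Induced k A M →ₗ[Env k A] Y :=
  -- Semilinearity over σ includes linearity over `k`, because σ fixes the scalars.
  let h' : M →ₗ[k] Y :=
    { toFun := h
      map_add' := map_add h
      map_smul' := fun c m => by
        rw [← algebraMap_smul A c m, map_smulₛₗ, RingHom.id_apply]
        refine (congrArg (· • h m) ((sigma k A).commutes c)).trans ?_
        exact algebraMap_smul (Env k A) c (h m) }
  let φ : M ⊗[k] A →ₗ[k] Y := TensorProduct.lift ((ractHom k A Y).flip ∘ₗ h')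
  { toFun := φ
    map_add' := map_add φ
    map_smul' := fun e t => by
      refine map_env_smul (X := Induced k A M) φ.toAddMonoidHom (fun x c t => ?_) e t
      have hφ (m : M) (b : A) : φ (Induced.tmul k A m b) = ract k Y b (h m) := rfl
      have key : φ ((x ⊗ₜ[k] 1 : Env k A) • (1 ⊗ₜ[k] MulOpposite.op c : Env k A) • t) =
          (x ⊗ₜ[k] 1 : Env k A) • (1 ⊗ₜ[k] MulOpposite.op c : Env k A) • φ t := by
        induction t using Induced.induction_on with
        | add s t hs ht =>
          rw [smul_add, smul_add]
          refine (map_add φ _ _).trans ?_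
          rw [hs, ht, ← smul_add, ← smul_add]
          exact congrArg _ (congrArg _ (map_add φ s t).symm)
        | tmul m b =>
          rw [Induced.op_smul_tmul, Induced.smul_tmul]
          refine (map_sum φ _ _).trans ?_
          simp only [hφ, map_smulₛₗ, ract_apply]
          rw [smul_smul (1 ⊗ₜ[k] MulOpposite.op c : Env k A)]
          rw [Algebra.TensorProduct.tmul_mul_tmul, one_mul, ← MulOpposite.op_mul, smul_smul]
          -- The left action of `x` is moved past the right action of `b c` and expanded by
          -- `sum_op_mul_sigma`; semilinearity of `h` accounts for the factors σ(x₁).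
          rw [show (x ⊗ₜ[k] 1 : Env k A) * 1 ⊗ₜ[k] MulOpposite.op (b * c) =
            1 ⊗ₜ[k] MulOpposite.op (b * c) * x ⊗ₜ[k] 1 by simp, ← sum_op_mul_sigma, Finset.mul_sum,
            Finset.sum_smul]
          refine Finset.sum_congr rfl fun i _ => ?_
          rw [← mul_assoc (1 ⊗ₜ[k] MulOpposite.op (b * c) : Env k A),
            Algebra.TensorProduct.tmul_mul_tmul, one_mul, ← MulOpposite.op_mul, mul_smul]
          rfl
      have hxc : (x ⊗ₜ[k] MulOpposite.op c : Env k A) =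
          x ⊗ₜ[k] 1 * 1 ⊗ₜ[k] MulOpposite.op c := by simp
      rw [hxc, mul_smul, mul_smul]
      exact key }

theorem Induced.extend_tmul (h : M →ₛₗ[(sigma k A).toRingHom] Y) (m : M) (b : A) :
    Induced.extend h (Induced.tmul k A m b) = ract k Y b (h m) := rfl

theorem Induced.extend_unit (h : M →ₛₗ[(sigma k A).toRingHom] Y) (m : M) :
    Induced.extend h (Induced.unit k M m) = h m :=
  (Induced.extend_tmul h m 1).trans (one_smul (Env k A) _)

/-- The elements `m ⊗ 1` generate, since `m ⊗ b` is their right multiple by `b`. -/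
theorem Induced.hom_ext {f g : Induced k A M →ₗ[Env k A] Y}
    (h : ∀ m, f (Induced.unit k M m) = g (Induced.unit k M m)) : f = g := by
  ext t
  induction t using Induced.induction_on with
  | add s t hs ht => rw [map_add, map_add, hs, ht]
  | tmul m b =>
    have hb : Induced.tmul k A m b =
        (1 ⊗ₜ[k] MulOpposite.op b : Env k A) • Induced.unit k M m := by
      refine Eq.trans ?_ (Induced.op_smul_tmul b m 1).symm
      rw [one_mul]
    rw [hb, map_smul, map_smul, h]

end
end Induced

/-! ### The induced complete resolution and bijectivity of the comparison on cohomology -/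

section InducedResolution

variable {k : Type u} {A : Type v} [Field k] [Ring A] [HopfAlgebra k A]

/-- Every module over the field is flat, and contraction is tensoring with `g` followed by the
identification of `k ⊗ N` with `N`. -/
theorem Triv.lcontract_exact {L M : Type*} [AddCommGroup L] [Module k L] [Module A L]
    [IsScalarTower k A L] [AddCommGroup M] [Module k M] [Module A M] [IsScalarTower k A M]
    (N : Type*) [AddCommGroup N] [Module k N] {f : L →ₗ[A] M} {g : M →ₗ[A] Triv k A}
    (h : Function.Exact f g) :
    Function.Exact (LinearMap.rTensor N (f.restrictScalars k)) (Triv.lcontract N g) := by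
  have h' : Function.Exact (f.restrictScalars k) ((Triv.toField k A).comp (g.restrictScalars k)) := h
  intro t
  refine Iff.trans ?_ (Module.Flat.rTensor_exact N h' t)
  have h2 : Triv.lcontract N g t = TensorProduct.lid k N
      (LinearMap.rTensor N ((Triv.toField k A).comp (g.restrictScalars k)) t) := by
    induction t using TensorProduct.induction_on with
    | zero => simp
    | add s t hs ht => simp only [map_add, hs, ht]
    | tmul x y => rfl
  rw [h2, LinearEquiv.map_eq_zero_iff]

theorem Triv.rcontract_exact {L N : Type*} [AddCommGroup L] [Module k L] [Module A L]
    [IsScalarTower k A L] [AddCommGroup N] [Module k N] [Module A N] [IsScalarTower k A N]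
    (M : Type*) [AddCommGroup M] [Module k M] {f : L →ₗ[A] N} {g : N →ₗ[A] Triv k A}
    (h : Function.Exact f g) :
    Function.Exact (LinearMap.lTensor M (f.restrictScalars k)) (Triv.rcontract M g) := by
  have h' : Function.Exact (f.restrictScalars k) ((Triv.toField k A).comp (g.restrictScalars k)) := h
  intro t
  refine Iff.trans ?_ (Module.Flat.lTensor_exact M h' t)
  have h2 : Triv.rcontract M g t = TensorProduct.rid k M
      (LinearMap.lTensor M ((Triv.toField k A).comp (g.restrictScalars k)) t) := by
    induction t using TensorProduct.induction_on with
    | zero => simp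
    | add s t hs ht => simp only [map_add, hs, ht]
    | tmul x y => rfl
  rw [h2, LinearEquiv.map_eq_zero_iff]

theorem Triv.lcontract_surjective {M : Type*} [AddCommGroup M] [Module k M] [Module A M]
    [IsScalarTower k A M] (N : Type*) [AddCommGroup N] [Module k N] {g : M →ₗ[A] Triv k A}
    (h : Function.Surjective g) : Function.Surjective (Triv.lcontract N g) := fun y => by
  obtain ⟨m, hm⟩ := h (1 : k)
  refine ⟨m ⊗ₜ y, ?_⟩
  change Triv.toField k A (g m) • y = y
  rw [hm]
  exact one_smul k y

theorem Triv.rcontract_surjective {N : Type*} [AddCommGroup N] [Module k N] [Module A N]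
    [IsScalarTower k A N] (M : Type*) [AddCommGroup M] [Module k M] {g : N →ₗ[A] Triv k A}
    (h : Function.Surjective g) : Function.Surjective (Triv.rcontract M g) := fun x => by
  obtain ⟨m, hm⟩ := h (1 : k)
  refine ⟨x ⊗ₜ m, ?_⟩
  change Triv.toField k A (g m) • x = x
  rw [hm]
  exact one_smul k x

theorem Induced.exact_map {M M' M'' : Type*} [AddCommGroup M] [Module k M] [Module A M]
    [IsScalarTower k A M] [AddCommGroup M'] [Module k M'] [Module A M']
    [IsScalarTower k A M'] [AddCommGroup M''] [Module k M''] [Module A M'']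
    [IsScalarTower k A M''] {f : M →ₗ[A] M'} {g : M' →ₗ[A] M''} (h : Function.Exact f g) :
    Function.Exact (Induced.map (k := k) f) (Induced.map (k := k) g) :=
  Module.Flat.rTensor_exact A (f := f.restrictScalars k) (g := g.restrictScalars k) h

/-- The map from an induced bimodule to the regular bimodule given by an augmentation. -/
noncomputable def Induced.aug {M : Type*} [AddCommGroup M] [Module k M] [Module A M]
    [IsScalarTower k A M] (f : M →ₗ[A] Triv k A) : Induced k A M →ₗ[Env k A] Regular k A where
  toFun t := Triv.lcontract A f t
  map_add' := map_add (Triv.lcontract A f)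
  map_smul' e t := by
    refine map_env_smul (X := Induced k A M) (Y := Regular k A)
      (Triv.lcontract A f).toAddMonoidHom (fun x c t => ?_) e t
    refine (congrArg (Triv.lcontract A f) (Induced.tmul_smul x c t)).trans ?_
    refine Eq.trans ?_ (Regular.tmul_smul k A x c _).symm
    rw [Triv.lcontract_diagAct]
    refine (congrArg (x * ·) (Triv.lcontract_lTensor f _ t)).trans ?_
    exact (mul_assoc x _ c).symm

theorem Induced.aug_unit {M : Type*} [AddCommGroup M] [Module k M] [Module A M]
    [IsScalarTower k A M] (f : M →ₗ[A] Triv k A) (m : M) :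
    Induced.aug f (Induced.unit k M m) = unitHom k A (f m) :=
  (Algebra.algebraMap_eq_smul_one (A := A) (Triv.toField k A (f m))).symm

variable (P : CompleteResolution A (Triv k A))

/-- The complex of induced bimodules. -/
noncomputable def inducedComplex : ChainComplex (ModuleCat.{v} (Env k A)) ℤ where
  X n := ModuleCat.of (Env k A) (Induced k A (P.cx.X n))
  d i j := ModuleCat.ofHom (Induced.map (P.d i j))
  shape i j h := by
    have h0 : P.d i j = 0 := by rw [CompleteResolution.d, P.cx.shape i j h]; rfl
    rw [h0]
    ext t
    refine LinearMap.congr_fun (f := Induced.map (k := k) 0) (g := 0) (Induced.hom_ext fun m => ?_) t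
    exact TensorProduct.zero_tmul _ _
  d_comp_d' i j l hi hj := by
    ext t
    refine LinearMap.congr_fun (f := Induced.map (k := k) (P.d j l) ∘ₗ Induced.map (P.d i j))
      (g := 0) (Induced.hom_ext fun m => ?_) t
    change Induced.unit k _ (P.d j l (P.d i j m)) = 0
    rw [P.isAugmented.exact.d_d hi.symm hj.symm, map_zero]

/-- The complete resolution of the regular bimodule induced from a complete resolution of the
trivial module. -/
noncomputable def inducedResolution
    (hσ : HomAcyclic (sigma k A).toRingHom P.d (Env k A)) : BimoduleResolution k A where
  cx := inducedComplex P
  finite n :=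
    have := P.finite n
    have := P.projective n
    (Induced.finite_projective (k := k) (A := A) (M := P.cx.X n)).1
  projective n :=
    have := P.finite n
    have := P.projective n
    (Induced.finite_projective (k := k) (A := A) (M := P.cx.X n)).2
  exact n := Induced.exact_map (P.exact n)
  -- By the universal property, bimodule cocycles on the induced complex are σ-linear cocycles on
  -- `P` with values in `Aᵉ`; these bound by `hσ`, and the bounding map extends back.
  dual_exact n := by
    intro g
    constructor
    · intro hg
      obtain ⟨h, hh⟩ := hσ (n + 1) n (n - 1) rfl (by omega)
        (LinearMap.comp (M₂ := Induced k A (P.cx.X n)) g (Induced.unit k (P.cx.X n)))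
        fun x => LinearMap.congr_fun hg (Induced.unit k _ x)
      exact ⟨Induced.extend h, Induced.hom_ext (k := k) (M := P.cx.X n) fun m =>
        (Induced.extend_unit h _).trans (hh m)⟩
    · rintro ⟨h, rfl⟩
      refine Induced.hom_ext (k := k) (M := P.cx.X (n + 1)) fun m => ?_
      change h (Induced.unit k (P.cx.X (n - 1)) (P.d n (n - 1) (P.d (n + 1) n m))) = 0
      rw [P.isAugmented.exact.d_d rfl (by omega), map_zero]
      exact map_zero h
  aug := Induced.aug P.aug
  aug_surjective := Triv.lcontract_surjective A P.aug_surjective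
  aug_exact := Triv.lcontract_exact A P.aug_exact

variable {P} {X : BimoduleResolution k A}

theorem CompleteResolution.homAcyclic_self {R : Type v} [Ring R] {M : Type w} [AddCommGroup M]
    [Module R M] (Q : CompleteResolution R M) (Y : Type*) [AddCommGroup Y] [Module R Y]
    [Module.Finite R Y] [Module.Projective R Y] : HomAcyclic (RingHom.id R) Q.d Y :=
  Q.homAcyclic.of_finite_projective Y

/-- Composition with a comparison is bijective on cohomology. -/
theorem Comparison.toAdjoint_bijective (ι : Comparison P X)
    (hσ : HomAcyclic (sigma k A).toRingHom P.d (Env k A)) (n : ℤ) :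
    Function.Bijective (ι.toAdjoint n) := by
  let Q := inducedResolution P hσ
  have hfX := X.finite
  have hpX := X.projective
  have hfQ := Q.finite
  have hpQ := Q.projective
  -- ι factors as the unit `P → Q` followed by `J`. The unit induces a bijection on cochains, so it
  -- remains to see that `J` is a homotopy equivalence.
  let J : ∀ m, Q.cx.X m →ₗ[Env k A] X.cx.X m := fun m => Induced.extend (ι.map m)
  have hJu : ∀ m (x : P.cx.X m), J m (Induced.unit k _ x) = ι.map m x := fun m x =>
    Induced.extend_unit (ι.map m) x
  have hJ : ∀ m n, m = n + 1 → ∀ x, J n (Q.d m n x) = X.d m n (J m x) := fun m n _ x => by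
    refine LinearMap.congr_fun (f := J n ∘ₗ Q.d m n) (g := X.d m n ∘ₗ J m)
      (Induced.hom_ext (k := k) (M := P.cx.X m) fun p => ?_) x
    change J n (Induced.unit k _ (P.d m n p)) = X.d m n (J m (Induced.unit k _ p))
    rw [hJu, hJu, ι.chain_d]
  have hJa : ∀ x, X.aug (J 0 x) = Q.aug x := fun x => by
    refine LinearMap.congr_fun (f := X.aug ∘ₗ J 0) (g := Q.aug)
      (Induced.hom_ext (k := k) (M := P.cx.X 0) fun p => ?_) x
    refine Eq.trans ?_ (Induced.aug_unit P.aug p).symm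
    change X.aug (J 0 (Induced.unit k _ p)) = _
    rw [hJu, ι.augmentation]
  -- `K` lifts the augmentation of `X`. Both `J K` and `K J` preserve the augmentations, hence act
  -- as the identity on cohomology.
  obtain ⟨K, hK, hKa⟩ := Q.isAugmented.exists_chainMap X.isAugmented.exact hpX
    (fun j => X.homAcyclic_self (Q.cx.X j)) X.aug fun x => X.isAugmented.exact_zero.apply_apply_eq_zero x
  have hXX := X.isAugmented.comp_sub_coboundary X.isAugmented.exact hpX
    (fun j => X.homAcyclic_self (X.cx.X j)) (fun m => J m ∘ₗ K m) (fun m => LinearMap.id)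
    (fun m n h x => by rw [LinearMap.comp_apply, hK m n h, hJ m n h]; rfl) (fun _ _ _ _ => rfl) 0
    (fun x => by rw [LinearMap.comp_apply, hJa, hKa]; exact sub_self _)
    (N := Regular k A) (m := n) (l := n - 1) (n := n + 1) (by omega) rfl
  have hQQ := Q.isAugmented.comp_sub_coboundary Q.isAugmented.exact hpQ
    (fun j => Q.homAcyclic_self (Q.cx.X j)) (fun m => K m ∘ₗ J m) (fun m => LinearMap.id)
    (fun m n h x => by rw [LinearMap.comp_apply, hJ m n h, hK m n h]; rfl) (fun _ _ _ _ => rfl) 0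
    (fun x => by rw [LinearMap.comp_apply, hKa, hJa]; exact sub_self _)
    (N := Regular k A) (m := n) (l := n - 1) (n := n + 1) (by omega) rfl
  constructor
  · refine (injective_iff_map_eq_zero _).2 fun x hx => ?_
    obtain ⟨f, hf, rfl⟩ := HomCohomology.exists_mk x
    rw [Comparison.toAdjoint_mk, HomCohomology.mk_eq_zero (l := n - 1) (by omega)] at hx
    obtain ⟨h₀, hh₀⟩ := hx
    -- If `f ι` bounds, then `f J` bounds by the extended cochain. Precomposing with `K` and
    -- correcting by the homotopy between `J K` and the identity shows that `f` bounds.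
    have hfJ : ∀ q, f (J n q) = Induced.extend (Adjoint.toSemilinear h₀) (Q.d n (n - 1) q) :=
      fun q => LinearMap.congr_fun (f := f ∘ₗ J n)
        (g := (Induced.extend (Adjoint.toSemilinear h₀)) ∘ₗ Q.d n (n - 1))
        (Induced.hom_ext (k := k) (M := P.cx.X n) fun p => by
          refine (congrArg f (hJu n p)).trans ((hh₀ p).trans ?_)
          exact (Induced.extend_unit (Adjoint.toSemilinear h₀) _).symm) q
    obtain ⟨g, hg⟩ := hXX f (mem_cocycles.1 hf)
    refine (HomCohomology.mk_eq_zero (l := n - 1) (by omega) hf).2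
      ⟨Induced.extend (Adjoint.toSemilinear h₀) ∘ₗ K (n - 1) - g, fun x => ?_⟩
    change f x = Induced.extend (Adjoint.toSemilinear h₀) (K (n - 1) (X.d n (n - 1) x)) -
      g (X.d n (n - 1) x)
    rw [← hg, hK n (n - 1) (by omega)]
    refine Eq.trans ?_ (congrArg (· - _) (hfJ (K n x)))
    exact (sub_sub_cancel _ _).symm
  · intro y
    obtain ⟨φ, hφ, rfl⟩ := HomCohomology.exists_mk y
    -- The preimage is the extension of φ to `Q` pulled back along `K`. Its image under ρ is `ψ K J`
    -- on units, cohomologous to ψ on units, that is, to φ.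
    let ψ : Q.cx.X n →ₗ[Env k A] Regular k A := Induced.extend (Adjoint.toSemilinear φ)
    have hψu : ∀ p : P.cx.X n, ψ (Induced.unit k _ p) = φ p := fun p =>
      Induced.extend_unit (Adjoint.toSemilinear φ) p
    have hψ : ∀ q, ψ (Q.d (n + 1) n q) = 0 := fun q =>
      LinearMap.congr_fun (f := ψ ∘ₗ Q.d (n + 1) n) (g := 0)
        (Induced.hom_ext (k := k) (M := P.cx.X (n + 1)) fun p =>
          (hψu _).trans (mem_cocycles.1 hφ p)) q
    obtain ⟨g, hg⟩ := hQQ ψ hψ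
    have hf : ψ ∘ₗ K n ∈ cocycles X.cx (Regular k A) n := mem_cocycles.2 fun x => by
      refine (congrArg ψ (hK (n + 1) n rfl x)).trans (hψ _)
    refine ⟨HomCohomology.mk (ψ ∘ₗ K n) hf, ?_⟩
    rw [Comparison.toAdjoint_mk, HomCohomology.mk_eq_mk (l := n - 1) (by omega)]
    refine ⟨Adjoint.ofSemilinear (LinearMap.comp (M₂ := Induced k A (P.cx.X (n - 1))) g
      (Induced.unit k (P.cx.X (n - 1)))), fun p => ?_⟩
    refine Eq.trans ?_ (hg (Induced.unit k (P.cx.X n) p))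
    refine congrArg₂ (· - ·) ?_ (hψu p).symm
    exact congrArg (fun z => ψ (K n z)) (hJu n p).symm

/-- Comparisons exist. -/
theorem Comparison.nonempty (P : CompleteResolution A (Triv k A)) (X : BimoduleResolution k A)
    (hσ : HomAcyclic (sigma k A).toRingHom P.d (Env k A)) : Nonempty (Comparison P X) := by
  have hfX := X.finite
  have hpX := X.projective
  obtain ⟨E, hE, hEa⟩ := X.isAugmented.exists_chainMap P.isAugmented.exact P.projective
    (fun j => hσ.of_finite_projective (X.cx.X j))
    (Adjoint.toSemilinear (unitHom k A ∘ₗ P.aug)) fun x => by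
      change unitHom k A (P.aug (P.d 1 0 x)) = 0
      rw [P.isAugmented.exact_zero.apply_apply_eq_zero, map_zero]
  refine ⟨⟨E, fun i j x => ?_, hEa⟩⟩
  -- The construction controls adjacent degrees only; elsewhere both differentials vanish.
  by_cases h : i = j + 1
  · exact hE i j h x
  · have h' : ¬ (ComplexShape.down ℤ).Rel i j := fun h' => h h'.symm
    rw [P.cx.shape i j h', X.cx.shape i j h']
    exact map_zero (E j)

end InducedResolution

/-! ### Existence of diagonal approximations -/

section Diagonal

variable {R : Type*} [Ring R] {S : ℤ → Type*} [∀ i, AddCommGroup (S i)] [∀ i, Module R (S i)]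
  {d : ∀ i j, S i →ₗ[R] S j} {T : ℤ → ℤ → Type*} [∀ i j, AddCommGroup (T i j)]
  [∀ i j, Module R (T i j)]

/-- The chain map equation prescribes `d₁ G'` as `G d - (-1)ⁱ d₂ G`. The hypothesis on `G` says that
the latter is a cycle in its row, so projectivity of the source and exactness of the rows solve for
`G'`. -/
theorem exists_next_column (hS : ∀ i, Module.Projective R (S i)) (hd : IsExactComplex d)
    (d₁ : ∀ i i' j, T i j →ₗ[R] T i' j) (d₂ : ∀ i j j', T i j →ₗ[R] T i j')
    (comm : ∀ i i' j j' t, d₁ i i' j' (d₂ i j j' t) = d₂ i' j j' (d₁ i i' j t))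
    (rows : ∀ j, IsExactComplex fun i i' => d₁ i i' j) (cols : ∀ i, IsExactComplex (d₂ i))
    (i : ℤ) (G : ∀ j n, i + j = n → (S n →ₗ[R] T i j))
    (hG : ∀ l j j' n n' (_ : i = l + 1) (_ : j' = j + 1) (_ : n' = n + 1) (h : i + j = n)
      (h' : i + j' = n') x, d₁ i l j (G j n h (d n' n x)) =
        (i.negOnePow : ℤ) • d₁ i l j (d₂ i j' j (G j' n' h' x))) :
    ∃ G' : ∀ j n, i + 1 + j = n → (S n →ₗ[R] T (i + 1) j),
      (∀ j j' n n' (_ : j' = j + 1) (_ : n' = n + 1) (h : i + j = n) (h' : i + 1 + j = n')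
        (h'' : i + j' = n') x, G j n h (d n' n x) =
          d₁ (i + 1) i j (G' j n' h' x) + (i.negOnePow : ℤ) • d₂ i j' j (G j' n' h'' x)) ∧
      ∀ l j j' n n' (_ : i + 1 = l + 1) (_ : j' = j + 1) (_ : n' = n + 1) (h : i + 1 + j = n)
        (h' : i + 1 + j' = n') x, d₁ (i + 1) l j (G' j n h (d n' n x)) =
          ((i + 1).negOnePow : ℤ) • d₁ (i + 1) l j (d₂ (i + 1) j' j (G' j' n' h' x)) := by
  have key : ∀ j n' (h' : i + 1 + j = n'), ∃ g : S n' →ₗ[R] T (i + 1) j, ∀ x,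
      d₁ (i + 1) i j (g x) = G j (i + j) rfl (d n' (i + j) x) -
        (i.negOnePow : ℤ) • d₂ i (j + 1) j (G (j + 1) n' (by omega) x) := fun j n' h' => by
    obtain ⟨g, hg⟩ := (rows j).exists_lift hS (a := n') (i := i + 1) (j := i) (l := i - 1) rfl
      (by omega) (G j (i + j) rfl ∘ₗ d n' (i + j) -
        (i.negOnePow : ℤ) • (d₂ i (j + 1) j ∘ₗ G (j + 1) n' (by omega))) fun x => by
          rw [LinearMap.sub_apply, map_sub, LinearMap.smul_apply, map_zsmul, sub_eq_zero]
          exact hG (i - 1) j (j + 1) (i + j) n' (by omega) rfl (by omega) _ _ x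
    exact ⟨g, hg⟩
  choose G' hG' using key
  have hr : ∀ j j' n n' (_ : j' = j + 1) (_ : n' = n + 1) (h : i + j = n) (h' : i + 1 + j = n')
      (h'' : i + j' = n') x, G j n h (d n' n x) =
        d₁ (i + 1) i j (G' j n' h' x) + (i.negOnePow : ℤ) • d₂ i j' j (G j' n' h'' x) := by
    rintro j _ _ n' rfl - rfl h' h'' x
    rw [hG', sub_add_cancel]
  refine ⟨G', hr, ?_⟩
  intro l j j' n n' hl hj hn h h' x
  obtain rfl : i = l := by omega
  have h1 := hr j j' (i + j) n hj (by omega) rfl h (by omega) (d n' n x)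
  have h2 := hr j' (j' + 1) n n' rfl hn (by omega) h' (by omega) x
  rw [hd.d_d hn (by omega), map_zero] at h1
  -- The solvability condition passes on: substituting one instance of the equation into `d₂` of
  -- another kills `d₂ d₂`, and `d d = 0` supplies the rest; the new sign comes from increasing `i`
  -- by one.
  rw [comm, eq_sub_of_add_eq h2.symm, map_sub, map_zsmul, (cols i).d_d rfl hj, smul_zero, sub_zero,
    Int.negOnePow_succ, Units.val_neg, neg_smul]
  exact eq_neg_of_add_eq_zero_left h1.symm

/-- Here `d₁ G'` is given and `G` is unknown, and the equation `d₁ G' = G d - (-1)ⁱ d₂ G` says that,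
up to signs, `d₁ G'` is null-homotopic as a chain map from a shift of `S` to a column. The column is
augmented over `S i`, so the homotopy lemma applies once the augmented map is a coboundary. -/
theorem exists_previous_column {M : Type*} [AddCommGroup M] [Module R M] {aug : S 0 →ₗ[R] M}
    (hS : ∀ i, Module.Projective R (S i)) (hd : IsAugmented d aug)
    (d₁ : ∀ i i' j, T i j →ₗ[R] T i' j) (d₂ : ∀ i j j', T i j →ₗ[R] T i j')
    (comm : ∀ i i' j j' t, d₁ i i' j' (d₂ i j j' t) = d₂ i' j j' (d₁ i i' j t))
    (rows : ∀ j, IsExactComplex fun i i' => d₁ i i' j)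
    (a : ∀ i, T i 0 →ₗ[R] S i) (cols : ∀ i, IsAugmented (d₂ i) (a i))
    (acyc : ∀ i j, HomAcyclic (RingHom.id R) d (T i j))
    (acyc' : ∀ i, HomAcyclic (RingHom.id R) d (S i))
    (i : ℤ) (G' : ∀ j n, i + 1 + j = n → (S n →ₗ[R] T (i + 1) j))
    (hG' : ∀ l j j' n n' (_ : i + 1 = l + 1) (_ : j' = j + 1) (_ : n' = n + 1) (h : i + 1 + j = n)
      (h' : i + 1 + j' = n') x, d₁ (i + 1) l j (G' j n h (d n' n x)) =
        ((i + 1).negOnePow : ℤ) • d₁ (i + 1) l j (d₂ (i + 1) j' j (G' j' n' h' x))) :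
    ∃ G : ∀ j n, i + j = n → (S n →ₗ[R] T i j),
      (∀ j j' n n' (_ : j' = j + 1) (_ : n' = n + 1) (h : i + j = n) (h' : i + 1 + j = n')
        (h'' : i + j' = n') x, G j n h (d n' n x) =
          d₁ (i + 1) i j (G' j n' h' x) + (i.negOnePow : ℤ) • d₂ i j' j (G j' n' h'' x)) ∧
      ∀ l j j' n n' (_ : i = l + 1) (_ : j' = j + 1) (_ : n' = n + 1) (h : i + j = n)
        (h' : i + j' = n') x, d₁ i l j (G j n h (d n' n x)) =
          (i.negOnePow : ℤ) • d₁ i l j (d₂ i j' j (G j' n' h' x)) := by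
  -- The sign `(-1)^{(i+1)m}` cancels the `(-1)^{i+1}` in the hypothesis and makes `E` commute
  -- strictly with the differentials.
  let E : ∀ m, S (i + 1 + m) →ₗ[R] T i m := fun m =>
    (((i + 1) * m).negOnePow : ℤ) • (d₁ (i + 1) i m ∘ₗ G' m (i + 1 + m) rfl)
  have hE : ∀ m n, m = n + 1 → ∀ x, E n (d (i + 1 + m) (i + 1 + n) x) = d₂ i m n (E m x) := by
    intro m n h x
    change (((i + 1) * n).negOnePow : ℤ) • d₁ (i + 1) i n (G' n (i + 1 + n) rfl _) =
      d₂ i m n ((((i + 1) * m).negOnePow : ℤ) • d₁ (i + 1) i m (G' m (i + 1 + m) rfl x))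
    rw [hG' i n m (i + 1 + n) (i + 1 + m) rfl h (by omega) rfl rfl, comm, map_zsmul,
      negOnePow_smul_smul (m := (i + 1) * m) (by subst h; ring)]
  -- Augmenting the degree 0 part of the chain map `E` gives a cocycle with values in `S i`, and
  -- such cocycles bound.
  obtain ⟨γ, hγ⟩ := acyc' i (i + 1 + 1) (i + 1 + 0) (i + 1 + -1) (by omega) (by omega)
    (a i ∘ₗ E 0) fun x => by
      change a i (E 0 (d (i + 1 + 1) (i + 1 + 0) x)) = 0
      rw [hE 1 0 rfl, (cols i).exact_zero.apply_apply_eq_zero]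
  obtain ⟨H, hH⟩ := (cols i).exists_homotopy (S := fun m => S (i + 1 + m))
    (dS := fun l m => d (i + 1 + l) (i + 1 + m))
    (fun l m n hl hm => hd.exact _ _ _ (by omega) (by omega)) (fun m => hS _)
    (fun j l m n hl hm => acyc i j _ _ _ (by omega) (by omega)) E hE γ fun x => (hγ x).symm
  -- The homotopy raises the column degree by one, so the component in degree `j` comes from `H` in
  -- degree `j - 1`, with the matching sign.
  let G : ∀ j n, i + j = n → (S n →ₗ[R] T i j) := fun j n h =>
    (((i + 1) * j).negOnePow : ℤ) •
      ((show i + 1 + (j - 1) = n by omega) ▸ H (j - 1) j (by omega) : S n →ₗ[R] T i j)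
  have hGH : ∀ j m (h : i + j = i + 1 + m) (h' : j = m + 1) x, G j (i + 1 + m) h x =
      (((i + 1) * j).negOnePow : ℤ) • H m j h' x := by
    intro j m h h' x
    obtain rfl : m = j - 1 := by omega
    rfl
  have hr : ∀ j j' n n' (_ : j' = j + 1) (_ : n' = n + 1) (h : i + j = n) (h' : i + 1 + j = n')
      (h'' : i + j' = n') x, G j n h (d n' n x) =
        d₁ (i + 1) i j (G' j n' h' x) + (i.negOnePow : ℤ) • d₂ i j' j (G j' n' h'' x) := by
    rintro j j' n n' hj hn h rfl h'' x
    obtain ⟨l, rfl⟩ : ∃ l, j = l + 1 := ⟨j - 1, by omega⟩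
    obtain rfl : n = i + 1 + l := by omega
    have h1 := congrArg ((((i + 1) * (l + 1)).negOnePow : ℤ) • ·) (hH l (l + 1) j' rfl hj x)
    simp only [smul_add] at h1
    rw [hGH (l + 1) l h rfl, hGH j' (l + 1) h'' hj]
    change (((i + 1) * (l + 1)).negOnePow : ℤ) • (((i + 1) * (l + 1)).negOnePow : ℤ) •
      d₁ (i + 1) i (l + 1) (G' (l + 1) _ rfl x) = _ at h1
    rw [negOnePow_smul_smul rfl, Int.negOnePow_even _ ⟨_, rfl⟩, Units.val_one, one_smul] at h1
    rw [h1, map_zsmul, negOnePow_smul_smul rfl,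
      show i + (i + 1) * j' = (i + 1) * (l + 1) + (i + i + 1) by subst hj; ring,
      Int.negOnePow_add, Int.negOnePow_succ, Int.negOnePow_even _ ⟨i, rfl⟩]
    simp only [mul_neg, mul_one, Units.val_neg, neg_smul]
    abel
  refine ⟨G, hr, fun l j j' n n' hl hj hn h h' x => ?_⟩
  rw [hr j j' n n' hj hn h (by omega) h', map_add, (rows j).d_d rfl hl, zero_add, map_zsmul]

/-- Existence of a chain map from a complex to the product total complex of a double complex. -/
theorem exists_diagonal {M : Type*} [AddCommGroup M] [Module R M] {aug : S 0 →ₗ[R] M}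
    (hS : ∀ i, Module.Projective R (S i)) (hd : IsAugmented d aug)
    (d₁ : ∀ i i' j, T i j →ₗ[R] T i' j) (d₂ : ∀ i j j', T i j →ₗ[R] T i j')
    (comm : ∀ i i' j j' t, d₁ i i' j' (d₂ i j j' t) = d₂ i' j j' (d₁ i i' j t))
    (rows : ∀ j, IsExactComplex fun i i' => d₁ i i' j)
    (a : ∀ i, T i 0 →ₗ[R] S i) (cols : ∀ i, IsAugmented (d₂ i) (a i))
    (acyc : ∀ i j, HomAcyclic (RingHom.id R) d (T i j))
    (acyc' : ∀ i, HomAcyclic (RingHom.id R) d (S i))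
    (b : ∀ j, T 0 j →ₗ[R] S j) (hb : ∀ j, Function.Surjective (b j))
    (hbd : ∀ j j' t, b j' (d₂ 0 j j' t) = d j j' (b j t))
    (hb0 : ∀ j t, b j t = 0 → d₁ 0 (-1) j t = 0) :
    ∃ Γ : ∀ i j n, i + j = n → (S n →ₗ[R] T i j),
      (∀ i i' j j' n n' (_ : i' = i + 1) (_ : j' = j + 1) (_ : n' = n + 1) (h : i + j = n)
        (h' : i' + j = n') (h'' : i + j' = n') x, Γ i j n h (d n' n x) =
          d₁ i' i j (Γ i' j n' h' x) + (i.negOnePow : ℤ) • d₂ i j' j (Γ i j' n' h'' x)) ∧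
      ∀ x, b 0 (Γ 0 0 0 rfl x) = x := by
  -- Column 0 consists of sections of `b`, independent across degrees. They need not commute with
  -- the differentials; the neighbouring columns absorb the defect.
  have key : ∀ j, ∃ g : S j →ₗ[R] T 0 j, ∀ x, b j (g x) = x := fun j =>
    have := hS j
    exists_semilinear_lift (b j) LinearMap.id fun x => hb j x
  choose g hg using key
  obtain ⟨G₀, hG₀⟩ : ∃ G : ∀ j n, 0 + j = n → (S n →ₗ[R] T 0 j), ∀ j h x, G j j h x = g j x :=
    ⟨fun j n h => ((zero_add j).symm.trans h) ▸ g j, fun j h x => rfl⟩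
  obtain ⟨F, hF0, hF⟩ := exists_int_seq (α := fun i => ∀ j n, i + j = n → (S n →ₗ[R] T i j))
    (fun i G => ∀ l j j' n n' (_ : i = l + 1) (_ : j' = j + 1) (_ : n' = n + 1) (h : i + j = n)
      (h' : i + j' = n') x, d₁ i l j (G j n h (d n' n x)) =
        (i.negOnePow : ℤ) • d₁ i l j (d₂ i j' j (G j' n' h' x)))
    (fun i G G' => ∀ j j' n n' (_ : j' = j + 1) (_ : n' = n + 1) (h : i + j = n)
        (h' : i + 1 + j = n') (h'' : i + j' = n') x, G j n h (d n' n x) =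
          d₁ (i + 1) i j (G' j n' h' x) + (i.negOnePow : ℤ) • d₂ i j' j (G j' n' h'' x))
    (exists_next_column hS hd.exact d₁ d₂ comm rows fun i => (cols i).exact)
    (exists_previous_column hS hd d₁ d₂ comm rows a cols acyc acyc') 0 G₀
    (by
      intro l j j' n n' hl hj hn h h' x
      obtain rfl : l = -1 := by omega
      obtain rfl : j = n := by omega
      obtain rfl : j' = n' := by omega
      -- The defect `G₀ d - d₂ G₀` of the sections is killed by `b`, which commutes with the
      -- differentials, and hence by `d₁`; this is the starting condition.
      rw [hG₀, hG₀, Int.negOnePow_zero, Units.val_one, one_smul, ← sub_eq_zero, ← map_sub]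
      refine hb0 _ _ ?_
      rw [map_sub, hbd, hg, hg, sub_self])
  refine ⟨F, ?_, fun x => ?_⟩
  · rintro i _ j j' n n' rfl hj hn h h' h'' x
    exact hF i j j' n n' hj hn h h' h'' x
  · rw [hF0, hG₀, hg]

end Diagonal

/-! ### Diagonal approximations for the trivial module -/

section DiagonalApprox

variable {k : Type u} {A : Type v} [Field k] [Ring A] [HopfAlgebra k A]

instance {M N : Type*} [AddCommGroup M] [AddCommGroup N] [Module k M] [Module k N]
    [Module A M] [Module A N] [IsScalarTower k A M] [IsScalarTower k A N] :
    IsScalarTower k A (DiagTensor k A M N) where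
  smul_assoc c a t := by
    rw [DiagTensor.smul_def, DiagTensor.smul_def, map_smul]
    rfl

/-- Diagonal approximations of complete resolutions of the trivial module exist. -/
theorem DiagonalApprox.nonempty [FiniteDimensional k A] (P : CompleteResolution A (Triv k A)) :
    Nonempty (DiagonalApprox P) := by
  have hf := P.finite
  have hp := P.projective
  -- Finite dimension of the right factor makes the diagonal tensor products finitely generated as
  -- well as projective, which is what acyclicity with values in them requires.
  have hk : ∀ i, FiniteDimensional k (P.cx.X i) := fun i => Module.Finite.trans A _
  have hT := fun i j => DiagTensor.finite_projective k A (M := P.cx.X i) (N := P.cx.X j)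
  have hT1 := fun i j => (hT i j).1
  have hT2 := fun i j => (hT i j).2
  obtain ⟨Γ, hΓ, hΓ0⟩ := exists_diagonal (T := fun i j => DiagTensor k A (P.cx.X i) (P.cx.X j))
    hp P.isAugmented (fun i i' j => DiagTensor.rTensor (P.cx.X j) (P.d i i'))
    (fun i j j' => DiagTensor.lTensor (P.cx.X i) (P.d j j'))
    (fun i i' j j' t => (LinearMap.congr_fun (LinearMap.rTensor_comp_lTensor _
      ((P.d i i').restrictScalars k) ((P.d j j').restrictScalars k)) t).trans
        (LinearMap.congr_fun (LinearMap.lTensor_comp_rTensor _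
      ((P.d i i').restrictScalars k) ((P.d j j').restrictScalars k)) t).symm)
    (fun j i i' i'' h h' => Module.Flat.rTensor_exact (P.cx.X j)
      (f := (P.d i i').restrictScalars k) (g := (P.d i' i'').restrictScalars k)
      (P.isAugmented.exact i i' i'' h h'))
    (fun i =>
      { toFun := Triv.rcontract (P.cx.X i) P.aug
        map_add' := map_add _
        map_smul' := Triv.rcontract_diagAct P.aug })
    (fun i =>
      { exact := fun j j' j'' h h' => Module.Flat.lTensor_exact (P.cx.X i)
          (f := (P.d j j').restrictScalars k) (g := (P.d j' j'').restrictScalars k)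
          (P.isAugmented.exact j j' j'' h h')
        surjective := Triv.rcontract_surjective _ P.aug_surjective
        exact_zero := Triv.rcontract_exact _ P.aug_exact })
    (fun i j => P.homAcyclic_self _) (fun i => P.homAcyclic_self _)
    (fun j =>
      { toFun := Triv.lcontract (P.cx.X j) P.aug
        map_add' := map_add _
        map_smul' := Triv.lcontract_diagAct P.aug })
    (fun j => Triv.lcontract_surjective _ P.aug_surjective)
    (fun j j' t => Triv.lcontract_lTensor P.aug ((P.d j j').restrictScalars k) t)
    (fun j t ht => by
      obtain ⟨s, rfl⟩ := (Triv.lcontract_exact (P.cx.X j) P.aug_exact t).1 ht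
      exact (Module.Flat.rTensor_exact (P.cx.X j)
        (f := (P.d 1 0).restrictScalars k) (g := (P.d 0 (-1)).restrictScalars k)
        (P.isAugmented.exact 1 0 (-1) rfl rfl)).apply_apply_eq_zero s)
  exact ⟨{
    comp := fun i j n h => (Γ i j n h).restrictScalars k
    equivariant := fun i j n h a x => map_smul (Γ i j n h) a x
    chain := fun i j n h x => hΓ i (i + 1) j (j + 1) n (n + 1) rfl rfl rfl h _ _ x
    augmentation := fun x =>
      (Triv.pairing_eq_lcontract P.aug P.aug _).trans (congrArg P.aug (hΓ0 x)) }⟩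

end DiagonalApprox

section BalTensor

variable {k : Type u} {A : Type v} [Field k] [Ring A] [HopfAlgebra k A]

variable {X Y X' Y' X'' Y'' : Type*} [AddCommGroup X] [AddCommGroup Y] [AddCommGroup X']
  [AddCommGroup Y'] [AddCommGroup X''] [AddCommGroup Y'']
  [Module k X] [Module k Y] [Module k X'] [Module k Y'] [Module k X''] [Module k Y'']
  [Module (Env k A) X] [Module (Env k A) Y] [Module (Env k A) X'] [Module (Env k A) Y']
  [Module (Env k A) X''] [Module (Env k A) Y'']
  [IsScalarTower k (Env k A) X] [IsScalarTower k (Env k A) Y]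
  [IsScalarTower k (Env k A) X'] [IsScalarTower k (Env k A) Y']
  [IsScalarTower k (Env k A) X''] [IsScalarTower k (Env k A) Y'']

/-! ### The bimodule structure of `X ⊗_A Y` -/

theorem lact_one (x : X) : lact k X (1 : A) x = x := one_smul (Env k A) x

theorem ract_one (x : X) : ract k X (1 : A) x = x := one_smul (Env k A) x

variable (k A X Y) in
/-- The left action on `X ⊗_A Y`. -/
noncomputable def BalTensor.leftHom : A →ₐ[k] Module.End k (BalTensor k A X Y) :=
  AlgHom.ofLinearMap
    { toFun := fun a => BalTensor.act X Y a 1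
      map_add' := fun a b => BalTensor.hom_ext fun x y => by
        change BalTensor.mk k A X Y (lactHom k A X (a + b) x) _ =
          BalTensor.mk k A X Y (lactHom k A X a x) _ + BalTensor.mk k A X Y (lactHom k A X b x) _
        simp only [map_add, LinearMap.add_apply]
      map_smul' := fun c a => BalTensor.hom_ext fun x y => by
        change BalTensor.mk k A X Y (lactHom k A X (c • a) x) _ =
          c • BalTensor.mk k A X Y (lactHom k A X a x) _
        simp only [map_smul, LinearMap.smul_apply] }
    (BalTensor.hom_ext fun x y => by
      change BalTensor.tmul k A (lact k X 1 x) (ract k Y 1 y) = BalTensor.tmul k A x y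
      rw [lact_one, ract_one])
    fun a b => BalTensor.hom_ext fun x y => by
      change BalTensor.tmul k A (lact k X (a * b) x) (ract k Y 1 y) =
        BalTensor.tmul k A (lact k X a (lact k X b x)) (ract k Y 1 (ract k Y 1 y))
      rw [lact_lact, ract_one, ract_one]

variable (k A X Y) in
/-- The right action on `X ⊗_A Y`. -/
noncomputable def BalTensor.rightHom : Aᵐᵒᵖ →ₐ[k] Module.End k (BalTensor k A X Y) :=
  AlgHom.ofLinearMap
    { toFun := fun b => BalTensor.act X Y 1 b.unop
      map_add' := fun a b => BalTensor.hom_ext fun x y => by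
        change BalTensor.mk k A X Y _ (ractHom k A Y (a.unop + b.unop) y) =
          BalTensor.mk k A X Y _ (ractHom k A Y a.unop y) +
            BalTensor.mk k A X Y _ (ractHom k A Y b.unop y)
        simp only [map_add, LinearMap.add_apply]
      map_smul' := fun c a => BalTensor.hom_ext fun x y => by
        change BalTensor.mk k A X Y _ (ractHom k A Y (c • a.unop) y) =
          c • BalTensor.mk k A X Y _ (ractHom k A Y a.unop y)
        simp only [map_smul, LinearMap.smul_apply] }
    (BalTensor.hom_ext fun x y => by
      change BalTensor.tmul k A (lact k X 1 x) (ract k Y 1 y) = BalTensor.tmul k A x y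
      rw [lact_one, ract_one])
    fun a b => BalTensor.hom_ext fun x y => by
      change BalTensor.tmul k A (lact k X 1 x) (ract k Y (b.unop * a.unop) y) =
        BalTensor.tmul k A (lact k X 1 (lact k X 1 x)) (ract k Y a.unop (ract k Y b.unop y))
      rw [ract_ract, lact_one, lact_one]

theorem BalTensor.leftHom_rightHom (a b : A) (t : BalTensor k A X Y) :
    BalTensor.leftHom k A X Y a (BalTensor.rightHom k A X Y (MulOpposite.op b) t) =
      BalTensor.act X Y a b t := by
  induction t using BalTensor.induction_on with
  | add s t hs ht => simp only [map_add, hs, ht]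
  | tmul x y =>
    change BalTensor.tmul k A (lact k X a (lact k X 1 x)) (ract k Y 1 (ract k Y b y)) =
      BalTensor.tmul k A (lact k X a x) (ract k Y b y)
    rw [lact_one, ract_one]

theorem BalTensor.commute_leftHom_rightHom (a : A) (b : Aᵐᵒᵖ) :
    Commute (BalTensor.leftHom k A X Y a) (BalTensor.rightHom k A X Y b) :=
  BalTensor.hom_ext fun x y => by
    change BalTensor.tmul k A (lact k X a (lact k X 1 x)) (ract k Y 1 (ract k Y b.unop y)) =
      BalTensor.tmul k A (lact k X 1 (lact k X a x)) (ract k Y b.unop (ract k Y 1 y))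
    simp only [lact_one, ract_one]

variable (k A X Y) in
/-- The action of `Aᵉ` on `X ⊗_A Y`. -/
noncomputable def BalTensor.envHom : Env k A →ₐ[k] Module.End k (BalTensor k A X Y) :=
  Algebra.TensorProduct.lift (BalTensor.leftHom k A X Y) (BalTensor.rightHom k A X Y)
    BalTensor.commute_leftHom_rightHom

noncomputable instance : Module (Env k A) (BalTensor k A X Y) :=
  Module.compHom (BalTensor k A X Y) (BalTensor.envHom k A X Y).toRingHom

theorem BalTensor.env_smul (a b : A) (t : BalTensor k A X Y) :
    (a ⊗ₜ[k] MulOpposite.op b : Env k A) • t = BalTensor.act X Y a b t := by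
  refine Eq.trans ?_ (BalTensor.leftHom_rightHom a b t)
  change BalTensor.envHom k A X Y (a ⊗ₜ[k] MulOpposite.op b) t = _
  rw [envHom, Algebra.TensorProduct.lift_tmul]
  rfl

instance : IsScalarTower k (Env k A) (BalTensor k A X Y) where
  smul_assoc c e t := LinearMap.congr_fun (map_smul (BalTensor.envHom k A X Y) c e) t

/-- A linear map on `X ⊗_A Y` that is compatible with the two actions, as a map of bimodules. -/
noncomputable def BalTensor.toEnvLinear {Z : Type*} [AddCommGroup Z] [Module k Z]
    [Module (Env k A) Z] (φ : BalTensor k A X Y →ₗ[k] Z)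
    (hφ : ∀ a b t, φ (BalTensor.act X Y a b t) = (a ⊗ₜ[k] MulOpposite.op b : Env k A) • φ t) :
    BalTensor k A X Y →ₗ[Env k A] Z where
  toFun := φ
  map_add' := map_add φ
  map_smul' e t := map_env_smul φ.toAddMonoidHom
    (fun a b t => (congrArg φ (BalTensor.env_smul a b t)).trans (hφ a b t)) e t

theorem BalTensor.rTensor_act (f : X →ₗ[Env k A] X') (a b : A) (t : BalTensor k A X Y) :
    BalTensor.rTensor Y f (BalTensor.act X Y a b t) =
      (a ⊗ₜ[k] MulOpposite.op b : Env k A) • BalTensor.rTensor Y f t := by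
  rw [env_smul]
  induction t using BalTensor.induction_on with
  | add s t hs ht => simp only [map_add, hs, ht]
  | tmul x y => simp [map_lact]

theorem BalTensor.lTensor_act (f : Y →ₗ[Env k A] Y') (a b : A) (t : BalTensor k A X Y) :
    BalTensor.lTensor X f (BalTensor.act X Y a b t) =
      (a ⊗ₜ[k] MulOpposite.op b : Env k A) • BalTensor.lTensor X f t := by
  rw [env_smul]
  induction t using BalTensor.induction_on with
  | add s t hs ht => simp only [map_add, hs, ht]
  | tmul x y => simp [map_ract]

/-! ### Exactness of `X ⊗_A Y` -/

variable (X) in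
/-- The map `Aᵉ → Hom(X, X ⊗ A)`, `a ⊗ b ↦ (x ↦ x a ⊗ b)`. -/
noncomputable def ractTmul : Env k A →ₗ[k] X →ₗ[k] X ⊗[k] A :=
  TensorProduct.lift <| LinearMap.mk₂ k
    (fun a b => (TensorProduct.mk k X A).flip b.unop ∘ₗ ract k X a)
    (fun a a' b => by
      change _ ∘ₗ ractHom k A X (a + a') = _ ∘ₗ ractHom k A X a + _ ∘ₗ ractHom k A X a'
      rw [map_add, LinearMap.comp_add])
    (fun c a b => by
      change _ ∘ₗ ractHom k A X (c • a) = c • _ ∘ₗ ractHom k A X a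
      rw [map_smul, LinearMap.comp_smul])
    (fun a b b' => by rw [MulOpposite.unop_add, map_add, LinearMap.add_comp])
    (fun c a b => by rw [MulOpposite.unop_smul, map_smul, LinearMap.smul_comp])

theorem ractTmul_tmul (a b : A) (x : X) :
    ractTmul X (a ⊗ₜ[k] MulOpposite.op b) x = ract k X a x ⊗ₜ b := rfl

variable (Y) in
/-- The map `Aᵉ → Hom(Y, A ⊗ Y)`, `a ⊗ b ↦ (y ↦ a ⊗ b y)`. -/
noncomputable def tmulLact : Env k A →ₗ[k] Y →ₗ[k] A ⊗[k] Y :=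
  TensorProduct.lift <| LinearMap.mk₂ k
    (fun a b => (TensorProduct.mk k A Y a) ∘ₗ lact k Y b.unop)
    (fun a a' b => by rw [map_add, LinearMap.add_comp])
    (fun c a b => by rw [map_smul, LinearMap.smul_comp])
    (fun a b b' => by
      change _ ∘ₗ lactHom k A Y (b.unop + b'.unop) =
        _ ∘ₗ lactHom k A Y b.unop + _ ∘ₗ lactHom k A Y b'.unop
      rw [map_add, LinearMap.comp_add])
    (fun c a b => by
      change _ ∘ₗ lactHom k A Y (c • b.unop) = c • _ ∘ₗ lactHom k A Y b.unop
      rw [map_smul, LinearMap.comp_smul])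

theorem tmulLact_tmul (a b : A) (y : Y) :
    tmulLact Y (a ⊗ₜ[k] MulOpposite.op b) y = a ⊗ₜ lact k Y b y := rfl

theorem ractTmul_ract (e : Env k A) (a : A) (x : X) :
    ractTmul X e (ract k X a x) = ractTmul X ((a ⊗ₜ[k] 1) * e) x := by
  induction e using TensorProduct.induction_on with
  | zero => simp
  | add s t hs ht => simp only [mul_add, map_add, LinearMap.add_apply, hs, ht]
  | tmul p q =>
    obtain ⟨q, rfl⟩ := MulOpposite.op_surjective q
    rw [Algebra.TensorProduct.tmul_mul_tmul, one_mul, ractTmul_tmul, ractTmul_tmul, ract_ract]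

theorem tmulLact_lact (e : Env k A) (a : A) (y : Y) :
    tmulLact Y e (lact k Y a y) = tmulLact Y ((1 ⊗ₜ[k] MulOpposite.op a) * e) y := by
  induction e using TensorProduct.induction_on with
  | zero => simp
  | add s t hs ht => simp only [mul_add, map_add, LinearMap.add_apply, hs, ht]
  | tmul p q =>
    obtain ⟨q, rfl⟩ := MulOpposite.op_surjective q
    rw [Algebra.TensorProduct.tmul_mul_tmul, one_mul, ← MulOpposite.op_mul, tmulLact_tmul,
      tmulLact_tmul, lact_lact]

variable (X) in
/-- The map `X ⊗_A Y → X ⊗ A` given by a functional `r` on `Y`. -/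
noncomputable def BalTensor.coordRight (r : Y →ₗ[Env k A] Env k A) :
    BalTensor k A X Y →ₗ[k] X ⊗[k] A :=
  BalTensor.lift ((ractTmul X).comp (r.restrictScalars k)).flip fun a x y => by
    change ractTmul X (r y) (ract k X a x) = ractTmul X (r ((a ⊗ₜ[k] 1 : Env k A) • y)) x
    rw [ractTmul_ract, map_smul, smul_eq_mul]

variable (Y) in
/-- The map `X ⊗_A Y → A ⊗ Y` given by a functional `r` on `X`. -/
noncomputable def BalTensor.coordLeft (r : X →ₗ[Env k A] Env k A) :
    BalTensor k A X Y →ₗ[k] A ⊗[k] Y :=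
  BalTensor.lift ((tmulLact Y).comp (r.restrictScalars k)) fun a x y => by
    change tmulLact Y (r ((1 ⊗ₜ[k] MulOpposite.op a : Env k A) • x)) y =
      tmulLact Y (r x) (lact k Y a y)
    rw [tmulLact_lact, map_smul, smul_eq_mul]

variable (X) in
/-- The map `X ⊗ A → X ⊗_A Y`, `x ⊗ b ↦ x ⊗ r b`. -/
noncomputable def BalTensor.ofRight (r : Y) : X ⊗[k] A →ₗ[k] BalTensor k A X Y :=
  TensorProduct.lift ((BalTensor.mk k A X Y).compl₂ ((ractHom k A Y).flip r))

variable (Y) in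
/-- The map `A ⊗ Y → X ⊗_A Y`, `a ⊗ y ↦ a r ⊗ y`. -/
noncomputable def BalTensor.ofLeft (r : X) : A ⊗[k] Y →ₗ[k] BalTensor k A X Y :=
  TensorProduct.lift ((BalTensor.mk k A X Y).comp ((lactHom k A X).flip r))

/-- As `X ⊗_A Aᵉ` is `X ⊗ A`, a dual basis of `Y` makes `X ⊗_A Y` a retract, natural in `X`, of
finitely many copies of `X ⊗ A`. -/
theorem BalTensor.sum_ofRight_coordRight {n : ℕ} {r : Fin n → Y} {r' : Fin n → Y →ₗ[Env k A] Env k A}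
    (hr : ∀ y, ∑ c, r' c y • r c = y) (t : BalTensor k A X Y) :
    ∑ c, BalTensor.ofRight X (r c) (BalTensor.coordRight X (r' c) t) = t := by
  induction t using BalTensor.induction_on with
  | add s t hs ht => simp only [map_add, Finset.sum_add_distrib, hs, ht]
  | tmul x y =>
    have h : ∀ (e : Env k A) (q : Y), BalTensor.ofRight X q (ractTmul X e x) =
        BalTensor.mk k A X Y x (e • q) := fun e q => by
      induction e using TensorProduct.induction_on with
      | zero =>
        have h0 : (0 : Env k A) • q = 0 := zero_smul (Env k A) q
        rw [map_zero, LinearMap.zero_apply, map_zero]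
        exact ((congrArg _ h0).trans (map_zero _)).symm
      | add s t hs ht => simp only [map_add, LinearMap.add_apply, add_smul, hs, ht]
      | tmul a b =>
        obtain ⟨b, rfl⟩ := MulOpposite.op_surjective b
        rw [tmul_smul_eq]
        exact BalTensor.ract_tmul a x (ract k Y b q)
    conv_rhs => rw [← hr y]
    refine Eq.trans (Finset.sum_congr rfl fun c _ => h (r' c y) (r c)) ?_
    rw [← map_sum]
    rfl

theorem BalTensor.sum_ofLeft_coordLeft {n : ℕ} {r : Fin n → X} {r' : Fin n → X →ₗ[Env k A] Env k A}
    (hr : ∀ y, ∑ c, r' c y • r c = y) (t : BalTensor k A X Y) :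
    ∑ c, BalTensor.ofLeft Y (r c) (BalTensor.coordLeft Y (r' c) t) = t := by
  induction t using BalTensor.induction_on with
  | add s t hs ht => simp only [map_add, Finset.sum_add_distrib, hs, ht]
  | tmul x y =>
    have h : ∀ (e : Env k A) (q : X), BalTensor.ofLeft Y q (tmulLact Y e y) =
        (BalTensor.mk k A X Y).flip y (e • q) := fun e q => by
      induction e using TensorProduct.induction_on with
      | zero =>
        have h0 : (0 : Env k A) • q = 0 := zero_smul (Env k A) q
        rw [map_zero, LinearMap.zero_apply, map_zero]
        exact ((congrArg _ h0).trans (map_zero _)).symm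
      | add s t hs ht => simp only [map_add, LinearMap.add_apply, add_smul, hs, ht]
      | tmul a b =>
        obtain ⟨b, rfl⟩ := MulOpposite.op_surjective b
        rw [tmul_smul_eq, lact_ract]
        exact (BalTensor.ract_tmul b (lact k X a q) y).symm
    conv_rhs => rw [← hr x]
    refine Eq.trans (Finset.sum_congr rfl fun c _ => h (r' c x) (r c)) ?_
    rw [← map_sum]
    rfl

theorem BalTensor.coordRight_rTensor (r : Y →ₗ[Env k A] Env k A) (f : X →ₗ[Env k A] X')
    (t : BalTensor k A X Y) : BalTensor.coordRight X' r (BalTensor.rTensor Y f t) =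
      LinearMap.rTensor A (f.restrictScalars k) (BalTensor.coordRight X r t) := by
  induction t using BalTensor.induction_on with
  | add s t hs ht => simp only [map_add, hs, ht]
  | tmul x y =>
    change ractTmul X' (r y) (f x) = LinearMap.rTensor A (f.restrictScalars k) (ractTmul X (r y) x)
    induction r y using TensorProduct.induction_on with
    | zero => simp
    | add s t hs ht => simp only [map_add, LinearMap.add_apply, hs, ht]
    | tmul a b =>
      obtain ⟨b, rfl⟩ := MulOpposite.op_surjective b
      rw [ractTmul_tmul, ractTmul_tmul, ← map_ract]
      rfl

theorem BalTensor.coordLeft_lTensor (r : X →ₗ[Env k A] Env k A) (f : Y →ₗ[Env k A] Y')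
    (t : BalTensor k A X Y) : BalTensor.coordLeft Y' r (BalTensor.lTensor X f t) =
      LinearMap.lTensor A (f.restrictScalars k) (BalTensor.coordLeft Y r t) := by
  induction t using BalTensor.induction_on with
  | add s t hs ht => simp only [map_add, hs, ht]
  | tmul x y =>
    change tmulLact Y' (r x) (f y) = LinearMap.lTensor A (f.restrictScalars k) (tmulLact Y (r x) y)
    induction r x using TensorProduct.induction_on with
    | zero => simp
    | add s t hs ht => simp only [map_add, LinearMap.add_apply, hs, ht]
    | tmul a b =>
      obtain ⟨b, rfl⟩ := MulOpposite.op_surjective b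
      rw [tmulLact_tmul, tmulLact_tmul, ← map_lact]
      rfl

theorem BalTensor.rTensor_ofRight (r : Y) (f : X →ₗ[Env k A] X') (t : X ⊗[k] A) :
    BalTensor.rTensor Y f (BalTensor.ofRight X r t) =
      BalTensor.ofRight X' r (LinearMap.rTensor A (f.restrictScalars k) t) := by
  induction t using TensorProduct.induction_on with
  | zero => simp
  | add s t hs ht => simp only [map_add, hs, ht]
  | tmul x b => rfl

theorem BalTensor.lTensor_ofLeft (r : X) (f : Y →ₗ[Env k A] Y') (t : A ⊗[k] Y) :
    BalTensor.lTensor X f (BalTensor.ofLeft Y r t) =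
      BalTensor.ofLeft Y' r (LinearMap.lTensor A (f.restrictScalars k) t) := by
  induction t using TensorProduct.induction_on with
  | zero => simp
  | add s t hs ht => simp only [map_add, hs, ht]
  | tmul x b => rfl

/-- Exactness is inherited from the tensor product with `A` over the field: the coordinates of a
cycle bound there, and the retraction carries the bounding elements back. -/
theorem BalTensor.rTensor_exact (Y : Type*) [AddCommGroup Y] [Module k Y] [Module (Env k A) Y]
    [IsScalarTower k (Env k A) Y] [Module.Finite (Env k A) Y]
    [Module.Projective (Env k A) Y] {f : X →ₗ[Env k A] X'} {g : X' →ₗ[Env k A] X''}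
    (h : Function.Exact f g) :
    Function.Exact (BalTensor.rTensor Y f) (BalTensor.rTensor Y g) := by
  obtain ⟨n, r, r', hr⟩ := exists_dual_basis (R := Env k A) Y
  intro t
  constructor
  · intro ht
    have h1 : ∀ c, ∃ s, LinearMap.rTensor A (f.restrictScalars k) s =
        BalTensor.coordRight X' (r' c) t := fun c =>
      (Module.Flat.rTensor_exact A (f := f.restrictScalars k) (g := g.restrictScalars k) h _).1
        (by rw [← coordRight_rTensor, ht, map_zero])
    choose s hs using h1
    refine ⟨∑ c, BalTensor.ofRight X (r c) (s c), ?_⟩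
    simp only [map_sum, rTensor_ofRight, hs]
    exact sum_ofRight_coordRight hr t
  · rintro ⟨s, rfl⟩
    induction s using BalTensor.induction_on with
    | add s t hs ht => rw [map_add, map_add, hs, ht, add_zero]
    | tmul x y =>
      rw [rTensor_tmul, rTensor_tmul, h.apply_apply_eq_zero]
      exact LinearMap.congr_fun (map_zero (BalTensor.mk k A X'' Y)) y

theorem BalTensor.lTensor_exact (X : Type*) [AddCommGroup X] [Module k X] [Module (Env k A) X]
    [IsScalarTower k (Env k A) X] [Module.Finite (Env k A) X]
    [Module.Projective (Env k A) X] {f : Y →ₗ[Env k A] Y'} {g : Y' →ₗ[Env k A] Y''}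
    (h : Function.Exact f g) :
    Function.Exact (BalTensor.lTensor X f) (BalTensor.lTensor X g) := by
  obtain ⟨n, r, r', hr⟩ := exists_dual_basis (R := Env k A) X
  intro t
  constructor
  · intro ht
    have h1 : ∀ c, ∃ s, LinearMap.lTensor A (f.restrictScalars k) s =
        BalTensor.coordLeft Y' (r' c) t := fun c =>
      (Module.Flat.lTensor_exact A (f := f.restrictScalars k) (g := g.restrictScalars k) h _).1
        (by rw [← coordLeft_lTensor, ht, map_zero])
    choose s hs using h1
    refine ⟨∑ c, BalTensor.ofLeft Y (r c) (s c), ?_⟩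
    simp only [map_sum, lTensor_ofLeft, hs]
    exact sum_ofLeft_coordLeft hr t
  · rintro ⟨s, rfl⟩
    induction s using BalTensor.induction_on with
    | add s t hs ht => rw [map_add, map_add, hs, ht, add_zero]
    | tmul x y =>
      rw [lTensor_tmul, lTensor_tmul, h.apply_apply_eq_zero]
      exact map_zero (BalTensor.mk k A X Y'' x)

/-- This is injectivity of `A ⊗_A Y → Y`, with left inverse `y ↦ 1 ⊗ y`. -/
theorem BalTensor.lcontract_id_eq_zero {t : BalTensor k A (Regular k A) Y}
    (h : BalTensor.lcontract Y (LinearMap.id : Regular k A →ₗ[Env k A] _) t = 0) : t = 0 := by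
  have key : ∀ t, BalTensor.mk k A (Regular k A) Y (1 : A) (BalTensor.lcontract Y LinearMap.id t) = t := by
    intro t
    induction t using BalTensor.induction_on with
    | add s t hs ht => simp only [map_add, hs, ht]
    | tmul x y =>
      refine (BalTensor.ract_tmul (Regular.toA k A x) _ y).symm.trans ?_
      congr 1
      exact (Regular.toA_ract (Regular.toA k A x) _).trans (one_mul (M := A) x)
  rw [← key t, h, map_zero]

theorem BalTensor.rcontract_id_eq_zero {t : BalTensor k A X (Regular k A)}
    (h : BalTensor.rcontract X (LinearMap.id : Regular k A →ₗ[Env k A] _) t = 0) : t = 0 := by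
  have key : ∀ t, (BalTensor.mk k A X (Regular k A)).flip (1 : A)
      (BalTensor.rcontract X LinearMap.id t) = t := by
    intro t
    induction t using BalTensor.induction_on with
    | add s t hs ht => simp only [map_add, hs, ht]
    | tmul x y =>
      refine (BalTensor.ract_tmul (Regular.toA k A y) x _).trans ?_
      congr 1
      exact (Regular.toA_lact (Regular.toA k A y) _).trans (mul_one (M := A) y)
  rw [← key t, h, map_zero]

theorem BalTensor.lcontract_exact (Y : Type*) [AddCommGroup Y] [Module k Y] [Module (Env k A) Y]
    [IsScalarTower k (Env k A) Y] [Module.Finite (Env k A) Y]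
    [Module.Projective (Env k A) Y] {f : X →ₗ[Env k A] X'} {g : X' →ₗ[Env k A] Regular k A}
    (h : Function.Exact f g) :
    Function.Exact (BalTensor.rTensor Y f) (BalTensor.lcontract Y g) := fun t => by
  have hg : BalTensor.lcontract Y LinearMap.id (BalTensor.rTensor Y g t) =
    BalTensor.lcontract Y g t := lcontract_rTensor LinearMap.id g t
  refine Iff.trans ?_ (rTensor_exact Y h t)
  rw [← hg]
  exact ⟨lcontract_id_eq_zero, fun h => by rw [h, map_zero]⟩

theorem BalTensor.rcontract_exact (X : Type*) [AddCommGroup X] [Module k X] [Module (Env k A) X]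
    [IsScalarTower k (Env k A) X] [Module.Finite (Env k A) X]
    [Module.Projective (Env k A) X] {f : Y →ₗ[Env k A] Y'} {g : Y' →ₗ[Env k A] Regular k A}
    (h : Function.Exact f g) :
    Function.Exact (BalTensor.lTensor X f) (BalTensor.rcontract X g) := fun t => by
  have hg : BalTensor.rcontract X LinearMap.id (BalTensor.lTensor X g t) =
    BalTensor.rcontract X g t := rcontract_lTensor LinearMap.id g t
  refine Iff.trans ?_ (lTensor_exact X h t)
  rw [← hg]
  exact ⟨rcontract_id_eq_zero, fun h => by rw [h, map_zero]⟩

theorem BalTensor.lcontract_surjective (Y : Type*) [AddCommGroup Y] [Module k Y]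
    [Module (Env k A) Y] [IsScalarTower k (Env k A) Y] {g : X →ₗ[Env k A] Regular k A}
    (h : Function.Surjective g) : Function.Surjective (BalTensor.lcontract Y g) := fun y => by
  obtain ⟨m, hm⟩ := h (1 : A)
  refine ⟨BalTensor.tmul k A m y, ?_⟩
  rw [lcontract_tmul, hm]
  exact lact_one y

theorem BalTensor.rcontract_surjective (X : Type*) [AddCommGroup X] [Module k X]
    [Module (Env k A) X] [IsScalarTower k (Env k A) X] {g : Y →ₗ[Env k A] Regular k A}
    (h : Function.Surjective g) : Function.Surjective (BalTensor.rcontract X g) := fun x => by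
  obtain ⟨m, hm⟩ := h (1 : A)
  refine ⟨BalTensor.tmul k A x m, ?_⟩
  rw [rcontract_tmul, hm]
  exact ract_one x

end BalTensor

/-! ### Acyclicity of `X ⊗_A Y` and diagonal approximations for the regular bimodule -/

section BalTensorAcyclic

variable {k : Type u} {A : Type v} [Field k] [Ring A] [HopfAlgebra k A]

/-- The map `Aᵉ → Aᵒᵖ`, `a ⊗ b ↦ f(a) b`. -/
noncomputable def envCoord (f : A →ₗ[k] k) : Env k A →ₗ[k] Aᵐᵒᵖ :=
  TensorProduct.lift ((LinearMap.lsmul k Aᵐᵒᵖ).comp f)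

theorem envCoord_tmul (f : A →ₗ[k] k) (a : A) (b : Aᵐᵒᵖ) : envCoord f (a ⊗ₜ b) = f a • b := rfl

theorem envCoord_op_mul (f : A →ₗ[k] k) (b : Aᵐᵒᵖ) (e : Env k A) :
    envCoord f ((1 ⊗ₜ[k] b) * e) = b * envCoord f e := by
  induction e using TensorProduct.induction_on with
  | zero => rw [mul_zero, map_zero, mul_zero]
  | add s t hs ht => rw [mul_add, map_add, map_add, hs, ht, mul_add]
  | tmul p q =>
    rw [Algebra.TensorProduct.tmul_mul_tmul, envCoord_tmul, envCoord_tmul, one_mul, mul_smul_comm]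

variable {X Y : Type*} [AddCommGroup X] [AddCommGroup Y] [Module k X] [Module k Y]
  [Module (Env k A) X] [Module (Env k A) Y]
  [IsScalarTower k (Env k A) X] [IsScalarTower k (Env k A) Y]

theorem BalTensor.coordLeft_act (r : X →ₗ[Env k A] Env k A) (a b : A) (t : BalTensor k A X Y) :
    BalTensor.coordLeft Y r (BalTensor.act X Y a b t) =
      TensorProduct.map (LinearMap.mulLeft k a) (ract k Y b) (BalTensor.coordLeft Y r t) := by
  induction t using BalTensor.induction_on with
  | add s t hs ht => simp only [map_add, hs, ht]
  | tmul x y =>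
    change tmulLact Y (r ((a ⊗ₜ[k] 1 : Env k A) • x)) (ract k Y b y) =
      TensorProduct.map _ _ (tmulLact Y (r x) y)
    rw [map_smul, smul_eq_mul]
    induction r x using TensorProduct.induction_on with
    | zero => rw [mul_zero, map_zero, LinearMap.zero_apply, LinearMap.zero_apply, map_zero]
    | add s t hs ht => simp only [mul_add, map_add, LinearMap.add_apply, hs, ht]
    | tmul p q =>
      obtain ⟨q, rfl⟩ := MulOpposite.op_surjective q
      rw [Algebra.TensorProduct.tmul_mul_tmul, one_mul, tmulLact_tmul, tmulLact_tmul, lact_ract]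
      rfl

/-- The functional on `X ⊗_A Y` given by functionals on `X`, `Y` and `A`. -/
noncomputable def BalTensor.functional (r : X →ₗ[Env k A] Env k A) (q : Y →ₗ[Env k A] Env k A)
    (f : A →ₗ[k] k) : BalTensor k A X Y →ₗ[Env k A] Env k A :=
  BalTensor.toEnvLinear
    (LinearMap.lTensor A (envCoord f ∘ₗ q.restrictScalars k) ∘ₗ BalTensor.coordLeft Y r)
    fun a b t => by
      rw [LinearMap.comp_apply, coordLeft_act, LinearMap.comp_apply]
      induction BalTensor.coordLeft Y r t using TensorProduct.induction_on with
      | zero => rw [map_zero, map_zero, smul_zero]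
      | add s t hs ht => rw [map_add, map_add, map_add, hs, ht, smul_add]
      | tmul p y =>
        have h : envCoord f (q ((1 ⊗ₜ[k] MulOpposite.op b : Env k A) • y)) =
            MulOpposite.op b * envCoord f (q y) := by
          rw [map_smul, smul_eq_mul, envCoord_op_mul]
        exact (congrArg (fun z => (a * p) ⊗ₜ[k] z) h).trans
          (Algebra.TensorProduct.tmul_mul_tmul a p (MulOpposite.op b) _).symm

/-- Expanding the left tensor factor of `w` in the basis `e` recovers the action of `w` from its
`Aᵒᵖ`-valued coordinates. -/
theorem sum_ract_envCoord {κ : Type*} [Fintype κ] (e : Module.Basis κ k A) (w : Env k A) (y : Y) :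
    ∑ s, ract k Y (envCoord (e.coord s) w).unop (lact k Y (e s) y) = w • y := by
  induction w using TensorProduct.induction_on with
  | zero =>
    have h0 : (0 : Env k A) • y = 0 := zero_smul (Env k A) y
    refine (Finset.sum_eq_zero fun s _ => ?_).trans h0.symm
    rw [map_zero]
    exact LinearMap.congr_fun (map_zero (ractHom k A Y)) _
  | add s t hs ht =>
    rw [add_smul, ← hs, ← ht, ← Finset.sum_add_distrib]
    refine Finset.sum_congr rfl fun s _ => ?_
    rw [map_add]
    exact LinearMap.congr_fun (map_add (ractHom k A Y) _ _) _
  | tmul a b =>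
    obtain ⟨b, rfl⟩ := MulOpposite.op_surjective b
    rw [tmul_smul_eq, lact_ract]
    change _ = ractHom k A Y b (lactHom k A Y a y)
    conv_rhs => rw [← e.sum_repr a, map_sum, LinearMap.sum_apply, map_sum]
    refine Finset.sum_congr rfl fun s _ => ?_
    rw [envCoord_tmul, map_smul, LinearMap.smul_apply, map_smul]
    exact LinearMap.congr_fun (map_smul (ractHom k A Y) _ b) _

theorem BalTensor.sum_envCoord_smul {κ : Type*} [Fintype κ] (e : Module.Basis κ k A) {m : ℕ}
    {q : Fin m → Y} {q' : Fin m → Y →ₗ[Env k A] Env k A} (hq : ∀ y, ∑ c, q' c y • q c = y)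
    (x : X) (z : A ⊗[k] Y) :
    ∑ p : Fin m × κ, (LinearMap.lTensor A (envCoord (e.coord p.2) ∘ₗ (q' p.1).restrictScalars k) z :
        Env k A) • BalTensor.tmul k A x (lact k Y (e p.2) (q p.1)) = BalTensor.ofLeft Y x z := by
  induction z using TensorProduct.induction_on with
  | zero =>
    rw [map_zero]
    refine Finset.sum_eq_zero fun p _ => ?_
    rw [map_zero]
    exact zero_smul (Env k A) (BalTensor.tmul k A x (lact k Y (e p.2) (q p.1)))
  | add s t hs ht =>
    rw [map_add, ← hs, ← ht, ← Finset.sum_add_distrib]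
    refine Finset.sum_congr rfl fun p _ => ?_
    rw [map_add]
    exact add_smul (R := Env k A) _ _ (BalTensor.tmul k A x (lact k Y (e p.2) (q p.1)))
  | tmul a y =>
    have h : ∀ p : Fin m × κ,
        (LinearMap.lTensor A (envCoord (e.coord p.2) ∘ₗ (q' p.1).restrictScalars k)
          (a ⊗ₜ y) : Env k A) • BalTensor.tmul k A x (lact k Y (e p.2) (q p.1)) =
        BalTensor.mk k A X Y (lact k X a x)
          (ract k Y (envCoord (e.coord p.2) (q' p.1 y)).unop (lact k Y (e p.2) (q p.1))) :=
      fun p => BalTensor.env_smul a (envCoord (e.coord p.2) (q' p.1 y)).unop _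
    rw [Finset.sum_congr rfl fun p _ => h p, ← map_sum, Fintype.sum_prod_type]
    simp only [sum_ract_envCoord, hq]
    rfl

/-- `Aᵉ ⊗_A Aᵉ` is a sum of copies of `Aᵉ` indexed by a basis of the middle factor `A`. Combined
with dual bases of `X` and `Y`, this makes `X ⊗_A Y` a retract of a finite free `Aᵉ`-module. -/
theorem BalTensor.homAcyclic [FiniteDimensional k A] [Module.Finite (Env k A) X]
    [Module.Projective (Env k A) X] [Module.Finite (Env k A) Y] [Module.Projective (Env k A) Y]
    {R : Type*} [Ring R] {σ : R →+* Env k A} {S : ℤ → Type*} [∀ i, AddCommGroup (S i)]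
    [∀ i, Module R (S i)] {dS : ∀ i j, S i →ₗ[R] S j} (h : HomAcyclic σ dS (Env k A)) :
    HomAcyclic σ dS (BalTensor k A X Y) := by
  obtain ⟨n, r, r', hr⟩ := exists_dual_basis (R := Env k A) X
  obtain ⟨m, q, q', hq⟩ := exists_dual_basis (R := Env k A) Y
  let e := Module.finBasis k A
  refine h.of_retract (κ := Fin n × Fin m × Fin (Module.finrank k A))
    (fun c => BalTensor.functional (r' c.1) (q' c.2.1) (e.coord c.2.2))
    (fun c => LinearMap.toSpanSingleton (Env k A) (BalTensor k A X Y)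
      (BalTensor.tmul k A (r c.1) (lact k Y (e c.2.2) (q c.2.1)))) fun t => ?_
  rw [Fintype.sum_prod_type]
  refine Eq.trans (Finset.sum_congr rfl fun c _ => ?_) (sum_ofLeft_coordLeft hr t)
  exact sum_envCoord_smul e hq (r c) (coordLeft Y (r' c) t)

/-- Diagonal approximations of complete resolutions of the regular bimodule exist. -/
theorem BimoduleDiagonalApprox.nonempty [FiniteDimensional k A] (X : BimoduleResolution k A) :
    Nonempty (BimoduleDiagonalApprox X) := by
  have hf := X.finite
  have hp := X.projective
  obtain ⟨Γ, hΓ, hΓ0⟩ := exists_diagonal (T := fun i j => BalTensor k A (X.cx.X i) (X.cx.X j))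
    hp X.isAugmented
    (fun i i' j => BalTensor.toEnvLinear (BalTensor.rTensor (X.cx.X j) (X.d i i'))
      (BalTensor.rTensor_act _))
    (fun i j j' => BalTensor.toEnvLinear (BalTensor.lTensor (X.cx.X i) (X.d j j'))
      (BalTensor.lTensor_act _))
    (fun i i' j j' t => LinearMap.congr_fun (f := BalTensor.rTensor (X.cx.X j') (X.d i i') ∘ₗ
        BalTensor.lTensor (X.cx.X i) (X.d j j')) (g := BalTensor.lTensor (X.cx.X i') (X.d j j') ∘ₗ
        BalTensor.rTensor (X.cx.X j) (X.d i i')) (BalTensor.hom_ext fun _ _ => rfl) t)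
    (fun j i i' i'' h h' => BalTensor.rTensor_exact (X.cx.X j) (X.isAugmented.exact i i' i'' h h'))
    (fun i => BalTensor.toEnvLinear (BalTensor.rcontract (X.cx.X i) X.aug)
      (BalTensor.rcontract_act _))
    (fun i =>
      { exact := fun j j' j'' h h' =>
          BalTensor.lTensor_exact (X.cx.X i) (X.isAugmented.exact j j' j'' h h')
        surjective := BalTensor.rcontract_surjective _ X.aug_surjective
        exact_zero := BalTensor.rcontract_exact _ X.aug_exact })
    (fun i j => BalTensor.homAcyclic X.homAcyclic) (fun i => X.homAcyclic_self _)
    (fun j => BalTensor.toEnvLinear (BalTensor.lcontract (X.cx.X j) X.aug)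
      (BalTensor.lcontract_act _))
    (fun j => BalTensor.lcontract_surjective _ X.aug_surjective)
    (fun j j' t => BalTensor.lcontract_lTensor X.aug (X.d j j') t)
    (fun j t ht => by
      obtain ⟨s, rfl⟩ := (BalTensor.lcontract_exact (X.cx.X j) X.aug_exact t).1 ht
      exact (BalTensor.rTensor_exact (X.cx.X j)
        (X.isAugmented.exact 1 0 (-1) rfl rfl)).apply_apply_eq_zero s)
  exact ⟨{
    comp := fun i j n h => (Γ i j n h).restrictScalars k
    equivariant := fun i j n h a b x =>
      (map_smul (Γ i j n h) _ x).trans (BalTensor.env_smul a b _)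
    chain := fun i j n h x => hΓ i (i + 1) j (j + 1) n (n + 1) rfl rfl rfl h _ _ x
    augmentation := fun x =>
      (BalTensor.mul_eq_lcontract X.aug X.aug _).trans (congrArg X.aug (hΓ0 x)) }⟩

end BalTensorAcyclic

section Frobenius

variable {k : Type u} {A : Type v} [Field k] [Ring A] [HopfAlgebra k A]

open Coalgebra HopfAlgebra

/-! ### Integrals -/

variable (k A) in
/-- The dual of `A`, with `(a ξ)(y) = ξ(S(a) y)`. -/
def DualRep : Type _ := A →ₗ[k] k

instance : AddCommGroup (DualRep k A) := inferInstanceAs (AddCommGroup (A →ₗ[k] k))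

instance : Module k (DualRep k A) := inferInstanceAs (Module k (A →ₗ[k] k))

variable (k A) in
/-- Evaluation at `y`. -/
def DualRep.eval (y : A) : DualRep k A →ₗ[k] k := LinearMap.applyₗ (R := k) y

theorem DualRep.ext {ξ η : DualRep k A} (h : ∀ y, eval k A y ξ = eval k A y η) : ξ = η :=
  LinearMap.ext h

noncomputable instance : SMul A (DualRep k A) where
  smul a ξ := LinearMap.comp (R₁ := k) ξ (LinearMap.mulLeft k (antipode k a))

theorem DualRep.eval_smul (a y : A) (ξ : DualRep k A) :
    eval k A y (a • ξ) = eval k A (antipode k a * y) ξ := rfl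

theorem DualRep.eval_add (x y : A) (ξ : DualRep k A) :
    eval k A (x + y) ξ = eval k A x ξ + eval k A y ξ := LinearMap.map_add (R := k) ξ x y

noncomputable instance : Module A (DualRep k A) where
  one_smul ξ := DualRep.ext fun y => by rw [DualRep.eval_smul, antipode_one, one_mul]
  mul_smul a b ξ := DualRep.ext fun y => by
    rw [DualRep.eval_smul, DualRep.eval_smul, DualRep.eval_smul, antipode_mul_antidistrib,
      mul_assoc]
  smul_zero a := DualRep.ext fun y => by rw [DualRep.eval_smul, map_zero, map_zero]
  smul_add a ξ η := DualRep.ext fun y => by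
    simp only [DualRep.eval_smul, map_add]
  add_smul a b ξ := DualRep.ext fun y => by
    rw [DualRep.eval_smul, map_add, add_mul, DualRep.eval_add, map_add]
    rfl
  zero_smul ξ := DualRep.ext fun y => by
    rw [DualRep.eval_smul, map_zero, zero_mul, map_zero]
    exact LinearMap.map_zero (R := k) ξ

instance : IsScalarTower k A (DualRep k A) where
  smul_assoc c a ξ := DualRep.ext fun y => by
    rw [DualRep.eval_smul, map_smul, smul_mul_assoc, map_smul]
    exact LinearMap.map_smul (R := k) ξ c (antipode k a * y)

variable (k A) in
/-- The map `A ⊗ A* → A`, `a ⊗ ξ ↦ ξ(y) a`. -/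
noncomputable def DualRep.contract (y : A) : A ⊗[k] DualRep k A →ₗ[k] A :=
  TensorProduct.lift ((LinearMap.lsmul k A).comp (DualRep.eval k A y)).flip

theorem DualRep.contract_tmul (y a : A) (ξ : DualRep k A) :
    contract k A y (a ⊗ₜ ξ) = eval k A y ξ • a := rfl

theorem DualRep.contract_lsmul (y a : A) (t : A ⊗[k] DualRep k A) :
    contract k A y (a • t) = a * contract k A y t := by
  induction t using TensorProduct.induction_on with
  | zero => simp
  | add s t hs ht => simp only [smul_add, map_add, mul_add, hs, ht]
  | tmul b ξ =>
    rw [TensorProduct.smul_tmul', contract_tmul, contract_tmul, smul_eq_mul, mul_smul_comm]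

theorem DualRep.contract_diagAct (y a : A) (t : A ⊗[k] DualRep k A) :
    contract k A y (diagAct A (DualRep k A) a t) =
      ∑ i ∈ (ℛ k a).index, (ℛ k a).left i *
        contract k A (antipode k ((ℛ k a).right i) * y) t := by
  induction t using TensorProduct.induction_on with
  | zero => simp
  | add s t hs ht => simp only [map_add, mul_add, Finset.sum_add_distrib, hs, ht]
  | tmul b ξ =>
    rw [diagAct_tmul a (ℛ k a), map_sum]
    refine Finset.sum_congr rfl fun i _ => ?_
    rw [contract_tmul, contract_tmul, eval_smul, mul_smul_comm, smul_eq_mul]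

/-- In finite dimension `A ⊗ A*` is the space of endomorphisms of `A`, and contraction is evaluation
of the endomorphism. -/
theorem DualRep.eq_zero_of_contract [FiniteDimensional k A] {t : A ⊗[k] DualRep k A}
    (h : ∀ y, contract k A y t = 0) : t = 0 := by
  let e := Module.finBasis k A
  let u : Fin (Module.finrank k A) → DualRep k A := fun s => e.coord s
  have key : ∀ t : A ⊗[k] DualRep k A, ∑ s, contract k A (e s) t ⊗ₜ[k] u s = t := fun t => by
    induction t using TensorProduct.induction_on with
    | zero => simp
    | add s t hs ht => simp only [map_add, TensorProduct.add_tmul, Finset.sum_add_distrib, hs, ht]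
    | tmul b ξ =>
      simp only [contract_tmul, TensorProduct.smul_tmul, ← TensorProduct.tmul_sum]
      congr 1
      exact e.sum_dual_apply_smul_coord ξ
  rw [← key t]
  exact Finset.sum_eq_zero fun s _ => by rw [h, TensorProduct.zero_tmul]

variable (k A) in
/-- A nonzero finite dimensional Hopf algebra has a nonzero left integral. -/
theorem exists_integral [FiniteDimensional k A] :
    ∃ Λ : A, Λ ≠ 0 ∧ ∀ a : A, a * Λ = counit (R := k) a • Λ := by
  have : Nontrivial A := (Bialgebra.counitAlgHom k A).toRingHom.domain_nontrivial
  let e := Module.finBasis k A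
  let u : Fin (Module.finrank k A) → DualRep k A := fun s => e.coord s
  -- The element `c` corresponds to the identity of `A`. It is invariant for the diagonal action
  -- because a₁ S(a₂) = ε(a).
  let c : A ⊗[k] DualRep k A := ∑ s, e s ⊗ₜ[k] u s
  have hc : ∀ y, DualRep.contract k A y c = y := fun y => by
    rw [map_sum]
    exact e.sum_repr y
  have hac : ∀ a : A, diagAct A (DualRep k A) a c = counit (R := k) a • c := fun a => by
    rw [← sub_eq_zero]
    refine DualRep.eq_zero_of_contract fun y => ?_
    rw [map_sub, DualRep.contract_diagAct, map_smul, hc]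
    simp only [hc, ← mul_assoc]
    rw [← Finset.sum_mul, sum_mul_antipode_eq_smul, smul_mul_assoc, one_mul, sub_self]
  -- Untwisting turns invariance for the diagonal action into invariance for left multiplication on
  -- the first factor, so every contraction of the untwisted element is a left integral.
  have hw : ∀ a : A, a • diagInv k A (DualRep k A) c =
      counit (R := k) a • diagInv k A (DualRep k A) c := fun a => by
    apply (diagMap_bijective k A (DualRep k A)).1
    rw [diagMap_lsmul, map_smul, diagMap_diagInv, hac]
  obtain ⟨y, hy⟩ : ∃ y, DualRep.contract k A y (diagInv k A (DualRep k A) c) ≠ 0 := by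
    by_contra! h
    have h0 := congrArg (diagMap k A (DualRep k A)) (DualRep.eq_zero_of_contract h)
    rw [diagMap_diagInv, map_zero] at h0
    have h1 := hc 1
    rw [h0, map_zero] at h1
    exact zero_ne_one h1
  refine ⟨_, hy, fun a => ?_⟩
  rw [← DualRep.contract_lsmul, hw, map_smul]

/-- Writing `y ⊗ 1` as the sum of (1 ⊗ y₂) σ(y₁), the integral property replaces σ(y₁) σ(Λ) by ε(y₁)
σ(Λ), and the counit axiom recombines the terms. -/
theorem tmul_one_mul_sigma {Λ : A} (hΛ : ∀ a : A, a * Λ = counit (R := k) a • Λ) (y : A) :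
    (y ⊗ₜ[k] 1 : Env k A) * sigma k A Λ = (1 ⊗ₜ[k] MulOpposite.op y) * sigma k A Λ := by
  rw [← sum_op_mul_sigma, Finset.sum_mul]
  have h : ∀ i, (1 ⊗ₜ[k] MulOpposite.op ((ℛ k y).right i) : Env k A) *
      sigma k A ((ℛ k y).left i) * sigma k A Λ =
      (1 ⊗ₜ[k] MulOpposite.op (counit (R := k) ((ℛ k y).left i) • (ℛ k y).right i) : Env k A) *
        sigma k A Λ := fun i => by
    rw [mul_assoc, ← map_mul, hΛ, map_smul, MulOpposite.op_smul, TensorProduct.tmul_smul,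
      mul_smul_comm, smul_mul_assoc]
  rw [Finset.sum_congr rfl fun i _ => h i, ← Finset.sum_mul, ← TensorProduct.tmul_sum,
    ← Finset.op_sum, sum_counit_smul]

/-! ### The Frobenius isomorphism -/

variable (k A) in
/-- A finite dimensional Hopf algebra is a Frobenius algebra. -/
theorem exists_frobenius [FiniteDimensional k A] :
    ∃ Ψ : (A →ₗ[k] k) ≃ₗ[k] A, ∀ (y : A) g, Ψ (g ∘ₗ LinearMap.mulRight k y) = y * Ψ g := by
  obtain ⟨Λ, hΛ0, hΛ⟩ := exists_integral k A
  -- `F g` applies `g` to the second tensor factor, so that Ψ(g) is the sum of g(S(Λ₂)) Λ₁. The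
  -- equivariance of Ψ is the symmetry of σ(Λ) seen through `F`.
  let F : (A →ₗ[k] k) →ₗ[k] Env k A →ₗ[k] A :=
    { toFun := fun g => TensorProduct.lift
        (((LinearMap.lsmul k A).comp (g ∘ₗ (MulOpposite.opLinearEquiv k).symm.toLinearMap)).flip)
      map_add' := fun f g => TensorProduct.ext' fun a b => add_smul (f b.unop) (g b.unop) a
      map_smul' := fun c g => TensorProduct.ext' fun a b => mul_smul c (g b.unop) a }
  have hF : ∀ g a b, F g (a ⊗ₜ MulOpposite.op b) = g b • a := fun _ _ _ => rfl
  let Ψ : (A →ₗ[k] k) →ₗ[k] A := F.flip (sigma k A Λ)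
  have hF1 : ∀ g y t, F g ((y ⊗ₜ[k] 1 : Env k A) * t) = y * F g t := fun g y t => by
    induction t using TensorProduct.induction_on with
    | zero => rw [mul_zero, map_zero, mul_zero]
    | add s t hs ht => rw [mul_add, map_add, map_add, mul_add, hs, ht]
    | tmul a b =>
      obtain ⟨b, rfl⟩ := MulOpposite.op_surjective b
      rw [Algebra.TensorProduct.tmul_mul_tmul, one_mul, hF, hF, mul_smul_comm]
  have hF2 : ∀ g y t, F g ((1 ⊗ₜ[k] MulOpposite.op y : Env k A) * t) =
      F (g ∘ₗ LinearMap.mulRight k y) t := fun g y t => by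
    induction t using TensorProduct.induction_on with
    | zero => rw [mul_zero, map_zero, map_zero]
    | add s t hs ht => rw [mul_add, map_add, map_add, hs, ht]
    | tmul a b =>
      obtain ⟨b, rfl⟩ := MulOpposite.op_surjective b
      rw [Algebra.TensorProduct.tmul_mul_tmul, one_mul, ← MulOpposite.op_mul, hF, hF]
      rfl
  have hΨ : ∀ (y : A) g, Ψ (g ∘ₗ LinearMap.mulRight k y) = y * Ψ g := fun y g => by
    change F _ (sigma k A Λ) = y * F g (sigma k A Λ)
    rw [← hF1, tmul_one_mul_sigma hΛ, hF2]
  have hΨ' : ∀ g, Ψ g = ∑ i ∈ (ℛ k Λ).index, g (antipode k ((ℛ k Λ).right i)) • (ℛ k Λ).left i :=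
    fun g => by
      change F g (sigma k A Λ) = _
      rw [sigma_eq_sum k A Λ (ℛ k Λ), map_sum]
      rfl
  have hinj : Function.Injective Ψ := by
    refine (injective_iff_map_eq_zero Ψ).2 fun g hg => ?_
    -- Since Ψ(g) = 0, equivariance kills Ψ on all translates of `g`, and these values are the
    -- contractions of the twist of `Λ ⊗ g`. As the twist is injective and Λ is nonzero, `g`
    -- vanishes.
    have h0 : diagMap k A (DualRep k A) (Λ ⊗ₜ (show DualRep k A from g)) = 0 := by
      refine DualRep.eq_zero_of_contract fun y => ?_
      have h1 := hΨ y g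
      rw [hg, mul_zero, hΨ'] at h1
      rw [diagMap_tmul_eq, map_sum]
      exact h1
    have h2 : Λ ⊗ₜ[k] (show DualRep k A from g) = 0 :=
      (diagMap_bijective k A (DualRep k A)).1 (h0.trans (map_zero _).symm)
    obtain ⟨f, hf⟩ : ∃ f : A →ₗ[k] k, f Λ ≠ 0 := by
      by_contra! h
      exact hΛ0 ((Module.forall_dual_apply_eq_zero_iff k Λ).1 h)
    have h3 := congrArg (TensorProduct.lift ((LinearMap.lsmul k (DualRep k A)).comp f)) h2
    rw [map_zero] at h3
    exact (smul_eq_zero.1 (show f Λ • (show DualRep k A from g) = 0 from h3)).resolve_left hf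
  exact ⟨LinearEquiv.ofInjectiveOfFinrankEq Ψ hinj Subspace.dual_finrank_eq, hΨ⟩

end Frobenius

section Existence

variable {k : Type u} {A : Type v} [Field k] [Ring A] [HopfAlgebra k A] [FiniteDimensional k A]

/-! ### Self-injectivity -/

/-- The map `M → A` given by a linear functional on `M` and a Frobenius isomorphism. -/
noncomputable def frobeniusHom {Ψ : (A →ₗ[k] k) ≃ₗ[k] A}
    (hΨ : ∀ (y : A) g, Ψ (g ∘ₗ LinearMap.mulRight k y) = y * Ψ g)
    {M : Type*} [AddCommGroup M] [Module k M] [Module A M] [IsScalarTower k A M] (ξ : M →ₗ[k] k) :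
    M →ₗ[A] A where
  toFun m := Ψ (ξ ∘ₗ (LinearMap.toSpanSingleton A M m).restrictScalars k)
  map_add' m m' := by
    rw [← map_add]
    congr 1
    ext x
    simp
  map_smul' y m := by
    rw [RingHom.id_apply, smul_eq_mul, ← hΨ]
    congr 1
    ext x
    simp [mul_smul]

/-- Over a finite dimensional Hopf algebra `A`, exact complexes are `Hom(-, A)`-acyclic. -/
theorem IsExactComplex.homAcyclic {S : ℤ → Type*} [∀ i, AddCommGroup (S i)]
    [∀ i, Module k (S i)] [∀ i, Module A (S i)] [∀ i, IsScalarTower k A (S i)]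
    {d : ∀ i j, S i →ₗ[A] S j} (hd : IsExactComplex d) : HomAcyclic (RingHom.id A) d A := by
  obtain ⟨Ψ, hΨ⟩ := exists_frobenius k A
  intro i j l hi hj g hg
  -- The Frobenius isomorphism encodes the `A`-linear map `g` as the functional ξ, reducing the
  -- extension problem to linear algebra over the field.
  let ξ : S j →ₗ[k] k := LinearMap.applyₗ (R := k) (1 : A) ∘ₗ Ψ.symm.toLinearMap ∘ₗ
    (LinearMap.restrictScalars k (S := A) g)
  have hξ : ∀ y, ξ y = Ψ.symm (g y) 1 := fun _ => rfl
  -- ξ vanishes on the kernel of the differential, which consists of boundaries, and so extends over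
  -- its image.
  have hmem : ξ ∈ LinearMap.range ((d j l).restrictScalars k).dualMap := by
    rw [LinearMap.range_dualMap_eq_dualAnnihilator_ker, Submodule.mem_dualAnnihilator]
    intro y hy
    obtain ⟨x, rfl⟩ := (hd i j l hi hj y).1 hy
    rw [hξ, hg, map_zero, LinearMap.zero_apply]
  obtain ⟨ξ', hξ'⟩ := hmem
  refine ⟨frobeniusHom hΨ ξ', fun y => ?_⟩
  change Ψ _ = g y
  rw [← Ψ.apply_symm_apply (g y)]
  congr 1
  ext x
  have h1 := LinearMap.congr_fun hξ' (x • y)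
  change ξ' (d j l (x • y)) = _ at h1
  rw [hξ, map_smul (d j l), map_smul g, smul_eq_mul] at h1
  change ξ' (x • d j l y) = _
  rw [h1]
  have h2 := hΨ x (Ψ.symm (g y))
  rw [Ψ.apply_symm_apply] at h2
  rw [← h2, Ψ.symm_apply_apply, LinearMap.comp_apply, LinearMap.mulRight_apply,
    one_mul]

variable (k) in
/-- Every finitely generated module over a finite dimensional Hopf algebra embeds in a free module
of finite rank. -/
theorem exists_embedding (M : Type*) [AddCommGroup M] [Module k M] [Module A M]
    [IsScalarTower k A M] [Module.Finite A M] :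
    ∃ (n : ℕ) (f : M →ₗ[A] (Fin n → A)), Function.Injective f := by
  obtain ⟨Ψ, hΨ⟩ := exists_frobenius k A
  have : FiniteDimensional k M := Module.Finite.trans A M
  let b := Module.finBasis k M
  -- Each coordinate functional gives an `A`-linear map to `A`. If all of them vanish at `m`,
  -- evaluating the underlying functionals at `1` shows that every coordinate of `m` is zero.
  refine ⟨_, LinearMap.pi fun s => frobeniusHom hΨ (b.coord s),
    (injective_iff_map_eq_zero _).2 fun m hm => ?_⟩
  refine b.forall_coord_eq_zero_iff.1 fun s => ?_
  have h := congrFun hm s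
  change Ψ _ = 0 at h
  rw [LinearEquiv.map_eq_zero_iff] at h
  simpa using LinearMap.congr_fun h 1

/-! ### Existence of complete resolutions -/

/-- A short exact sequence from `K'` to `K` through a finitely generated projective module. -/
structure ProjectiveExtension (K K' : ModuleCat.{v} A) where
  /-- the middle term -/
  mid : ModuleCat.{v} A
  /-- the injection -/
  i : K' →ₗ[A] mid
  /-- the surjection -/
  p : mid →ₗ[A] K
  finite : Module.Finite A mid
  projective : Module.Projective A mid
  injective : Function.Injective i
  surjective : Function.Surjective p
  exact : Function.Exact i p

/-- Upwards one takes kernels of free covers, finitely generated since `A` is Noetherian; downwards,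
cokernels of embeddings in finite free modules, which the Frobenius property supplies. -/
theorem exists_projectiveExtensions (k : Type u) {A : Type v} [Field k] [Ring A] [HopfAlgebra k A]
    [FiniteDimensional k A] (K₀ : ModuleCat.{v} A) [Module.Finite A K₀] :
    ∃ K : ℤ → ModuleCat.{v} A, K 0 = K₀ ∧
      ∀ i, Nonempty (ProjectiveExtension (K i) (K (i + 1))) := by
  have : IsNoetherianRing A := isNoetherian_of_tower k inferInstance
  refine exists_int_seq (α := fun _ => ModuleCat.{v} A) (fun _ K => Module.Finite A K)
    (fun _ K K' => Nonempty (ProjectiveExtension K K')) (fun _ K hK => ?_) (fun _ K hK => ?_)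
    0 K₀ ‹_›
  · obtain ⟨n, f, hf⟩ := Module.Finite.exists_fin' A K
    exact ⟨ModuleCat.of A (LinearMap.ker f), ⟨{
      mid := ModuleCat.of A (Fin n → A)
      i := (LinearMap.ker f).subtype
      p := f
      finite := inferInstanceAs (Module.Finite A (Fin n → A))
      projective := inferInstanceAs (Module.Projective A (Fin n → A))
      injective := Subtype.val_injective
      surjective := hf
      exact := LinearMap.exact_subtype_ker_map f }⟩,
      inferInstanceAs (Module.Finite A (LinearMap.ker f))⟩
  · obtain ⟨n, f, hf⟩ := exists_embedding k (A := A) K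
    exact ⟨ModuleCat.of A ((Fin n → A) ⧸ LinearMap.range f), ⟨{
      mid := ModuleCat.of A (Fin n → A)
      i := f
      p := (LinearMap.range f).mkQ
      finite := inferInstanceAs (Module.Finite A (Fin n → A))
      projective := inferInstanceAs (Module.Projective A (Fin n → A))
      injective := hf
      surjective := Submodule.mkQ_surjective _
      exact := LinearMap.exact_map_mkQ_range f }⟩,
      inferInstanceAs (Module.Finite A ((Fin n → A) ⧸ LinearMap.range f))⟩

variable (k A) in
/-- The counit, as a map of `A`-modules. -/
noncomputable def counitHom : A →ₗ[A] Triv k A := LinearMap.toSpanSingleton A (Triv k A) (1 : k)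

theorem counitHom_surjective : Function.Surjective (counitHom k A) := fun (c : k) => by
  refine ⟨algebraMap k A c, ?_⟩
  change (Coalgebra.counit (R := k) (algebraMap k A c) * 1 : k) = c
  rw [mul_one, Bialgebra.counit_algebraMap]

variable (k A) in
/-- Complete resolutions of the trivial module exist. -/
theorem CompleteResolution.nonempty_triv : Nonempty (CompleteResolution A (Triv k A)) := by
  -- The trivial module lives in the universe of `k`, so the splicing starts from its model in the
  -- universe of `A`, the quotient by the augmentation ideal.
  obtain ⟨K, hK0, hE⟩ := exists_projectiveExtensions k
    (ModuleCat.of A (A ⧸ LinearMap.ker (counitHom k A)))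
  have E := fun i => (hE i).some
  obtain ⟨ε, hε⟩ : ∃ ε : K 0 →ₗ[A] Triv k A, Function.Bijective ε := by
    rw [hK0]
    exact ⟨((counitHom k A).quotKerEquivOfSurjective counitHom_surjective).toLinearMap,
      LinearEquiv.bijective _⟩
  have hcomp : ∀ n, Function.Exact ((E n).i ∘ₗ (E (n + 1)).p) (E n).p := fun n x => by
    rw [(E n).exact x, LinearMap.coe_comp, (E (n + 1)).surjective.range_comp]
  have hd : ∀ n, Function.Exact ((E (n + 1)).i ∘ₗ (E (n + 1 + 1)).p) ((E n).i ∘ₗ (E (n + 1)).p) :=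
    fun n x => by
      rw [← hcomp (n + 1) x]
      exact map_eq_zero_iff _ (E n).injective
  let C : ChainComplex (ModuleCat.{v} A) ℤ := ChainComplex.of (fun n => (E n).mid)
    (fun n => ModuleCat.ofHom ((E n).i ∘ₗ (E (n + 1)).p)) fun n => by
      ext x
      exact (hd n).apply_apply_eq_zero x
  have hCd : ∀ n, C.d (n + 1) n = ModuleCat.ofHom ((E n).i ∘ₗ (E (n + 1)).p) := fun n =>
    ChainComplex.of_d (fun n => (E n).mid)
      (fun n => ModuleCat.ofHom ((E n).i ∘ₗ (E (n + 1)).p)) n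
  have hC : IsExactComplex fun i j => (C.d i j).hom := by
    rintro _ _ l rfl rfl
    beta_reduce
    rw [hCd, hCd]
    exact hd l
  have hfin : ∀ n, Module.Finite A (C.X n) := fun n => (E n).finite
  -- Dual exactness needs no construction: it follows from exactness by self-injectivity.
  have hac : HomAcyclic (RingHom.id A) (fun i j => (C.d i j).hom) A := hC.homAcyclic (k := k)
  exact ⟨{
    cx := C
    finite := hfin
    projective := fun n => (E n).projective
    exact := fun n => hC (n + 1) n (n - 1) rfl (by omega)
    dual_exact := fun n g => by
      constructor
      · intro hg
        obtain ⟨h, hh⟩ := hac (n + 1) n (n - 1) rfl (by omega) g fun x => LinearMap.congr_fun hg x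
        exact ⟨h, LinearMap.ext hh⟩
      · rintro ⟨h, rfl⟩
        refine LinearMap.ext fun x => ?_
        change h ((C.d n (n - 1)).hom ((C.d (n + 1) n).hom x)) = 0
        rw [(hC (n + 1) n (n - 1) rfl (by omega)).apply_apply_eq_zero, map_zero]
    aug := ε ∘ₗ (E 0).p
    aug_surjective := hε.2.comp (E 0).surjective
    aug_exact := fun x => by
      have h : (C.d 1 0).hom = (E 0).i ∘ₗ (E (0 + 1)).p := congrArg ModuleCat.Hom.hom (hCd 0)
      rw [h, ← hcomp 0 x]
      exact map_eq_zero_iff ε hε.1 }⟩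

end Existence
end TateHopf

open TateHopf in
theorem corollary7p3 {k : Type u} {A : Type v} [Field k] [Ring A] [HopfAlgebra k A]
    [FiniteDimensional k A] :
    (Nonempty (CompleteResolution A (Triv k A)) ∧ Nonempty (BimoduleResolution k A)) ∧
    ∀ (P : CompleteResolution A (Triv k A)) (X : BimoduleResolution k A),
      (Nonempty (DiagonalApprox P) ∧ Nonempty (BimoduleDiagonalApprox X) ∧
        Nonempty (Comparison P X)) ∧
      ∀ (Γ : DiagonalApprox P) (Γ' : BimoduleDiagonalApprox X) (ι : Comparison P X),
        (∀ n, Function.Bijective (ι.toAdjoint n)) ∧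
        ∃ (T : DirectSum.GRing (Tate P (Triv k A))) (H : DirectSum.GRing (TateHochschild X)),
          (∀ i j (x : Tate P (Triv k A) i) (y : Tate P (Triv k A) j),
            T.mul x y = Tate.cup Γ i j x y) ∧
          (∀ i j (x : TateHochschild X i) (y : TateHochschild X j),
            H.mul x y = TateHochschild.cup Γ' i j x y) ∧
          ∃ θ : (⨁ n, Tate P (Triv k A) n) →+* ⨁ n, TateHochschild X n,
            (∀ n (x : Tate P (Triv k A) n), ∃ y : TateHochschild X n,
              θ (DirectSum.of _ n x) = DirectSum.of _ n y ∧
                ι.toAdjoint n y = CompleteResolution.Ext.coeffMap P (unitHom k A) n x) ∧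
            Function.Injective θ ∧
            letI : Module (⨁ n, Tate P (Triv k A) n) (⨁ n, TateHochschild X n) :=
              Module.compHom _ θ
            ∃ N : Submodule (⨁ n, Tate P (Triv k A) n) (⨁ n, TateHochschild X n),
              (∀ y ∈ N, ∀ n, DirectSum.of (TateHochschild X) n (y n) ∈ N) ∧
              IsCompl (LinearMap.range (linearOfRingHom θ)) N := by
  have hσ := fun P : CompleteResolution A (Triv k A) => homAcyclic_sigma k A P.homAcyclic
  obtain ⟨P₀⟩ := CompleteResolution.nonempty_triv k A
  refine ⟨⟨⟨P₀⟩, ⟨inducedResolution P₀ (hσ P₀)⟩⟩, fun P X =>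
    ⟨⟨DiagonalApprox.nonempty P, BimoduleDiagonalApprox.nonempty X,
      Comparison.nonempty P X (hσ P)⟩, fun Γ Γ' ι => ?_⟩⟩
  have hρ := ι.toAdjoint_bijective (hσ P)
  exact ⟨hρ, exists_gRing_theta ι (hσ P) Γ Γ' hρ⟩
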